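/- **Definitions.** A quadrant is a closed set of one of the four forms $\{(a,b): a\ge x,\ b\le y\}$ (southeast), $\{a\le x,\ b\le y\}$ (southwest), $\{a\ge x,\ b\ge y\}$ (northeast), $\{a\le x,\ b\ge y\}$ (northwest), with vertex $(x,y)\in\mathbb R^2$. An instance $(S,\mathcal Q)$ of quadrant set cover consists of a finite set $S\subset\mathbb R^2$ and a finite set $\mathcal Q$ of quadrants. A set cover is a multiset $\mathcal Q'$ of elements of $\mathcal Q$ such that every point of $S$ lies in some element of $\mathcal Q'$; $|\mathcal Q'|$ counts multiplicities, and $\mathsf{opt}(S,\mathcal Q)$ is the minimum size of a set cover (if there is one). In the partially dynamic setting the point set is changed by a sequence of updates, each of which inserts a point into $S$ or deletes a point from $S$, while $\mathcal Q$ stays fixed. A $c$-approximate partially dynamic quadrant set cover data structure is a program that constructs a data structure from an initial instance (given as a list of points and a list of quadrants, without repetitions), then processes the updates one at a time, as they arrive, and stores implicitly, initially and after each update, a set cover $\mathcal Q'$ of the current instance $(S,\mathcal Q)$ with $|\mathcal Q'|\le c\cdot\mathsf{opt}(S,\mathcal Q)$ whenever the current instance has a set cover. At each such time it answers * the size query (report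 $|\mathcal Q'|$) in $O(1)$ time, * a membership query (report, for a given $Q\in\mathcal Q$, the multiplicity of $Q$ in $\mathcal Q'$) in $O(1+\log(1+|\mathcal Q'|))$ time, * the reporting query (list all elements of $\mathcal Q'$, with multiplicity) in $O(1+|\mathcal Q'|)$ time; whenever the current instance has no set cover, it answers each of these queries in $O(1)$ time by saying that there is no solution. Time is counted in elementary steps of a real-valued pointer machine: a word is null, a real number, or a pointer to a memory cell that holds two words. A program is a finite list of first-order, possibly recursive functions; each variable access, constant ($0$, $1$ or null), addition or subtraction or comparison ($\le$) of two reals, test whether a word is a pointer, allocation of a cell, reading of a field of a cell, binding of a local variable, and function call is one step. Cells are never overwritten (so the program is even purely functional). **Theorem.** There is an $O(1)$-approximate partially dynamic quadrant set cover data structure with $\widetilde O(1)$ amortized update time and $\widetilde O(n_0)$ construction time, where $n_0$ is the size of the initial instance. Precisely: there are a program $D$ and constants $c,C\in\mathbb R$ and $k\in\mathbb N$ such that, for every initial instance $(S_0,\mathcal Q)$ with $n_0=|S_0|+|\mathcal Q|$ and every infinite sequence of point updates (whose finite prefixes give all finite sequences), $D$ is a $c$-approximate partially dynamic quadrant set cover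 data structure in the above sense (with $C$ as the constant in all query times); its construction takes at most $C\,(n_0+1)\log^k(n_0+2)$ steps; and for every $m\ge 0$ the first $m$ updates take together at most $\sum_{i=1}^{m} C\log^k(n_i+2)$ steps, where $n_i=|S_i|+|\mathcal Q|$ and $S_i$ is the point set after the $i$-th update. -/

import Mathlib

namespace QuadrantSetCover

/-! ### The machine model

A real-valued pointer machine without destructive updates (pure Lisp with real atoms). -/

/-- A machine word: the null pointer, a real number, or a pointer to a memory cell with two words.
Cells are never overwritten, so the tree that is reachable from a word determines it. -/
inductive Val : Type
  | nil : Val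
  | real (r : ℝ) : Val
  | pair (a b : Val) : Val

/-- First-order programs. Variables are de Bruijn indices into the local environment.
The only constants are null, `0` and `1`; the only operations on reals are `+`, `-` and `≤`. -/
inductive Expr : Type
  | var (i : ℕ) : Expr
  | nil : Expr
  | zero : Expr
  | one : Expr
  | add (a b : Expr) : Expr
  | sub (a b : Expr) : Expr
  | pair (a b : Expr) : Expr
  | fst (a : Expr) : Expr
  | snd (a : Expr) : Expr
  /-- bind the value of `a` as variable `0` in `b` -/
  | letIn (a b : Expr) : Expr
  /-- test whether `a` is a pointer to a cell -/
  | ifPair (a b c : Expr) : Expr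
  /-- compare the reals `a ≤ b` -/
  | ifLe (a b c d : Expr) : Expr
  /-- call the (possibly recursive) function number `f` with one argument -/
  | call (f : ℕ) (a : Expr) : Expr

/-- `Eval P env e v t`: in the program with function bodies `P`, the expression `e` evaluates in the
local environment `env` to `v` in exactly `t` steps. Every elementary operation (variable access,
constant, arithmetic operation, cell allocation, field access, binding, branch, call) is one step.
The body of a function sees only its argument, so local environments have a length that is bounded
in terms of the program. Ill-typed operations have no value. -/
inductive Eval (P : List Expr) : List Val → Expr → Val → ℕ → Prop
  | var {env : List Val} {i : ℕ} {v : Val} (h : env[i]? = some v) :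
      Eval P env (.var i) v 1
  | nil {env : List Val} : Eval P env .nil .nil 1
  | zero {env : List Val} : Eval P env .zero (.real 0) 1
  | one {env : List Val} : Eval P env .one (.real 1) 1
  | add {env : List Val} {a b : Expr} {x y : ℝ} {s t : ℕ}
      (ha : Eval P env a (.real x) s) (hb : Eval P env b (.real y) t) :
      Eval P env (.add a b) (.real (x + y)) (s + t + 1)
  | sub {env : List Val} {a b : Expr} {x y : ℝ} {s t : ℕ}
      (ha : Eval P env a (.real x) s) (hb : Eval P env b (.real y) t) :
      Eval P env (.sub a b) (.real (x - y)) (s + t + 1)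
  | pair {env : List Val} {a b : Expr} {u v : Val} {s t : ℕ}
      (ha : Eval P env a u s) (hb : Eval P env b v t) :
      Eval P env (.pair a b) (.pair u v) (s + t + 1)
  | fst {env : List Val} {a : Expr} {u v : Val} {s : ℕ}
      (ha : Eval P env a (.pair u v) s) : Eval P env (.fst a) u (s + 1)
  | snd {env : List Val} {a : Expr} {u v : Val} {s : ℕ}
      (ha : Eval P env a (.pair u v) s) : Eval P env (.snd a) v (s + 1)
  | letIn {env : List Val} {a b : Expr} {u v : Val} {s t : ℕ}
      (ha : Eval P env a u s) (hb : Eval P (u :: env) b v t) :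
      Eval P env (.letIn a b) v (s + t + 1)
  | ifPair_pair {env : List Val} {a b c : Expr} {u w v : Val} {s t : ℕ}
      (ha : Eval P env a (.pair u w) s) (hb : Eval P env b v t) :
      Eval P env (.ifPair a b c) v (s + t + 1)
  | ifPair_nil {env : List Val} {a b c : Expr} {v : Val} {s t : ℕ}
      (ha : Eval P env a .nil s) (hc : Eval P env c v t) :
      Eval P env (.ifPair a b c) v (s + t + 1)
  | ifPair_real {env : List Val} {a b c : Expr} {x : ℝ} {v : Val} {s t : ℕ}
      (ha : Eval P env a (.real x) s) (hc : Eval P env c v t) :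
      Eval P env (.ifPair a b c) v (s + t + 1)
  | ifLe_true {env : List Val} {a b c d : Expr} {x y : ℝ} {v : Val} {s t r : ℕ}
      (ha : Eval P env a (.real x) s) (hb : Eval P env b (.real y) t) (hxy : x ≤ y)
      (hc : Eval P env c v r) : Eval P env (.ifLe a b c d) v (s + t + r + 1)
  | ifLe_false {env : List Val} {a b c d : Expr} {x y : ℝ} {v : Val} {s t r : ℕ}
      (ha : Eval P env a (.real x) s) (hb : Eval P env b (.real y) t) (hxy : ¬ x ≤ y)
      (hd : Eval P env d v r) : Eval P env (.ifLe a b c d) v (s + t + r + 1)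
  | call {env : List Val} {f : ℕ} {a body : Expr} {u v : Val} {s t : ℕ}
      (ha : Eval P env a u s) (hf : P[f]? = some body) (hb : Eval P [u] body v t) :
      Eval P env (.call f a) v (s + t + 1)

/-- The machine is deterministic: the result and the number of steps are unique. -/
theorem Eval.unique {P : List Expr} {env : List Val} {e : Expr} {v : Val} {t : ℕ}
    (h : Eval P env e v t) : ∀ {w : Val} {s : ℕ}, Eval P env e w s → v = w ∧ t = s := by
  induction h with
  | var h => intro w s hw; cases hw; simp_all
  | nil => intro w s hw; cases hw; simp
  | zero => intro w s hw; cases hw; simp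
  | one => intro w s hw; cases hw; simp
  | add _ _ i1 i2 | sub _ _ i1 i2 | pair _ _ i1 i2 =>
    intro w s hw
    cases hw
    rename_i h1 h2
    have := i1 h1
    have := i2 h2
    simp_all
  | fst _ i1 | snd _ i1 =>
    intro w s hw
    cases hw
    rename_i h1
    have := i1 h1
    simp_all
  | letIn _ _ i1 i2 =>
    intro w s hw
    cases hw
    rename_i h1 h2
    obtain ⟨rfl, rfl⟩ := i1 h1
    have := i2 h2
    simp_all
  | ifPair_pair _ _ i1 i2 | ifPair_nil _ _ i1 i2 | ifPair_real _ _ i1 i2 =>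
    intro w s hw
    cases hw <;> (rename_i h1 h2; have := i1 h1; simp_all) <;> (have := i2 h2; simp_all)
  | ifLe_true _ _ _ _ i1 i2 i3 | ifLe_false _ _ _ _ i1 i2 i3 =>
    intro w s hw
    cases hw <;> (
      rename_i h3 h1 h2 h4
      obtain ⟨a3, rfl⟩ := i1 h1
      obtain ⟨a4, rfl⟩ := i2 h2
      simp only [Val.real.injEq] at a3 a4
      subst a3 a4) <;>
    first
    | contradiction
    | (have := i3 h4; simp_all)
  | call _ hf _ i1 i2 =>
    intro w s hw
    cases hw
    rename_i hg h1 h2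
    obtain ⟨rfl, rfl⟩ := i1 h1
    rw [hf] at hg
    cases hg
    have := i2 h2
    simp_all

/-- Function number `f` of the program `P`, applied to `input`, returns `output` in `t` steps. -/
def Runs (P : List Expr) (f : ℕ) (input output : Val) (t : ℕ) : Prop :=
  Eval P [input] (.call f (.var 0)) output t

/-! ### Quadrant set cover -/

/-- A point of the plane. -/
abbrev Point : Type := ℝ × ℝ

/-- A (closed) quadrant of one of the four types, with vertex `(x, y)`: it extends to the east if
`east`, else to the west, and to the north if `north`, else to the south. -/
@[ext] structure Quadrant : Type where
  x : ℝ
  y : ℝ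
  east : Bool
  north : Bool

noncomputable instance : DecidableEq Quadrant := Classical.decEq _

/-- The quadrant as a set of points. -/
def Quadrant.toSet (q : Quadrant) : Set Point :=
  {p | (if q.east then q.x ≤ p.1 else p.1 ≤ q.x) ∧ (if q.north then q.y ≤ p.2 else p.2 ≤ q.y)}

/-- The multiset `R` is a set cover for the instance `(S, Q)`. -/
def IsSetCover (S : Finset Point) (Q : Finset Quadrant) (R : Multiset Quadrant) : Prop :=
  (∀ q ∈ R, q ∈ Q) ∧ ∀ p ∈ S, ∃ q ∈ R, p ∈ q.toSet

/-- The instance `(S, Q)` has a set cover. -/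
def Feasible (S : Finset Point) (Q : Finset Quadrant) : Prop :=
  ∃ R : Multiset Quadrant, IsSetCover S Q R

/-- The optimum: the minimum size of a set cover (only used for feasible instances). -/
noncomputable def opt (S : Finset Point) (Q : Finset Quadrant) : ℕ :=
  sInf {k : ℕ | ∃ R : Multiset Quadrant, IsSetCover S Q R ∧ Multiset.card R = k}

/-- An update; only points are updated. -/
inductive Update : Type
  | insert (p : Point) : Update
  | delete (p : Point) : Update

/-- The effect of an update on the point set. -/
noncomputable def Update.apply (S : Finset Point) : Update → Finset Point
  | .insert p => Insert.insert p S
  | .delete p => S.erase p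

/-- The point set after the first `i` updates of the sequence `ops`, starting from `S`. -/
noncomputable def pointsAt (S : Finset Point) (ops : ℕ → Update) : ℕ → Finset Point
  | 0 => S
  | i + 1 => (ops i).apply (pointsAt S ops i)

/-! ### Encodings of the input and the output -/

def encBool : Bool → Val
  | true => .pair .nil .nil
  | false => .nil

def encPoint (p : Point) : Val := .pair (.real p.1) (.real p.2)

def encQuadrant (q : Quadrant) : Val :=
  .pair (.pair (encBool q.east) (encBool q.north)) (.pair (.real q.x) (.real q.y))

/-- Null-terminated linked lists. -/
def encList {α : Type} (enc : α → Val) : List α → Val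
  | [] => .nil
  | a :: l => .pair (enc a) (encList enc l)

def encInstance (ps : List Point) (qs : List Quadrant) : Val :=
  .pair (encList encPoint ps) (encList encQuadrant qs)

/-- The answer to queries while there is no set cover. It is neither a number nor the encoding of a
list of quadrants. -/
def noSolution : Val := .pair .nil .nil

/-! ### Partially dynamic data structures -/

/-- A program that implements a partially dynamic data structure: the function bodies, and the
numbers of the functions that perform the construction, the updates and the queries. -/
structure Implementation : Type where
  code : List Expr
  construct : ℕ
  insert : ℕ
  delete : ℕ
  sizeQuery : ℕ
  membershipQuery : ℕ
  reportingQuery : ℕ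

/-- The update `u` turns the stored data structure `st` into `st'` in `t` steps. -/
def Implementation.RunsUpdate (D : Implementation) (st : Val) : Update → Val → ℕ → Prop
  | .insert p, st', t => Runs D.code D.insert (.pair st (encPoint p)) st' t
  | .delete p, st', t => Runs D.code D.delete (.pair st (encPoint p)) st' t

/-- The stored data structure `st` implicitly stores the multiset `R` of quadrants of `Q`: the size
query takes `O(1)`, a membership query `O(log |R|)` and the reporting query `O(|R|)` steps,
with `C` the constant in the bounds. -/
def Implementation.Stores (D : Implementation) (C : ℝ) (Q : Finset Quadrant) (st : Val)
    (R : Multiset Quadrant) : Prop :=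
  (∃ t : ℕ, Runs D.code D.sizeQuery st (.real (Multiset.card R)) t ∧ (t : ℝ) ≤ C) ∧
  (∀ q ∈ Q, ∃ t : ℕ,
    Runs D.code D.membershipQuery (.pair st (encQuadrant q)) (.real (Multiset.count q R)) t ∧
    (t : ℝ) ≤ C * (1 + Real.log (1 + Multiset.card R))) ∧
  (∃ (l : List Quadrant) (t : ℕ), (l : Multiset Quadrant) = R ∧
    Runs D.code D.reportingQuery st (encList encQuadrant l) t ∧
    (t : ℝ) ≤ C * (1 + Multiset.card R))

/-- All queries to the stored data structure `st` answer, in `O(1)` steps, that there is no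
solution. -/
def Implementation.ReportsNoSolution (D : Implementation) (C : ℝ) (Q : Finset Quadrant)
    (st : Val) : Prop :=
  (∃ t : ℕ, Runs D.code D.sizeQuery st noSolution t ∧ (t : ℝ) ≤ C) ∧
  (∀ q ∈ Q, ∃ t : ℕ, Runs D.code D.membershipQuery (.pair st (encQuadrant q)) noSolution t ∧
    (t : ℝ) ≤ C) ∧
  (∃ t : ℕ, Runs D.code D.reportingQuery st noSolution t ∧ (t : ℝ) ≤ C)

/-- The stored data structure `st` maintains a `c`-approximate set cover for `(S, Q)`. -/
def Implementation.Maintains (D : Implementation) (c C : ℝ) (S : Finset Point)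
    (Q : Finset Quadrant) (st : Val) : Prop :=
  (Feasible S Q → ∃ R : Multiset Quadrant, IsSetCover S Q R ∧
    (Multiset.card R : ℝ) ≤ c * (opt S Q : ℝ) ∧ D.Stores C Q st R) ∧
  (¬ Feasible S Q → D.ReportsNoSolution C Q st)

end QuadrantSetCover

namespace QuadrantSetCover

/-! ### Program verification: weakest preconditions with time -/

/-! Set cover by quadrants reduces, up to a factor of four, to piercing intervals. For a point `p`
in some quadrant, let its span be the interval generated by `p.1` and the first coordinates of the
vertices of all quadrants that contain `p`. A quadrant containing `p` has its vertex above or below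
the span (`ValidTables.x_mem_Icc`), so the vertices of any cover pierce all spans, and the piercing
number is at most the optimum. Conversely, fix a vertical line at `z` and take, for each of the four
types, a quadrant that reaches furthest vertically among those that meet the line. These at most
four quadrants contain every point whose span contains `z` (`ValidTables.exists_mem_coverQs`).

An optimal piercing is found greedily: the next breakpoint is the least right end among the spans
that start beyond the last breakpoint. In a search tree ordered by left ends, with the minimum right
end of each subtree, a breakpoint costs one query. Hence a new cover takes time proportional to the
number of breakpoints, up to logarithms, and not to the number of points (`computes_greedy`,
`computes_rebuild`).

Updates are lazy. Let `k` be the number of breakpoints at the last rebuilding and `cnt` the number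
of updates since. An insertion adds the quadrants chosen on the vertical line through the new point;
a deletion leaves the cover alone. Every cover of the current points has size at least `k - cnt`,
and the stored one has size at most `4 * (k + cnt)`. As long as `2 * cnt ≤ k`, this gives a factor
of 12 (`Inv.maintains`). When the condition fails, the cover is rebuilt. The new number of
breakpoints is at most the size of the old cover, which is then linear in `cnt`, so that the updates
since the last rebuilding pay (`computes_finish`).

Points in no quadrant are kept in a separate tree and are not counted in `cnt`; a cover exists
exactly when that tree is empty (`Inv.U_eq_leaf_iff`).

On the machine side, each function body is shown to compute a mathematical function such as
`AVL.ins`, `info` or `coverQs` within a time bound, by symbolic execution with `wp`; balanced trees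
then make the bounds logarithmic. -/

/-- `w` is a real number that satisfies `Q`. -/
def Val.onReal : Val → (ℝ → Prop) → Prop
  | .real x, Q => Q x
  | _, _ => False

/-- `w` is a pair that satisfies `Q`. -/
def Val.onPair : Val → (Val → Val → Prop) → Prop
  | .pair a b, Q => Q a b
  | _, _ => False

/-- Case distinction on whether `w` is a pair. -/
def Val.casesPair : Val → Prop → Prop → Prop
  | .pair _ _, A, _ => A
  | _, _, B => B

/-- Function `f` of `P` returns on input `u` a value `v` in a number `t` of steps with `R v t`. -/
def Calls (P : List Expr) (f : ℕ) (u : Val) (R : Val → ℕ → Prop) : Prop :=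
  ∃ body v t, P[f]? = some body ∧ Eval P [u] body v t ∧ R v t

/-- Evaluation of the expression that starts at time `n` ends with a value and a time that
satisfy `Q`. -/
def wp (P : List Expr) : Expr → List Val → ℕ → (Val → ℕ → Prop) → Prop
  | .var i, env, n, Q => ∃ v, env[i]? = some v ∧ Q v (n + 1)
  | .nil, _, n, Q => Q .nil (n + 1)
  | .zero, _, n, Q => Q (.real 0) (n + 1)
  | .one, _, n, Q => Q (.real 1) (n + 1)
  | .add a b, env, n, Q => wp P a env n fun u s => wp P b env s fun v t =>
      u.onReal fun x => v.onReal fun y => Q (.real (x + y)) (t + 1)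
  | .sub a b, env, n, Q => wp P a env n fun u s => wp P b env s fun v t =>
      u.onReal fun x => v.onReal fun y => Q (.real (x - y)) (t + 1)
  | .pair a b, env, n, Q => wp P a env n fun u s => wp P b env s fun v t =>
      Q (.pair u v) (t + 1)
  | .fst a, env, n, Q => wp P a env n fun u s => u.onPair fun x _ => Q x (s + 1)
  | .snd a, env, n, Q => wp P a env n fun u s => u.onPair fun _ y => Q y (s + 1)
  | .letIn a b, env, n, Q => wp P a env n fun u s => wp P b (u :: env) s fun v t => Q v (t + 1)
  | .ifPair a b c, env, n, Q => wp P a env n fun u s =>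
      u.casesPair (wp P b env s fun v t => Q v (t + 1)) (wp P c env s fun v t => Q v (t + 1))
  | .ifLe a b c d, env, n, Q => wp P a env n fun u s => wp P b env s fun v t =>
      u.onReal fun x => v.onReal fun y =>
        (x ≤ y → wp P c env t fun v t => Q v (t + 1)) ∧
        (¬ x ≤ y → wp P d env t fun v t => Q v (t + 1))
  | .call f a, env, n, Q => wp P a env n fun u s => Calls P f u fun v t => Q v (s + t + 1)

/-- The induction never enters a function body: `Calls` already provides an evaluation of it.
Recursive programs are therefore handled by inductions on their data, one per program. -/
theorem wp_sound {P : List Expr} (e : Expr) : ∀ {env : List Val} {n : ℕ} {Q : Val → ℕ → Prop},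
    wp P e env n Q → ∃ v t, Eval P env e v t ∧ Q v (n + t) := by
  induction e with
  | var i => rintro env n Q ⟨v, h, hQ⟩; exact ⟨v, 1, .var h, hQ⟩
  | nil => intro env n Q h; exact ⟨_, 1, .nil, h⟩
  | zero => intro env n Q h; exact ⟨_, 1, .zero, h⟩
  | one => intro env n Q h; exact ⟨_, 1, .one, h⟩
  | add a b iha ihb =>
    intro env n Q h
    obtain ⟨u, s, hu, h⟩ := iha h
    obtain ⟨v, t, hv, h⟩ := ihb h
    cases u <;> cases v <;> simp only [Val.onReal] at h
    exact ⟨_, _, .add hu hv, by simpa only [add_assoc] using h⟩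
  | sub a b iha ihb =>
    intro env n Q h
    obtain ⟨u, s, hu, h⟩ := iha h
    obtain ⟨v, t, hv, h⟩ := ihb h
    cases u <;> cases v <;> simp only [Val.onReal] at h
    exact ⟨_, _, .sub hu hv, by simpa only [add_assoc] using h⟩
  | pair a b iha ihb =>
    intro env n Q h
    obtain ⟨u, s, hu, h⟩ := iha h
    obtain ⟨v, t, hv, h⟩ := ihb h
    exact ⟨_, _, .pair hu hv, by simpa only [add_assoc] using h⟩
  | fst a iha =>
    intro env n Q h
    obtain ⟨u, s, hu, h⟩ := iha h
    cases u <;> simp only [Val.onPair] at h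
    exact ⟨_, _, .fst hu, by simpa only [add_assoc] using h⟩
  | snd a iha =>
    intro env n Q h
    obtain ⟨u, s, hu, h⟩ := iha h
    cases u <;> simp only [Val.onPair] at h
    exact ⟨_, _, .snd hu, by simpa only [add_assoc] using h⟩
  | letIn a b iha ihb =>
    intro env n Q h
    obtain ⟨u, s, hu, h⟩ := iha h
    obtain ⟨v, t, hv, h⟩ := ihb h
    exact ⟨_, _, .letIn hu hv, by simpa only [add_assoc] using h⟩
  | ifPair a b c iha ihb ihc =>
    intro env n Q h
    obtain ⟨u, s, hu, h⟩ := iha h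
    cases u <;> simp only [Val.casesPair] at h
    · obtain ⟨v, t, hv, h⟩ := ihc h
      exact ⟨_, _, .ifPair_nil hu hv, by simpa only [add_assoc] using h⟩
    · obtain ⟨v, t, hv, h⟩ := ihc h
      exact ⟨_, _, .ifPair_real hu hv, by simpa only [add_assoc] using h⟩
    · obtain ⟨v, t, hv, h⟩ := ihb h
      exact ⟨_, _, .ifPair_pair hu hv, by simpa only [add_assoc] using h⟩
  | ifLe a b c d iha ihb ihc ihd =>
    intro env n Q h
    obtain ⟨u, s, hu, h⟩ := iha h
    obtain ⟨v, t, hv, h⟩ := ihb h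
    cases u <;> cases v <;> simp only [Val.onReal] at h
    rename_i x _ y
    by_cases hxy : x ≤ y
    · obtain ⟨w, r, hw, h⟩ := ihc (h.1 hxy)
      exact ⟨_, _, .ifLe_true hu hv hxy hw, by simpa only [add_assoc] using h⟩
    · obtain ⟨w, r, hw, h⟩ := ihd (h.2 hxy)
      exact ⟨_, _, .ifLe_false hu hv hxy hw, by simpa only [add_assoc] using h⟩
  | call f a iha =>
    intro env n Q h
    obtain ⟨u, s, hu, body, v, t, hf, hv, h⟩ := iha h
    exact ⟨_, _, .call hu hf hv, by simpa only [add_assoc] using h⟩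

/-- The converse of `wp_sound`, which splices an already known evaluation of a subexpression into a
`wp` goal; `Ev.wp` is the form in use. -/
theorem wp_of_eval {P : List Expr} {env : List Val} {e : Expr} {v : Val} {t : ℕ}
    (h : Eval P env e v t) : ∀ {n : ℕ} {Q : Val → ℕ → Prop}, Q v (n + t) → wp P e env n Q := by
  induction h with
  | var h => intro n Q hQ; exact ⟨_, h, hQ⟩
  | nil | zero | one => intro n Q hQ; exact hQ
  | add _ _ ia ib | sub _ _ ia ib | pair _ _ ia ib | letIn _ _ ia ib | ifPair_pair _ _ ia ib
  | ifPair_nil _ _ ia ib | ifPair_real _ _ ia ib =>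
    intro n Q hQ
    exact ia (ib (by simpa only [add_assoc, Val.onReal, Val.onPair, Val.casesPair] using hQ))
  | fst _ ia | snd _ ia =>
    intro n Q hQ
    exact ia (by simpa only [add_assoc, Val.onReal, Val.onPair, Val.casesPair] using hQ)
  | ifLe_true _ _ hxy _ ia ib ic =>
    intro n Q hQ
    exact ia (ib ⟨fun _ => ic (by simpa only [add_assoc, Val.onReal, Val.onPair, Val.casesPair] using hQ), fun h => absurd hxy h⟩)
  | ifLe_false _ _ hxy _ ia ib ic =>
    intro n Q hQ
    exact ia (ib ⟨fun h => absurd h hxy, fun _ => ic (by simpa only [add_assoc, Val.onReal, Val.onPair, Val.casesPair] using hQ)⟩)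
  | call _ hf hb ia =>
    intro n Q hQ
    exact ia ⟨_, _, _, hf, hb, by simpa only [add_assoc, Val.onReal, Val.onPair, Val.casesPair] using hQ⟩

/-- The expression `e` evaluates in the environment `env` to `v` in at most `T` steps. -/
def Ev (P : List Expr) (env : List Val) (e : Expr) (v : Val) (T : ℕ) : Prop :=
  ∃ t, Eval P env e v t ∧ t ≤ T

theorem Ev.of_wp {P : List Expr} {env : List Val} {e : Expr} {v : Val} {T : ℕ}
    (h : wp P e env 0 fun w t => w = v ∧ t ≤ T) : Ev P env e v T := by
  obtain ⟨w, t, he, rfl, ht⟩ := wp_sound e h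
  exact ⟨t, he, by omega⟩

theorem Ev.wp {P : List Expr} {env : List Val} {e : Expr} {v : Val} {T n : ℕ}
    {Q : Val → ℕ → Prop} (h : Ev P env e v T) (hQ : ∀ t ≤ n + T, Q v t) : wp P e env n Q := by
  obtain ⟨t, he, ht⟩ := h
  exact wp_of_eval he (hQ _ (by omega))

attribute [simp] wp Val.onPair Val.onReal Val.casesPair

/-- Function `f` of `P` returns `v` on input `u` in at most `T` steps. -/
def Computes (P : List Expr) (f : ℕ) (u v : Val) (T : ℕ) : Prop :=
  Calls P f u fun w t => w = v ∧ t ≤ T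

theorem Computes.of_wp {P : List Expr} {f : ℕ} {body : Expr} {u v : Val} {T : ℕ}
    (hf : P[f]? = some body) (h : wp P body [u] 0 fun w t => w = v ∧ t ≤ T) :
    Computes P f u v T := by
  obtain ⟨w, t, he, hw⟩ := wp_sound body h
  exact ⟨body, w, t, hf, he, by simpa using hw⟩

theorem Computes.calls {P : List Expr} {f : ℕ} {u v : Val} {T : ℕ} {R : Val → ℕ → Prop}
    (h : Computes P f u v T) (hR : ∀ t ≤ T, R v t) : Calls P f u R := by
  obtain ⟨body, w, t, hf, he, rfl, ht⟩ := h
  exact ⟨body, w, t, hf, he, hR t ht⟩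

theorem Computes.mono {P : List Expr} {f : ℕ} {u v : Val} {T T' : ℕ}
    (h : Computes P f u v T) (hT : T ≤ T') : Computes P f u v T' :=
  h.calls fun _ ht => ⟨rfl, ht.trans hT⟩

theorem Computes.runs {P : List Expr} {f : ℕ} {u v : Val} {T : ℕ}
    (h : Computes P f u v T) : ∃ t, Runs P f u v t ∧ t ≤ T + 2 := by
  obtain ⟨body, w, t, hf, he, rfl, ht⟩ := h
  -- The two extra steps are the access to the input variable and the call itself.
  exact ⟨_, .call (.var rfl) hf he, by omega⟩

/-! ### Keys -/

/-- Keys of search trees, in lexicographic order. -/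
abbrev Key : Type := ℝ ×ₗ ℝ ×ₗ ℝ ×ₗ ℝ

/-- The key with the given components. -/
def mkKey (a b c d : ℝ) : Key := toLex (a, toLex (b, toLex (c, d)))

/-- The nesting of pairs mirrors the nesting of lexicographic products, so that one recursive
comparison program serves every depth. -/
def encLex {α : Type} (enc : α → Val) (p : ℝ ×ₗ α) : Val :=
  .pair (.real (ofLex p).1) (enc (ofLex p).2)

def encKey : Key → Val := encLex (encLex (encLex Val.real))

theorem encKey_mkKey (a b c d : ℝ) : encKey (mkKey a b c d) =
    .pair (.real a) (.pair (.real b) (.pair (.real c) (.real d))) := rfl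

theorem mkKey_lt_mkKey {a b c d a' b' c' d' : ℝ} : mkKey a b c d < mkKey a' b' c' d' ↔
    a < a' ∨ a = a' ∧ (b < b' ∨ b = b' ∧ (c < c' ∨ c = c' ∧ d < d')) := by
  simp [mkKey, Prod.Lex.toLex_lt_toLex]

theorem mkKey_inj {a b c d a' b' c' d' : ℝ} : mkKey a b c d = mkKey a' b' c' d' ↔
    a = a' ∧ b = b' ∧ c = c' ∧ d = d' := by
  simp [mkKey]

/-! ### Search trees -/

/-- Binary search trees, balanced by height. -/
inductive AVL : Type
  | leaf : AVL
  | node (k : Key) (v : ℝ) (l r : AVL) : AVL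

namespace AVL

def height : AVL → ℕ
  | leaf => 0
  | node _ _ l r => max l.height r.height + 1

/-- The minimum of `a` and the values in the tree. -/
noncomputable def minWith : AVL → ℝ → ℝ
  | leaf, a => a
  | node _ v l r, a => min (r.minWith (l.minWith v)) a

/-- Every node stores its height and the minimum value of its subtree. -/
noncomputable def enc : AVL → Val
  | leaf => .nil
  | node k v l r => .pair (.pair (.real (node k v l r).height) (.real (r.minWith (l.minWith v))))
      (.pair (.pair (encKey k) (.real v)) (.pair l.enc r.enc))

/-- The rebalanced tree with left subtree `l`, root `(k, v)` and right subtree `r`. -/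
def bal (l : AVL) (k : Key) (v : ℝ) (r : AVL) : AVL :=
  if l.height ≤ r.height + 1 then
    if r.height ≤ l.height + 1 then node k v l r
    else match r with
      | leaf => node k v l r
      | node kr vr rl rr =>
        if rl.height ≤ rr.height then node kr vr (node k v l rl) rr
        else match rl with
          | leaf => node k v l r
          | node k' v' a b => node k' v' (node k v l a) (node kr vr b rr)
  else match l with
    | leaf => node k v l r
    | node kl vl ll lr =>
      if lr.height ≤ ll.height then node kl vl ll (node k v lr r)
      else match lr with
        | leaf => node k v l r
        | node k' v' a b => node k' v' (node kl vl ll a) (node k v b r)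

noncomputable def ins (k : Key) (v : ℝ) : AVL → AVL
  | leaf => node k v leaf leaf
  | node k' v' l r =>
    if k < k' then bal (ins k v l) k' v' r
    else if k' < k then bal l k' v' (ins k v r)
    else node k v l r

noncomputable def get (k : Key) : AVL → Option ℝ
  | leaf => none
  | node k' v' l r => if k < k' then get k l else if k' < k then get k r else some v'

/-- The entry with the least key of a tree with root `(k, v)` and left subtree `t`. -/
def leftmost (k : Key) (v : ℝ) : AVL → Key × ℝ
  | leaf => (k, v)
  | node k' v' l _ => leftmost k' v' l

def delMin : AVL → AVL
  | leaf => leaf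
  | node _ _ leaf r => r
  | node k v (node k' v' a b) r => bal (delMin (node k' v' a b)) k v r

noncomputable def del (k : Key) : AVL → AVL
  | leaf => leaf
  | node k' v' l r =>
    if k < k' then bal (del k l) k' v' r
    else if k' < k then bal l k' v' (del k r)
    else match r with
      | leaf => l
      | node kr vr rl rr =>
        bal l (leftmost kr vr rl).1 (leftmost kr vr rl).2 (delMin (node kr vr rl rr))

/-- The minimum value among the entries with a key above `k`. -/
noncomputable def query (k : Key) : AVL → Option ℝ
  | leaf => none
  | node k' v' l r =>
    if k < k' then
      match query k l with
      | none => some (r.minWith v')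
      | some m => some (min m (r.minWith v'))
    else query k r

end AVL

/-! ### Programs for search trees -/

def eTrue : Expr := .pair .nil .nil

/-- Lexicographic comparison of a pair of keys. -/
def ltBody : Expr :=
  .ifPair (.fst (.var 0))
    (.ifLe (.fst (.snd (.var 0))) (.fst (.fst (.var 0)))
      (.ifLe (.fst (.fst (.var 0))) (.fst (.snd (.var 0)))
        (.call 0 (.pair (.snd (.fst (.var 0))) (.snd (.snd (.var 0))))) .nil)
      eTrue)
    (.ifLe (.snd (.var 0)) (.fst (.var 0)) .nil eTrue)

def eHeight (t : Expr) : Expr := .ifPair t (.fst (.fst t)) .zero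

def eNodeHeight (l r : Expr) : Expr :=
  .ifLe (eHeight l) (eHeight r) (.add (eHeight r) .one) (.add (eHeight l) .one)

def eMinWith (t a : Expr) : Expr :=
  .ifPair t (.ifLe (.snd (.fst t)) a (.snd (.fst t)) a) a

/-- The node with left subtree `l`, entry `e` and right subtree `r`, for the input `(l, e, r)`. -/
def mkBody : Expr :=
  .letIn (eMinWith (.fst (.var 0)) (.snd (.fst (.snd (.var 0)))))
  (.letIn (eMinWith (.snd (.snd (.var 1))) (.var 0))
  (.letIn (eNodeHeight (.fst (.var 2)) (.snd (.snd (.var 2))))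
    (.pair (.pair (.var 0) (.var 1))
      (.pair (.fst (.snd (.var 3))) (.pair (.fst (.var 3)) (.snd (.snd (.var 3))))))))

def eMk (l e r : Expr) : Expr := .call 1 (.pair l (.pair e r))

def eEntry (t : Expr) : Expr := .fst (.snd t)

def eLeft (t : Expr) : Expr := .fst (.snd (.snd t))

def eRight (t : Expr) : Expr := .snd (.snd (.snd t))

/-- `AVL.bal`, for the input `(l, e, r)`. -/
def balBody : Expr :=
  .ifLe (eHeight (.fst (.var 0))) (.add (eHeight (.snd (.snd (.var 0)))) .one)
    (.ifLe (eHeight (.snd (.snd (.var 0)))) (.add (eHeight (.fst (.var 0))) .one)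
      (.call 1 (.var 0))
      (.letIn (.snd (.snd (.var 0)))
        (.ifLe (eHeight (eLeft (.var 0))) (eHeight (eRight (.var 0)))
          (eMk (eMk (.fst (.var 1)) (.fst (.snd (.var 1))) (eLeft (.var 0))) (eEntry (.var 0))
            (eRight (.var 0)))
          (.letIn (eLeft (.var 0))
            (eMk (eMk (.fst (.var 2)) (.fst (.snd (.var 2))) (eLeft (.var 0))) (eEntry (.var 0))
              (eMk (eRight (.var 0)) (eEntry (.var 1)) (eRight (.var 1))))))))
    (.letIn (.fst (.var 0))
      (.ifLe (eHeight (eRight (.var 0))) (eHeight (eLeft (.var 0)))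
        (eMk (eLeft (.var 0)) (eEntry (.var 0))
          (eMk (eRight (.var 0)) (.fst (.snd (.var 1))) (.snd (.snd (.var 1)))))
        (.letIn (eRight (.var 0))
          (eMk (eMk (eLeft (.var 1)) (eEntry (.var 1)) (eLeft (.var 0))) (eEntry (.var 0))
            (eMk (eRight (.var 0)) (.fst (.snd (.var 2))) (.snd (.snd (.var 2))))))))

def eBal (l e r : Expr) : Expr := .call 2 (.pair l (.pair e r))

def eLt (a b : Expr) (c d : Expr) : Expr := .ifPair (.call 0 (.pair a b)) c d

/-- `AVL.ins`, for the input `(e, t)`. -/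
def insBody : Expr :=
  .ifPair (.snd (.var 0))
    (.letIn (.snd (.var 0)) (.letIn (.fst (.var 1))
      (eLt (.fst (.var 0)) (.fst (eEntry (.var 1)))
        (eBal (.call 3 (.pair (.var 0) (eLeft (.var 1)))) (eEntry (.var 1)) (eRight (.var 1)))
        (eLt (.fst (eEntry (.var 1))) (.fst (.var 0))
          (eBal (eLeft (.var 1)) (eEntry (.var 1)) (.call 3 (.pair (.var 0) (eRight (.var 1)))))
          (eMk (eLeft (.var 1)) (.var 0) (eRight (.var 1)))))))
    (eMk .nil (.fst (.var 0)) .nil)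

/-- The entry with a given key or null, for the input `(k, t)`. -/
def getBody : Expr :=
  .ifPair (.snd (.var 0))
    (eLt (.fst (.var 0)) (.fst (eEntry (.snd (.var 0))))
      (.call 4 (.pair (.fst (.var 0)) (eLeft (.snd (.var 0)))))
      (eLt (.fst (eEntry (.snd (.var 0)))) (.fst (.var 0))
        (.call 4 (.pair (.fst (.var 0)) (eRight (.snd (.var 0)))))
        (eEntry (.snd (.var 0)))))
    .nil

def leftmostBody : Expr :=
  .ifPair (eLeft (.var 0)) (.call 5 (eLeft (.var 0))) (eEntry (.var 0))

def delMinBody : Expr :=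
  .ifPair (eLeft (.var 0)) (eBal (.call 6 (eLeft (.var 0))) (eEntry (.var 0)) (eRight (.var 0)))
    (eRight (.var 0))

/-- `AVL.del`, for the input `(k, t)`. -/
def delBody : Expr :=
  .ifPair (.snd (.var 0))
    (.letIn (.snd (.var 0)) (.letIn (.fst (.var 1))
      (eLt (.var 0) (.fst (eEntry (.var 1)))
        (eBal (.call 7 (.pair (.var 0) (eLeft (.var 1)))) (eEntry (.var 1)) (eRight (.var 1)))
        (eLt (.fst (eEntry (.var 1))) (.var 0)
          (eBal (eLeft (.var 1)) (eEntry (.var 1)) (.call 7 (.pair (.var 0) (eRight (.var 1)))))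
          (.ifPair (eRight (.var 1))
            (eBal (eLeft (.var 1)) (.call 5 (eRight (.var 1))) (.call 6 (eRight (.var 1))))
            (eLeft (.var 1)))))))
    .nil

/-- `AVL.query`, for the input `(k, t)`. -/
def queryBody : Expr :=
  .ifPair (.snd (.var 0))
    (eLt (.fst (.var 0)) (.fst (eEntry (.snd (.var 0))))
      (.letIn (eMinWith (eRight (.snd (.var 0))) (.snd (eEntry (.snd (.var 0)))))
      (.letIn (.call 8 (.pair (.fst (.var 1)) (eLeft (.snd (.var 1)))))
        (.ifPair (.var 0)
          (.ifLe (.fst (.var 0)) (.var 1) (.var 0) (.pair (.var 1) .nil))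
          (.pair (.var 1) .nil))))
      (.call 8 (.pair (.fst (.var 0)) (eRight (.snd (.var 0))))))
    .nil

def encOption : Option ℝ → Val
  | none => .nil
  | some r => .pair (.real r) .nil

def treeCode : List Expr :=
  [ltBody, mkBody, balBody, insBody, getBody, leftmostBody, delMinBody, delBody, queryBody]

end QuadrantSetCover

namespace QuadrantSetCover

/-! ### Running times of the programs for search trees -/

/-- The code that follows `treeCode` is left arbitrary, so these results apply unchanged inside the
full program `code`. -/
theorem computes_lt_real {R : List Expr} (x y : ℝ) :
    Computes (treeCode ++ R) 0 (.pair (.real x) (.real y)) (encBool (decide (x < y))) 20 := by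
  refine .of_wp (body := ltBody) rfl ?_
  by_cases h : x < y
  · simp [ltBody, eTrue, encBool, h]
  · simp [ltBody, eTrue, encBool, h, not_lt.1 h]

/-- One level of the recursion, over any ordered second component; three applications reach the keys
with four components. -/
theorem computes_lt_lex {R : List Expr} {α : Type} [LinearOrder α] {enc : α → Val} {T : ℕ}
    (h : ∀ x y, Computes (treeCode ++ R) 0 (.pair (enc x) (enc y)) (encBool (decide (x < y))) T)
    (x y : ℝ ×ₗ α) : Computes (treeCode ++ R) 0 (.pair (encLex enc x) (encLex enc y))
      (encBool (decide (x < y))) (T + 40) := by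
  refine .of_wp (body := ltBody) rfl ?_
  simp only [ltBody, wp, Val.onPair, Val.casesPair, Val.onReal, eTrue, encLex,
    Prod.Lex.lt_iff, List.getElem?_cons_zero, Option.some.injEq, exists_eq_left']
  refine ⟨fun h1 => ⟨fun h2 => (h _ _).calls fun t ht => ?_, fun h2 => ?_⟩, fun h1 => ?_⟩
  · have : (ofLex x).1 = (ofLex y).1 := le_antisymm h2 h1
    exact ⟨by simp [this], by omega⟩
  · have h3 : ¬ ((ofLex x).1 < (ofLex y).1 ∨ (ofLex x).1 = (ofLex y).1 ∧
        (ofLex x).2 < (ofLex y).2) := by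
      rintro (h3 | h3)
      · linarith
      · exact h2 h3.1.le
    simp [h3, encBool]
  · have h3 : (ofLex x).1 < (ofLex y).1 := not_le.1 h1
    simp [h3, encBool]

theorem computes_lt {R : List Expr} (x y : Key) : Computes (treeCode ++ R) 0
    (.pair (encKey x) (encKey y)) (encBool (decide (x < y))) 140 :=
  computes_lt_lex (computes_lt_lex (computes_lt_lex computes_lt_real)) x y

theorem wp_eLt {R : List Expr} {env : List Val} {a b c d : Expr} {x y : Key} {s t n : ℕ}
    {Q : Val → ℕ → Prop} (ha : Ev (treeCode ++ R) env a (encKey x) s)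
    (hb : Ev (treeCode ++ R) env b (encKey y) t)
    (hc : x < y → ∀ m ≤ n + s + t + 150, wp (treeCode ++ R) c env m fun v t => Q v (t + 1))
    (hd : ¬ x < y → ∀ m ≤ n + s + t + 150, wp (treeCode ++ R) d env m fun v t => Q v (t + 1)) :
    wp (treeCode ++ R) (eLt a b c d) env n Q := by
  refine ha.wp fun m hm => hb.wp fun m' hm' => ?_
  refine (computes_lt x y).calls fun r hr => ?_
  by_cases h : x < y
  · simpa [encBool, h] using hc h _ (by omega)
  · simpa [encBool, h] using hd h _ (by omega)

/-! ### Node construction and stored minima -/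

namespace AVL

theorem ev_height {P : List Expr} {env : List Val} {e : Expr} {t : AVL} {s : ℕ}
    (h : Ev P env e t.enc s) : Ev P env (eHeight e) (.real t.height) (2 * s + 3) := by
  refine .of_wp (h.wp fun m hm => ?_)
  rcases t with _ | ⟨k, v, l, r⟩
  · simp [enc, height]; omega
  · simp only [enc, Val.casesPair]
    exact h.wp fun m' hm' => by simp [enc]; omega

theorem ev_nodeHeight {P : List Expr} {env : List Val} {el er : Expr} {k : Key} {v : ℝ}
    {l r : AVL} {s : ℕ} (hl : Ev P env el l.enc s) (hr : Ev P env er r.enc s) :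
    Ev P env (eNodeHeight el er) (.real (node k v l r).height) (6 * s + 12) := by
  refine .of_wp ?_
  simp only [eNodeHeight, wp]
  refine (ev_height hl).wp fun m hm => ?_
  refine (ev_height hr).wp fun m' hm' => ?_
  refine ⟨fun h => (ev_height hr).wp fun m hm => ?_, fun h => (ev_height hl).wp fun m hm => ?_⟩
  · have h : l.height ≤ r.height := by exact_mod_cast h
    simp [height, h]; omega
  · have h : r.height ≤ l.height := by rw [Nat.cast_le] at h; omega
    simp [height, h]; omega

theorem ev_minWith {P : List Expr} {env : List Val} {e a : Expr} {t : AVL} {x : ℝ} {s s' : ℕ}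
    (h : Ev P env e t.enc s) (ha : Ev P env a (.real x) s') :
    Ev P env (eMinWith e a) (.real (t.minWith x)) (3 * s + 3 * s' + 6) := by
  refine .of_wp (h.wp fun m hm => ?_)
  rcases t with _ | ⟨k, v, l, r⟩
  · exact ha.wp fun m hm => ⟨rfl, by omega⟩
  · refine h.wp fun m hm => ha.wp fun m' hm' => ⟨fun h1 => ?_, fun h1 => ?_⟩
    · refine h.wp fun m hm => ?_
      simp [enc, minWith, min_eq_left h1]; omega
    · refine ha.wp fun m hm => ?_
      simp [minWith, min_eq_right (not_le.1 h1).le]; omega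

theorem computes_mk {R : List Expr} (k : Key) (v : ℝ) (l r : AVL) : Computes (treeCode ++ R) 1
    (.pair l.enc (.pair (.pair (encKey k) (.real v)) r.enc)) (node k v l r).enc 240 := by
  refine .of_wp (body := mkBody) rfl ?_
  simp only [mkBody, wp]
  refine (ev_minWith (t := l) (x := v) (s := 10) (s' := 10) (.of_wp (by simp)) (.of_wp (by simp))).wp
    fun m hm => ?_
  refine (ev_minWith (t := r) (x := l.minWith v) (s := 10) (s' := 10) (.of_wp (by simp)) (.of_wp (by simp))).wp
    fun m hm => ?_
  refine (ev_nodeHeight (k := k) (v := v) (l := l) (r := r) (s := 10) (.of_wp (by simp))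
    (.of_wp (by simp))).wp fun m hm => ?_
  simp [enc]
  omega

theorem ev_eMk {R : List Expr} {env : List Val} {el ee er : Expr} {k : Key} {v : ℝ} {l r : AVL}
    {s t u : ℕ} (hl : Ev (treeCode ++ R) env el l.enc s)
    (he : Ev (treeCode ++ R) env ee (.pair (encKey k) (.real v)) t)
    (hr : Ev (treeCode ++ R) env er r.enc u) :
    Ev (treeCode ++ R) env (eMk el ee er) (node k v l r).enc (s + t + u + 250) := by
  refine .of_wp (hl.wp fun m hm => he.wp fun m hm => hr.wp fun m hm => ?_)
  exact (computes_mk _ _ _ _).calls fun t ht => ⟨rfl, by omega⟩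

end AVL
end QuadrantSetCover

namespace QuadrantSetCover
namespace AVL

/-- Constant time, because a rotation reads only heights stored near the root and builds at most
three nodes. -/
theorem computes_bal {R : List Expr} (l : AVL) (k : Key) (v : ℝ) (r : AVL) :
    Computes (treeCode ++ R) 2 (.pair l.enc (.pair (.pair (encKey k) (.real v)) r.enc))
      (bal l k v r).enc 1500 := by
  refine .of_wp (body := balBody) rfl ?_
  simp only [balBody, wp]
  refine (ev_height (t := l) (s := 10) (.of_wp (by simp))).wp fun m1 h1 => ?_
  refine (ev_height (t := r) (s := 10) (.of_wp (by simp))).wp fun m2 h2 => ?_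
  refine ⟨fun hlr => ?_, fun hlr => ?_⟩
  · have hlr' : l.height ≤ r.height + 1 := by exact_mod_cast hlr
    refine (ev_height (t := r) (s := 10) (.of_wp (by simp))).wp fun m3 h3 => ?_
    refine (ev_height (t := l) (s := 10) (.of_wp (by simp))).wp fun m4 h4 => ?_
    refine ⟨fun hrl => ?_, fun hrl => ?_⟩
    · have hrl' : r.height ≤ l.height + 1 := by exact_mod_cast hrl
      refine ⟨_, rfl, (computes_mk _ _ _ _).calls fun t ht => ⟨?_, by omega⟩⟩
      simp [bal, hlr', hrl']
    · have hrl' : ¬ r.height ≤ l.height + 1 := by exact_mod_cast hrl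
      rcases r with _ | ⟨kr, vr, rl, rr⟩
      · simp [height] at hrl'
      refine ⟨_, rfl, ?_⟩
      simp only [Val.onPair]
      refine (ev_height (t := rl) (s := 20) (.of_wp (by simp [eLeft, enc]))).wp fun m5 h5 => ?_
      refine (ev_height (t := rr) (s := 20) (.of_wp (by simp [eRight, enc]))).wp fun m6 h6 => ?_
      refine ⟨fun hr => ?_, fun hr => ?_⟩
      · have hr' : rl.height ≤ rr.height := by exact_mod_cast hr
        refine (ev_eMk (l := node k v l rl) (k := kr) (v := vr) (r := rr) (s := 300) (t := 20) (u := 20)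
          (.of_wp ((ev_eMk (l := l) (k := k) (v := v) (r := rl) (s := 10) (t := 10) (u := 10)
            (.of_wp (by simp)) (.of_wp (by simp)) (.of_wp (by simp [eLeft, enc]))).wp
            fun m hm => ⟨rfl, by omega⟩))
          (.of_wp (by simp [eEntry, enc])) (.of_wp (by simp [eRight, enc]))).wp
          fun m hm => ⟨?_, by omega⟩
        simp [bal, hlr', hrl', hr']
      · have hr' : ¬ rl.height ≤ rr.height := by exact_mod_cast hr
        rcases rl with _ | ⟨k', v', a, b⟩
        · simp [height] at hr'
        simp only [eLeft, wp]
        refine ⟨_, rfl, ?_⟩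
        simp only [enc, Val.onPair]
        refine (ev_eMk (l := node k v l a) (k := k') (v := v') (r := node kr vr b rr)
          (s := 300) (t := 20) (u := 300)
          (.of_wp ((ev_eMk (l := l) (k := k) (v := v) (r := a) (s := 10) (t := 10) (u := 10)
            (.of_wp (by simp)) (.of_wp (by simp)) (.of_wp (by simp))).wp
            fun m hm => ⟨rfl, by omega⟩))
          (.of_wp (by simp [eEntry]))
          (.of_wp ((ev_eMk (l := b) (k := kr) (v := vr) (r := rr) (s := 10) (t := 10) (u := 10)
            (.of_wp (by simp [eRight])) (.of_wp (by simp [eEntry]))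
            (.of_wp (by simp [eRight]))).wp
            fun m hm => ⟨rfl, by omega⟩))).wp fun m hm => ⟨?_, by omega⟩
        simp [bal, hlr', hrl', hr']
  · have hlr' : ¬ l.height ≤ r.height + 1 := by exact_mod_cast hlr
    rcases l with _ | ⟨kl, vl, ll, lr⟩
    · simp [height] at hlr'
    refine ⟨_, rfl, ?_⟩
    simp only [Val.onPair]
    refine (ev_height (t := lr) (s := 20) (.of_wp (by simp [eRight, enc]))).wp fun m5 h5 => ?_
    refine (ev_height (t := ll) (s := 20) (.of_wp (by simp [eLeft, enc]))).wp fun m6 h6 => ?_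
    refine ⟨fun hr => ?_, fun hr => ?_⟩
    · have hr' : lr.height ≤ ll.height := by exact_mod_cast hr
      refine (ev_eMk (l := ll) (k := kl) (v := vl) (r := node k v lr r) (s := 20) (t := 20) (u := 300)
        (.of_wp (by simp [eLeft, enc])) (.of_wp (by simp [eEntry, enc]))
        (.of_wp ((ev_eMk (l := lr) (k := k) (v := v) (r := r) (s := 10) (t := 10) (u := 10)
          (.of_wp (by simp [eRight, enc])) (.of_wp (by simp)) (.of_wp (by simp))).wp
          fun m hm => ⟨rfl, by omega⟩))).wp fun m hm => ⟨?_, by omega⟩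
      simp [bal, hlr', hr']
    · have hr' : ¬ lr.height ≤ ll.height := by exact_mod_cast hr
      rcases lr with _ | ⟨k', v', a, b⟩
      · simp [height] at hr'
      simp only [eRight, wp]
      refine ⟨_, rfl, ?_⟩
      simp only [enc, Val.onPair]
      refine (ev_eMk (l := node kl vl ll a) (k := k') (v := v') (r := node k v b r)
        (s := 300) (t := 20) (u := 300)
        (.of_wp ((ev_eMk (l := ll) (k := kl) (v := vl) (r := a) (s := 10) (t := 10) (u := 10)
          (.of_wp (by simp [eLeft])) (.of_wp (by simp [eEntry])) (.of_wp (by simp [eLeft]))).wp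
          fun m hm => ⟨rfl, by omega⟩))
        (.of_wp (by simp [eEntry]))
        (.of_wp ((ev_eMk (l := b) (k := k) (v := v) (r := r) (s := 10) (t := 10) (u := 10)
          (.of_wp (by simp)) (.of_wp (by simp))
          (.of_wp (by simp))).wp
          fun m hm => ⟨rfl, by omega⟩))).wp fun m hm => ⟨?_, by omega⟩
      simp [bal, hlr', hr']

theorem ev_eBal {R : List Expr} {env : List Val} {el ee er : Expr} {k : Key} {v : ℝ} {l r : AVL}
    {s t u : ℕ} (hl : Ev (treeCode ++ R) env el l.enc s)
    (he : Ev (treeCode ++ R) env ee (.pair (encKey k) (.real v)) t)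
    (hr : Ev (treeCode ++ R) env er r.enc u) :
    Ev (treeCode ++ R) env (eBal el ee er) (bal l k v r).enc (s + t + u + 1510) := by
  refine .of_wp (hl.wp fun m hm => he.wp fun m hm => hr.wp fun m hm => ?_)
  exact (computes_bal _ _ _ _).calls fun t ht => ⟨rfl, by omega⟩

/-! ### Running times of insertion, lookup, deletion and range minimum -/

theorem computes_ins {R : List Expr} (k : Key) (v : ℝ) (t : AVL) :
    Computes (treeCode ++ R) 3 (.pair (.pair (encKey k) (.real v)) t.enc)
      (ins k v t).enc (2000 * (t.height + 1)) := by
  induction t with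
  | leaf =>
    refine .of_wp (body := insBody) rfl ?_
    simp only [insBody, wp]
    refine ⟨_, rfl, ?_⟩
    simp only [Val.onPair, enc, Val.casesPair]
    refine (ev_eMk (l := leaf) (k := k) (v := v) (r := leaf) (s := 10) (t := 10) (u := 10)
      (.of_wp (by simp [enc])) (.of_wp (by simp)) (.of_wp (by simp [enc]))).wp
      fun m hm => ⟨rfl, by omega⟩
  | node k' v' l r ihl ihr =>
    refine .of_wp (body := insBody) rfl ?_
    simp only [insBody, wp]
    refine ⟨_, rfl, ?_⟩
    simp only [Val.onPair, enc, Val.casesPair]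
    refine ⟨_, rfl, ?_⟩
    simp only [Val.onPair]
    refine ⟨_, rfl, ?_⟩
    simp only
    refine wp_eLt (x := k) (y := k') (s := 10) (t := 10) (.of_wp (by simp)) (.of_wp (by simp [eEntry]))
      (fun h m hm => ?_) (fun h m hm => ?_)
    · refine (ev_eBal (l := ins k v l) (k := k') (v := v') (r := r)
        (s := 2000 * (l.height + 1) + 20) (t := 10) (u := 10)
        (.of_wp ?_) (.of_wp (by simp [eEntry])) (.of_wp (by simp [eRight]))).wp fun m hm => ⟨?_, ?_⟩
      · simp [eLeft]
        exact ihl.calls fun t ht => ⟨rfl, by omega⟩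
      · simp [ins, h]
      · simp only [height]; omega
    · refine wp_eLt (x := k') (y := k) (s := 10) (t := 10) (.of_wp (by simp [eEntry])) (.of_wp (by simp))
        (fun h' m hm => ?_) (fun h' m hm => ?_)
      · refine (ev_eBal (l := l) (k := k') (v := v') (r := ins k v r)
          (s := 10) (t := 10) (u := 2000 * (r.height + 1) + 20)
          (.of_wp (by simp [eLeft])) (.of_wp (by simp [eEntry])) (.of_wp ?_)).wp fun m hm => ⟨?_, ?_⟩
        · simp [eRight]
          exact ihr.calls fun t ht => ⟨rfl, by omega⟩
        · simp [ins, h, h']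
        · simp only [height]; omega
      · refine (ev_eMk (l := l) (k := k) (v := v) (r := r) (s := 10) (t := 10) (u := 10)
          (.of_wp (by simp [eLeft])) (.of_wp (by simp)) (.of_wp (by simp [eRight]))).wp
          fun m hm => ⟨?_, ?_⟩
        · simp [ins, h, h']
        · omega

/-- The encoding of an optional entry with a given key. -/
def encGet (k : Key) : Option ℝ → Val
  | none => .nil
  | some v => .pair (encKey k) (.real v)

theorem computes_get {R : List Expr} (k : Key) (t : AVL) :
    Computes (treeCode ++ R) 4 (.pair (encKey k) t.enc)
      (encGet k (get k t)) (400 * (t.height + 1)) := by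
  induction t with
  | leaf =>
    refine .of_wp (body := getBody) rfl ?_
    simp [getBody, enc, get, encGet, height]
  | node k' v' l r ihl ihr =>
    refine .of_wp (body := getBody) rfl ?_
    simp only [getBody, wp]
    refine ⟨_, rfl, ?_⟩
    simp only [Val.onPair, enc, Val.casesPair]
    refine wp_eLt (x := k) (y := k') (s := 10) (t := 10) (.of_wp (by simp)) (.of_wp (by simp [eEntry]))
      (fun h m hm => ?_) (fun h m hm => ?_)
    · simp [eLeft]
      exact ihl.calls fun t ht => ⟨by simp [get, h], by simp only [height]; omega⟩
    · refine wp_eLt (x := k') (y := k) (s := 10) (t := 10) (.of_wp (by simp [eEntry])) (.of_wp (by simp))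
        (fun h' m hm => ?_) (fun h' m hm => ?_)
      · simp [eRight]
        exact ihr.calls fun t ht => ⟨by simp [get, h, h'], by simp only [height]; omega⟩
      · have hk : k' = k := le_antisymm (not_lt.1 h) (not_lt.1 h')
        subst hk
        simp [eEntry, get, encGet]
        omega

theorem computes_leftmost {R : List Expr} (k : Key) (v : ℝ) (l r : AVL) :
    Computes (treeCode ++ R) 5 (node k v l r).enc
      (.pair (encKey (leftmost k v l).1) (.real (leftmost k v l).2)) (20 * (l.height + 1)) := by
  induction l generalizing k v r with
  | leaf =>
    refine .of_wp (body := leftmostBody) rfl ?_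
    simp [leftmostBody, enc, eLeft, eEntry, leftmost, height]
  | node k' v' a b iha ihb =>
    refine .of_wp (body := leftmostBody) rfl ?_
    simp [leftmostBody, enc, eLeft]
    exact (iha k' v' b).calls fun t ht => ⟨rfl, by simp only [height]; omega⟩

theorem computes_delMin {R : List Expr} (k : Key) (v : ℝ) (l r : AVL) :
    Computes (treeCode ++ R) 6 (node k v l r).enc
      (delMin (node k v l r)).enc (1600 * (l.height + 1)) := by
  induction l generalizing k v r with
  | leaf =>
    refine .of_wp (body := delMinBody) rfl ?_
    simp [delMinBody, enc, eLeft, eRight, delMin, height]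
  | node k' v' a b iha ihb =>
    refine .of_wp (body := delMinBody) rfl ?_
    simp only [delMinBody, wp]
    refine Ev.wp (v := (node k' v' a b).enc) (T := 10) (.of_wp (by simp [enc, eLeft])) fun m hm => ?_
    simp only [enc, Val.casesPair]
    refine (ev_eBal (l := delMin (node k' v' a b)) (k := k) (v := v) (r := r)
      (s := 1600 * (a.height + 1) + 20) (t := 10) (u := 10) (.of_wp ?_)
      (.of_wp (by simp [eEntry])) (.of_wp (by simp [eRight]))).wp fun m hm => ⟨rfl, ?_⟩
    · simp [eLeft]
      exact (iha k' v' b).calls fun t ht => ⟨rfl, by omega⟩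
    · simp only [height]; omega

theorem computes_del {R : List Expr} (k : Key) (t : AVL) :
    Computes (treeCode ++ R) 7 (.pair (encKey k) t.enc)
      (del k t).enc (4000 * (t.height + 1)) := by
  induction t with
  | leaf =>
    refine .of_wp (body := delBody) rfl ?_
    simp [delBody, enc, del, height]
  | node k' v' l r ihl ihr =>
    refine .of_wp (body := delBody) rfl ?_
    simp only [delBody, wp]
    refine ⟨_, rfl, ?_⟩
    simp only [Val.onPair, enc, Val.casesPair]
    refine ⟨_, rfl, ?_⟩
    simp only [Val.onPair]
    refine ⟨_, rfl, ?_⟩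
    simp only
    refine wp_eLt (x := k) (y := k') (s := 10) (t := 10) (.of_wp (by simp)) (.of_wp (by simp [eEntry]))
      (fun h m hm => ?_) (fun h m hm => ?_)
    · refine (ev_eBal (l := del k l) (k := k') (v := v') (r := r)
        (s := 4000 * (l.height + 1) + 20) (t := 10) (u := 10)
        (.of_wp ?_) (.of_wp (by simp [eEntry])) (.of_wp (by simp [eRight]))).wp fun m hm => ⟨?_, ?_⟩
      · simp [eLeft]
        exact ihl.calls fun t ht => ⟨rfl, by omega⟩
      · simp [del, h]
      · simp only [height]; omega
    · refine wp_eLt (x := k') (y := k) (s := 10) (t := 10) (.of_wp (by simp [eEntry])) (.of_wp (by simp))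
        (fun h' m hm => ?_) (fun h' m hm => ?_)
      · refine (ev_eBal (l := l) (k := k') (v := v') (r := del k r)
          (s := 10) (t := 10) (u := 4000 * (r.height + 1) + 20)
          (.of_wp (by simp [eLeft])) (.of_wp (by simp [eEntry])) (.of_wp ?_)).wp fun m hm => ⟨?_, ?_⟩
        · simp [eRight]
          exact ihr.calls fun t ht => ⟨rfl, by omega⟩
        · simp [del, h, h']
        · simp only [height]; omega
      · rcases r with _ | ⟨kr, vr, rl, rr⟩
        · simp [eRight, eLeft, enc, del, h, h']
          omega
        · simp only [wp]
          refine Ev.wp (v := (node kr vr rl rr).enc) (T := 10) (.of_wp (by simp [enc, eRight]))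
            fun m hm => ?_
          simp only [enc, Val.casesPair]
          refine (ev_eBal (l := l) (k := (leftmost kr vr rl).1) (v := (leftmost kr vr rl).2)
            (r := delMin (node kr vr rl rr)) (s := 10) (t := 20 * (rl.height + 1) + 20)
            (u := 1600 * (rl.height + 1) + 20)
            (.of_wp (by simp [eLeft])) (.of_wp ?_) (.of_wp ?_)).wp fun m hm => ⟨?_, ?_⟩
          · simp [eRight]
            exact (computes_leftmost _ _ _ rr).calls fun t ht => ⟨rfl, by omega⟩
          · simp [eRight]
            exact (computes_delMin _ _ _ _).calls fun t ht => ⟨rfl, by omega⟩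
          · simp [del, h, h']
          · simp only [height]; omega

/-- When the root key lies above `k`, so does the whole right subtree, whose minimum is stored at
its root. Hence only one child is visited on each level. -/
theorem computes_query {R : List Expr} (k : Key) (t : AVL) :
    Computes (treeCode ++ R) 8 (.pair (encKey k) t.enc)
      (encOption (query k t)) (400 * (t.height + 1)) := by
  induction t with
  | leaf =>
    refine .of_wp (body := queryBody) rfl ?_
    simp [queryBody, enc, query, encOption, height]
  | node k' v' l r ihl ihr =>
    refine .of_wp (body := queryBody) rfl ?_
    simp only [queryBody, wp]
    refine ⟨_, rfl, ?_⟩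
    simp only [Val.onPair, enc, Val.casesPair]
    refine wp_eLt (x := k) (y := k') (s := 10) (t := 10) (.of_wp (by simp)) (.of_wp (by simp [eEntry]))
      (fun h m hm => ?_) (fun h m hm => ?_)
    · simp only [wp]
      refine (ev_minWith (t := r) (x := v') (s := 10) (s' := 10) (.of_wp (by simp [eRight]))
        (.of_wp (by simp [eEntry]))).wp fun m hm => ?_
      simp only [eLeft, wp]
      refine ⟨_, rfl, ?_⟩
      simp only [Val.onPair]
      refine ⟨_, rfl, ?_⟩
      simp only [Val.onPair]
      refine ihl.calls fun t ht => ?_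
      rcases hq : query k l with _ | x
      · simp [encOption, query, h, hq, height]; omega
      · simp [encOption, query, h, hq, height]
        refine ⟨fun h => ⟨h, by omega⟩, fun h => ⟨h.le, by omega⟩⟩
    · simp [eRight]
      exact ihr.calls fun t ht => ⟨by simp [query, h], by simp only [height]; omega⟩

end AVL
end QuadrantSetCover

namespace QuadrantSetCover
namespace AVL

/-! ### Balance -/

def Balanced : AVL → Prop
  | leaf => True
  | node _ _ l r => l.height ≤ r.height + 1 ∧ r.height ≤ l.height + 1 ∧ l.Balanced ∧ r.Balanced

/-- A height difference of two is the worst that one insertion or deletion in a subtree can cause.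
The height bounds carry the induction to the next level; the exact height in the last clause is
needed where no rotation happens. -/
theorem balanced_bal {l r : AVL} (k : Key) (v : ℝ) (hl : l.Balanced) (hr : r.Balanced)
    (hlr : l.height ≤ r.height + 2) (hrl : r.height ≤ l.height + 2) :
    (bal l k v r).Balanced ∧ max l.height r.height ≤ (bal l k v r).height ∧
      (bal l k v r).height ≤ max l.height r.height + 1 ∧
      (l.height ≤ r.height + 1 → r.height ≤ l.height + 1 →
        (bal l k v r).height = max l.height r.height + 1) := by
  unfold bal
  split_ifs with h1 h2
  · exact ⟨⟨h1, h2, hl, hr⟩, by simp [height], by simp [height], fun _ _ => rfl⟩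
  · rcases r with _ | ⟨kr, vr, rl, rr⟩
    · simp [height] at h2
    simp only [height, Balanced] at *
    split_ifs with h3
    · simp only [height, Balanced]
      refine ⟨⟨?_, ?_, ⟨?_, ?_, hl, hr.2.2.1⟩, hr.2.2.2⟩, ?_, ?_, ?_⟩ <;> omega
    · rcases rl with _ | ⟨k', v', a, b⟩
      · simp [height] at h3
      simp only [height, Balanced] at *
      obtain ⟨hr1, hr2, ⟨ha1, ha2, ha, hb⟩, hrr⟩ := hr
      refine ⟨⟨?_, ?_, ⟨?_, ?_, hl, ha⟩, ⟨?_, ?_, hb, hrr⟩⟩, ?_, ?_, ?_⟩ <;> omega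
  · rcases l with _ | ⟨kl, vl, ll, lr⟩
    · simp [height] at h1
    simp only [height, Balanced] at *
    split_ifs with h3
    · simp only [height, Balanced]
      refine ⟨⟨?_, ?_, hl.2.2.1, ?_, ?_, hl.2.2.2, hr⟩, ?_, ?_, ?_⟩ <;> omega
    · rcases lr with _ | ⟨k', v', a, b⟩
      · simp [height] at h3
      simp only [height, Balanced] at *
      obtain ⟨hl1, hl2, hll, ha1, ha2, ha, hb⟩ := hl
      refine ⟨⟨?_, ?_, ⟨?_, ?_, hll, ha⟩, ⟨?_, ?_, hb, hr⟩⟩, ?_, ?_, ?_⟩ <;> omega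

theorem balanced_ins (k : Key) (v : ℝ) {t : AVL} (ht : t.Balanced) :
    (ins k v t).Balanced ∧ t.height ≤ (ins k v t).height ∧
      (ins k v t).height ≤ t.height + 1 := by
  induction t with
  | leaf => simp [ins, Balanced, height]
  | node k' v' l r ihl ihr =>
    obtain ⟨h1, h2, hl, hr⟩ := ht
    obtain ⟨il, il1, il2⟩ := ihl hl
    obtain ⟨ir, ir1, ir2⟩ := ihr hr
    unfold ins
    split_ifs
    · have := balanced_bal k' v' il hr (by omega) (by omega)
      refine ⟨this.1, ?_, ?_⟩ <;> simp only [height] <;> omega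
    · have := balanced_bal k' v' hl ir (by omega) (by omega)
      refine ⟨this.1, ?_, ?_⟩ <;> simp only [height] <;> omega
    · exact ⟨⟨h1, h2, hl, hr⟩, le_rfl, Nat.le_succ _⟩

theorem balanced_delMin {t : AVL} (ht : t.Balanced) :
    (delMin t).Balanced ∧ t.height ≤ (delMin t).height + 1 ∧ (delMin t).height ≤ t.height := by
  induction t with
  | leaf => simp [delMin, Balanced, height]
  | node k v l r ihl _ =>
    obtain ⟨h1, h2, hl, hr⟩ := ht
    rcases l with _ | ⟨k', v', a, b⟩
    · simp only [delMin, height] at *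
      exact ⟨hr, by omega, by omega⟩
    · obtain ⟨il, il1, il2⟩ := ihl hl
      rw [delMin]
      have := balanced_bal k v il hr (by omega) (by omega)
      refine ⟨this.1, ?_, ?_⟩ <;> rw [height] <;> omega

theorem balanced_del (k : Key) {t : AVL} (ht : t.Balanced) :
    (del k t).Balanced ∧ t.height ≤ (del k t).height + 1 ∧ (del k t).height ≤ t.height := by
  induction t with
  | leaf => simp [del, Balanced, height]
  | node k' v' l r ihl ihr =>
    obtain ⟨h1, h2, hl, hr⟩ := ht
    obtain ⟨il, il1, il2⟩ := ihl hl
    obtain ⟨ir, ir1, ir2⟩ := ihr hr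
    unfold del
    split_ifs
    · have := balanced_bal k' v' il hr (by omega) (by omega)
      refine ⟨this.1, ?_, ?_⟩ <;> simp only [height] <;> omega
    · have := balanced_bal k' v' hl ir (by omega) (by omega)
      refine ⟨this.1, ?_, ?_⟩ <;> simp only [height] <;> omega
    · rcases r with _ | ⟨kr, vr, rl, rr⟩
      · simp only [height] at *
        exact ⟨hl, by omega, by omega⟩
      · obtain ⟨im, im1, im2⟩ := balanced_delMin hr
        have := balanced_bal (leftmost kr vr rl).1 (leftmost kr vr rl).2 hl im
          (by omega) (by omega)
        refine ⟨this.1, ?_, ?_⟩ <;> rw [height.eq_2 k'] <;> dsimp only <;> omega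

/-! ### Entries -/

/-- The entries in the order of their keys. -/
def toList : AVL → List (Key × ℝ)
  | leaf => []
  | node k v l r => l.toList ++ (k, v) :: r.toList

def Sorted (t : AVL) : Prop := t.toList.Pairwise fun e f => e.1 < f.1

/-- Rotations preserve the in-order list, which reduces order and membership after rebalancing to
statements about lists. -/
theorem toList_bal (l : AVL) (k : Key) (v : ℝ) (r : AVL) :
    (bal l k v r).toList = l.toList ++ (k, v) :: r.toList := by
  unfold bal
  split_ifs
  · rfl
  · rcases r with _ | ⟨kr, vr, rl, rr⟩
    · rfl
    dsimp only
    split_ifs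
    · simp [toList]
    · rcases rl with _ | ⟨k', v', a, b⟩ <;> simp [toList]
  · rcases l with _ | ⟨kl, vl, ll, lr⟩
    · rfl
    dsimp only
    split_ifs
    · simp [toList]
    · rcases lr with _ | ⟨k', v', a, b⟩ <;> simp [toList]

theorem sorted_node {k : Key} {v : ℝ} {l r : AVL} : (node k v l r).Sorted ↔
    l.Sorted ∧ r.Sorted ∧ (∀ e ∈ l.toList, e.1 < k) ∧ ∀ e ∈ r.toList, k < e.1 := by
  simp only [Sorted, toList, List.pairwise_append, List.pairwise_cons, List.mem_cons]
  constructor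
  · rintro ⟨hl, ⟨h1, hr⟩, h2⟩
    exact ⟨hl, hr, fun e he => h2 e he _ (.inl rfl), fun e he => h1 e he⟩
  · rintro ⟨hl, hr, h1, h2⟩
    refine ⟨hl, ⟨fun e he => h2 e he, hr⟩, ?_⟩
    rintro a ha b (rfl | hb)
    · exact h1 a ha
    · exact (h1 a ha).trans (h2 b hb)

theorem sorted_bal {k : Key} {v : ℝ} {l r : AVL} : (bal l k v r).Sorted ↔
    l.Sorted ∧ r.Sorted ∧ (∀ e ∈ l.toList, e.1 < k) ∧ ∀ e ∈ r.toList, k < e.1 := by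
  rw [← sorted_node (v := v), Sorted, Sorted, toList_bal, toList]

theorem sorted_ins (k : Key) (v : ℝ) {t : AVL} (ht : t.Sorted) : (ins k v t).Sorted ∧
    ∀ e, e ∈ (ins k v t).toList ↔ e = (k, v) ∨ e ∈ t.toList ∧ e.1 ≠ k := by
  induction t with
  | leaf => simp [ins, Sorted, toList]
  | node k' v' l r ihl ihr =>
    obtain ⟨hl, hr, h1, h2⟩ := sorted_node.1 ht
    obtain ⟨il, il'⟩ := ihl hl
    obtain ⟨ir, ir'⟩ := ihr hr
    unfold ins
    split_ifs with hk hk'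
    · rw [sorted_bal, toList_bal]
      refine ⟨⟨il, hr, fun e he => ?_, h2⟩, fun e => ?_⟩
      · rcases (il' e).1 he with rfl | he
        exacts [hk, h1 e he.1]
      · simp only [toList, List.mem_append, List.mem_cons, il']
        have h3 : e = (k', v') → e.1 ≠ k := by rintro rfl; exact hk.ne'
        have h4 : e ∈ r.toList → e.1 ≠ k := fun he => (hk.trans (h2 e he)).ne'
        tauto
    · rw [sorted_bal, toList_bal]
      refine ⟨⟨hl, ir, h1, fun e he => ?_⟩, fun e => ?_⟩
      · rcases (ir' e).1 he with rfl | he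
        exacts [hk', h2 e he.1]
      · simp only [toList, List.mem_append, List.mem_cons, ir']
        have h3 : e = (k', v') → e.1 ≠ k := by rintro rfl; exact hk'.ne
        have h4 : e ∈ l.toList → e.1 ≠ k := fun he => ((h1 e he).trans hk').ne
        tauto
    · obtain rfl : k' = k := le_antisymm (not_lt.1 hk) (not_lt.1 hk')
      refine ⟨sorted_node.2 ⟨hl, hr, h1, h2⟩, fun e => ?_⟩
      simp only [toList, List.mem_append, List.mem_cons]
      have h3 : e = (k', v') → e.1 = k' := by rintro rfl; rfl
      have h4 : e ∈ l.toList → e.1 ≠ k' := fun he => (h1 e he).ne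
      have h5 : e ∈ r.toList → e.1 ≠ k' := fun he => (h2 e he).ne'
      tauto

/-- Splitting the right subtree into its least entry and the rest is what allows a deletion to move
the successor to the root. -/
theorem leftmost_cons_delMin (k : Key) (v : ℝ) (l r : AVL) :
    leftmost k v l :: (delMin (node k v l r)).toList = (node k v l r).toList := by
  induction l generalizing k v r with
  | leaf => simp [leftmost, delMin, toList]
  | node k' v' a b iha _ =>
    rw [delMin, toList_bal, leftmost, ← List.cons_append, iha, toList.eq_2 k]

theorem sorted_del (k : Key) {t : AVL} (ht : t.Sorted) : (del k t).Sorted ∧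
    ∀ e, e ∈ (del k t).toList ↔ e ∈ t.toList ∧ e.1 ≠ k := by
  induction t with
  | leaf => simp [del, Sorted, toList]
  | node k' v' l r ihl ihr =>
    obtain ⟨hl, hr, h1, h2⟩ := sorted_node.1 ht
    obtain ⟨il, il'⟩ := ihl hl
    obtain ⟨ir, ir'⟩ := ihr hr
    unfold del
    split_ifs with hk hk'
    · rw [sorted_bal, toList_bal]
      refine ⟨⟨il, hr, fun e he => h1 e ((il' e).1 he).1, h2⟩, fun e => ?_⟩
      simp only [toList, List.mem_append, List.mem_cons, il']
      have h3 : e = (k', v') → e.1 ≠ k := by rintro rfl; exact hk.ne'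
      have h4 : e ∈ r.toList → e.1 ≠ k := fun he => (hk.trans (h2 e he)).ne'
      tauto
    · rw [sorted_bal, toList_bal]
      refine ⟨⟨hl, ir, h1, fun e he => h2 e ((ir' e).1 he).1⟩, fun e => ?_⟩
      simp only [toList, List.mem_append, List.mem_cons, ir']
      have h3 : e = (k', v') → e.1 ≠ k := by rintro rfl; exact hk'.ne
      have h4 : e ∈ l.toList → e.1 ≠ k := fun he => ((h1 e he).trans hk').ne
      tauto
    · obtain rfl : k' = k := le_antisymm (not_lt.1 hk) (not_lt.1 hk')
      have h3 : ∀ e ∈ l.toList, e.1 ≠ k' := fun e he => (h1 e he).ne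
      have h4 : ∀ e ∈ r.toList, e.1 ≠ k' := fun e he => (h2 e he).ne'
      rcases r with _ | ⟨kr, vr, rl, rr⟩
      · refine ⟨hl, fun e => ?_⟩
        simp only [toList, List.mem_append, List.mem_cons, List.not_mem_nil, or_false]
        have h5 : e = (k', v') → e.1 = k' := by rintro rfl; rfl
        have := h3 e
        tauto
      · have hm := leftmost_cons_delMin kr vr rl rr
        have hr' := hr
        rw [Sorted, ← hm, List.pairwise_cons] at hr'
        dsimp only
        rw [sorted_bal, toList_bal, Prod.mk.eta, hm]
        refine ⟨⟨hl, hr'.2, fun e he => (h1 e he).trans (h2 _ (hm ▸ List.mem_cons_self)),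
          hr'.1⟩, fun e => ?_⟩
        rw [toList.eq_2 k']
        simp only [List.mem_append, List.mem_cons]
        have h5 : e = (k', v') → e.1 = k' := by rintro rfl; rfl
        have h6 := h3 e
        have h7 := h4 e
        tauto

theorem get_eq_some {k : Key} {t : AVL} (ht : t.Sorted) {v : ℝ} :
    get k t = some v ↔ (k, v) ∈ t.toList := by
  induction t with
  | leaf => simp [get, toList]
  | node k' v' l r ihl ihr =>
    obtain ⟨hl, hr, h1, h2⟩ := sorted_node.1 ht
    simp only [toList, List.mem_append, List.mem_cons, Prod.mk.injEq, get]
    have h3 : (k, v) ∈ l.toList → k < k' := fun he => h1 _ he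
    have h4 : (k, v) ∈ r.toList → k' < k := fun he => h2 _ he
    split_ifs with hk hk'
    · rw [ihl hl]
      have := hk.not_gt
      have := hk.ne
      tauto
    · rw [ihr hr]
      have := hk'.ne'
      tauto
    · have : k = k' := le_antisymm (not_lt.1 hk') (not_lt.1 hk)
      rw [Option.some_inj, eq_comm]
      tauto

/-! ### Minima over ranges of keys -/

/-- `o` is the minimum of `s`, if there is one. -/
def _root_.QuadrantSetCover.IsOptMin (s : Set ℝ) : Option ℝ → Prop
  | none => s = ∅
  | some m => IsLeast s m

theorem isLeast_minWith (t : AVL) (a : ℝ) :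
    IsLeast (insert a {v | ∃ k, (k, v) ∈ t.toList}) (t.minWith a) := by
  induction t generalizing a with
  | leaf => simp [minWith, toList]
  | node k' v' l r ihl ihr =>
    have h1 := ihr (l.minWith v')
    have h2 := ihl v'
    rw [minWith]
    constructor
    · rcases min_choice (r.minWith (l.minWith v')) a with h | h <;> rw [h]
      · rcases h1.1 with h3 | ⟨k, h3⟩
        · rw [h3]
          rcases h2.1 with h4 | ⟨k, h4⟩
          · exact .inr ⟨k', by simp [toList, h4]⟩
          · exact .inr ⟨k, by simp [toList, h4]⟩
        · exact .inr ⟨k, by simp [toList, h3]⟩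
      · exact .inl rfl
    · rintro x (rfl | ⟨k, hx⟩)
      · exact min_le_right _ _
      · refine (min_le_left _ _).trans ?_
        simp only [toList, List.mem_append, List.mem_cons, Prod.mk.injEq] at hx
        rcases hx with hx | ⟨-, rfl⟩ | hx
        · exact (h1.2 (.inl rfl)).trans (h2.2 (.inr ⟨k, hx⟩))
        · exact (h1.2 (.inl rfl)).trans (h2.2 (.inl rfl))
        · exact h1.2 (.inr ⟨k, hx⟩)

theorem isOptMin_query (k : Key) {t : AVL} (ht : t.Sorted) :
    IsOptMin {v | ∃ k', k < k' ∧ (k', v) ∈ t.toList} (query k t) := by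
  induction t with
  | leaf => simp [query, toList, IsOptMin]
  | node k' v' l r ihl ihr =>
    obtain ⟨hl, hr, h1, h2⟩ := sorted_node.1 ht
    rw [query]
    split_ifs with hk
    · have h3 := isLeast_minWith r v'
      -- The root and all of the right subtree qualify, so only the left subtree needs a recursive
      -- query.
      have h4 : {v | ∃ k'', k < k'' ∧ (k'', v) ∈ (node k' v' l r).toList} =
          {v | ∃ k'', k < k'' ∧ (k'', v) ∈ l.toList} ∪ insert v' {v | ∃ k, (k, v) ∈ r.toList} := by
        ext x
        simp only [toList, List.mem_append, List.mem_cons, Prod.mk.injEq, Set.mem_ofPred_eq,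
          Set.mem_union, Set.mem_insert_iff]
        constructor
        · rintro ⟨k'', h, h' | h' | h'⟩
          exacts [.inl ⟨_, h, h'⟩, .inr (.inl h'.2), .inr (.inr ⟨_, h'⟩)]
        · rintro (⟨k'', h, h'⟩ | rfl | ⟨k'', h⟩)
          exacts [⟨_, h, .inl h'⟩, ⟨_, hk, .inr (.inl ⟨rfl, rfl⟩)⟩,
            ⟨_, hk.trans (h2 _ h), .inr (.inr h)⟩]
      rw [h4]
      have h5 := ihl hl
      rcases hq : query k l with _ | m <;> rw [hq] at h5 <;> simp only [IsOptMin] at *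
      · rw [h5, Set.empty_union]; exact h3
      · exact h5.union h3
    · have h4 : {v | ∃ k'', k < k'' ∧ (k'', v) ∈ (node k' v' l r).toList} =
          {v | ∃ k'', k < k'' ∧ (k'', v) ∈ r.toList} := by
        ext x
        simp only [toList, List.mem_append, List.mem_cons, Prod.mk.injEq, Set.mem_ofPred_eq]
        constructor
        · rintro ⟨k'', h, h' | h' | h'⟩
          · exact absurd (h.trans (h1 _ h')) hk
          · exact absurd (h'.1 ▸ h) hk
          · exact ⟨_, h, h'⟩
        · rintro ⟨k'', h, h'⟩
          exact ⟨_, h, .inr (.inr h')⟩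
      rw [h4]
      exact ihr hr

/-- If a balanced tree has height at least `n + 2`, both subtrees of its root have height at least
`n`. So the number of entries plus one doubles with every two levels. -/
theorem height_le {t : AVL} (ht : t.Balanced) :
    t.height ≤ 2 * Nat.log 2 (t.toList.length + 1) + 1 := by
  have key : ∀ n (t : AVL), t.Balanced → n ≤ t.height → 2 ^ ((n + 1) / 2) ≤ t.toList.length + 1 := by
    intro n
    induction n using Nat.strong_induction_on with
    | _ n ih =>
      intro t ht hn
      rcases n with _ | _ | n
      · simp
      · rcases t with _ | ⟨k, v, l, r⟩
        · simp [height] at hn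
        · simp [toList]; omega
      · rcases t with _ | ⟨k, v, l, r⟩
        · simp [height] at hn
        · obtain ⟨h1, h2, hl, hr⟩ := ht
          simp only [height] at hn
          have il := ih n (by omega) l hl (by omega)
          have ir := ih n (by omega) r hr (by omega)
          have : (n + 1 + 1 + 1) / 2 = (n + 1) / 2 + 1 := by omega
          rw [this, pow_succ]
          simp only [toList, List.length_append, List.length_cons]
          omega
  have h1 := key _ t ht le_rfl
  have h2 := Nat.le_log_of_pow_le (by norm_num) h1
  omega

end AVL
end QuadrantSetCover

namespace QuadrantSetCover

/-! ### The tables for the four types of quadrants -/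

/-- The identity or the negation. -/
def sg (b : Bool) (r : ℝ) : ℝ := if b then r else -r

namespace Quadrant

/-- The first coordinate of the vertex, reflected such that the quadrant extends to the east. -/
def u (q : Quadrant) : ℝ := sg q.east q.x

/-- The second coordinate of the vertex, reflected such that the quadrant extends to the north. -/
def v (q : Quadrant) : ℝ := sg q.north q.y

/-- The key of a quadrant in a search tree of quadrants. -/
def key (q : Quadrant) : Key :=
  mkKey q.x q.y (if q.east then 1 else 0) (if q.north then 1 else 0)

end Quadrant

/-- For the quadrants of one type: the tree `A` has the key `-v` and the value `u`,
the tree `B` has the key `-u` and the value `v`. -/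
structure Table : Type where
  e : Bool
  n : Bool
  A : AVL
  B : AVL

noncomputable def Table.enc (t : Table) : Val :=
  .pair (.pair (encBool t.e) (encBool t.n)) (.pair t.A.enc t.B.enc)

/-- The second key component `1` meets a `0` in the query keys of `Table.minU`, which turns the
strict comparison of keys into `v ≤ b`. The third component keeps quadrants with equal `v` apart. -/
noncomputable def fillA (e n : Bool) : List Quadrant → AVL
  | [] => .leaf
  | q :: qs => if q.east = e ∧ q.north = n then .ins (mkKey (-q.v) 1 q.u 0) q.u (fillA e n qs)
      else fillA e n qs

noncomputable def fillB (e n : Bool) : List Quadrant → AVL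
  | [] => .leaf
  | q :: qs => if q.east = e ∧ q.north = n then .ins (mkKey (-q.u) 1 q.v 0) q.v (fillB e n qs)
      else fillB e n qs

noncomputable def mkTable (qs : List Quadrant) (e n : Bool) : Table :=
  ⟨e, n, fillA e n qs, fillB e n qs⟩

noncomputable def mkTables (qs : List Quadrant) : List Table :=
  [mkTable qs true true, mkTable qs true false, mkTable qs false true, mkTable qs false false]

namespace Table

/-- The least `u` among the quadrants of the table with `v ≤ b`. -/
noncomputable def minU (t : Table) (b : ℝ) : Option ℝ := t.A.query (mkKey (-b) 0 0 0)

/-- The least `v` among the quadrants of the table with `u ≤ a`. -/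
noncomputable def minV (t : Table) (a : ℝ) : Option ℝ := t.B.query (mkKey (-a) 0 0 0)

end Table

/-- Whether some quadrant contains the point `p`, and the span of the first coordinates of `p` and
of the vertices of the quadrants that contain `p`. -/
noncomputable def info : List Table → Point → Bool × ℝ × ℝ
  | [], p => (false, p.1, p.1)
  | t :: ts, p =>
    match t.minU (sg t.n p.2) with
    | none => info ts p
    | some u =>
      if u ≤ sg t.e p.1 then
        (true, if t.e then (min (info ts p).2.1 u, (info ts p).2.2)
          else ((info ts p).2.1, max (info ts p).2.2 (-u)))
      else info ts p

/-- For every type a quadrant that, among those whose `u` is at most that of the vertical line at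
`z`, has the least `v`. -/
noncomputable def coverQs : List Table → ℝ → List Quadrant
  | [], _ => []
  | t :: ts, z =>
    match t.minV (sg t.e z) with
    | none => coverQs ts z
    | some v =>
      match t.minU v with
      | none => coverQs ts z
      | some u => ⟨sg t.e u, sg t.n v, t.e, t.n⟩ :: coverQs ts z

/-- A multiset of quadrants, as a list and as a tree of multiplicities. -/
structure Cover : Type where
  L : List Quadrant
  T : AVL

namespace Cover

noncomputable def enc (c : Cover) : Val :=
  .pair (.real c.L.length) (.pair (encList encQuadrant c.L) c.T.enc)

noncomputable def add (c : Cover) (q : Quadrant) : Cover :=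
  ⟨q :: c.L, c.T.ins q.key (((c.T.get q.key).elim 0 id) + 1)⟩

noncomputable def addAll (c : Cover) : List Quadrant → Cover
  | [] => c
  | q :: l => (c.addAll l).add q

end Cover

/-! ### Programs -/

def eSg (b r : Expr) : Expr := .ifPair b r (.sub .zero r)

def eSame (a b : Expr) : Expr := .ifPair a (.ifPair b eTrue .nil) (.ifPair b .nil eTrue)

def eKey (a b c d : Expr) : Expr := .pair a (.pair b (.pair c d))

def eNegKey (r : Expr) : Expr := eKey (.sub .zero r) .zero .zero .zero

def eMin (a b : Expr) : Expr := .ifLe a b a b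

def eMax (a b : Expr) : Expr := .ifLe a b b a

/-- The trees of the table of a given type, for the input `(type, quadrants)`. -/
def fillBody : Expr :=
  .ifPair (.snd (.var 0))
    (.letIn (.call 9 (.pair (.fst (.var 0)) (.snd (.snd (.var 0)))))
    (.letIn (.fst (.snd (.var 1)))
      (.ifPair (eSame (.fst (.fst (.var 0))) (.fst (.fst (.var 2))))
        (.ifPair (eSame (.snd (.fst (.var 0))) (.snd (.fst (.var 2))))
          (.letIn (eSg (.fst (.fst (.var 0))) (.fst (.snd (.var 0))))
          (.letIn (eSg (.snd (.fst (.var 1))) (.snd (.snd (.var 1))))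
            (.pair
              (.call 3 (.pair (.pair (eKey (.sub .zero (.var 0)) .one (.var 1) .zero) (.var 1))
                (.fst (.var 3))))
              (.call 3 (.pair (.pair (eKey (.sub .zero (.var 1)) .one (.var 0) .zero) (.var 0))
                (.snd (.var 3)))))))
          (.var 1))
        (.var 1))))
    (.pair .nil .nil)

def eQuery (k t : Expr) : Expr := .call 8 (.pair k t)

/-- `info`, for the input `(tables, point)`. -/
def infoBody : Expr :=
  .ifPair (.fst (.var 0))
    (.letIn (.call 10 (.pair (.snd (.fst (.var 0))) (.snd (.var 0))))
    (.letIn (.fst (.fst (.var 1)))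
    (.letIn (eSg (.fst (.fst (.var 0))) (.fst (.snd (.var 2))))
    (.letIn (eQuery (eNegKey (eSg (.snd (.fst (.var 1))) (.snd (.snd (.var 3)))))
        (.fst (.snd (.var 1))))
      (.ifPair (.var 0)
        (.ifLe (.fst (.var 0)) (.var 1)
          (.pair eTrue (.ifPair (.fst (.fst (.var 2)))
            (.pair (eMin (.fst (.snd (.var 3))) (.fst (.var 0))) (.snd (.snd (.var 3))))
            (.pair (.fst (.snd (.var 3)))
              (eMax (.snd (.snd (.var 3))) (.sub .zero (.fst (.var 0)))))))
          (.var 3))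
        (.var 3))))))
    (.pair .nil (.pair (.fst (.snd (.var 0))) (.fst (.snd (.var 0)))))

def eQKey (q : Expr) : Expr :=
  eKey (.fst (.snd q)) (.snd (.snd q)) (.ifPair (.fst (.fst q)) .one .zero)
    (.ifPair (.snd (.fst q)) .one .zero)

/-- `Cover.add`, for the input `(cover, quadrant)`. -/
def addBody : Expr :=
  .letIn (eQKey (.snd (.var 0)))
  (.letIn (.call 4 (.pair (.var 0) (.snd (.snd (.fst (.var 1))))))
    (.pair (.add (.fst (.fst (.var 2))) .one)
      (.pair (.pair (.snd (.var 2)) (.fst (.snd (.fst (.var 2)))))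
        (.call 3 (.pair (.pair (.var 1) (.ifPair (.var 0) (.add (.snd (.var 0)) .one) .one))
          (.snd (.snd (.fst (.var 2)))))))))

/-- Adds `coverQs` to a cover, for the input `(tables, z, cover)`. -/
def coverBody : Expr :=
  .ifPair (.fst (.var 0))
    (.letIn (.call 12 (.pair (.snd (.fst (.var 0))) (.snd (.var 0))))
    (.letIn (.fst (.fst (.var 1)))
    (.letIn (eQuery (eNegKey (eSg (.fst (.fst (.var 0))) (.fst (.snd (.var 2)))))
        (.snd (.snd (.var 0))))
      (.ifPair (.var 0)
        (.letIn (eQuery (eNegKey (.fst (.var 0))) (.fst (.snd (.var 1))))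
          (.ifPair (.var 0)
            (.call 11 (.pair (.var 3) (.pair (.fst (.var 2))
              (.pair (eSg (.fst (.fst (.var 2))) (.fst (.var 0)))
                (eSg (.snd (.fst (.var 2))) (.fst (.var 1)))))))
            (.var 3)))
        (.var 2)))))
    (.snd (.snd (.var 0)))

/-- Greedy piercing of intervals, for the input `(next, points, tables, count, cover)`. -/
def greedyBody : Expr :=
  .ifPair (.fst (.var 0))
    (.letIn (.fst (.fst (.var 0)))
    (.letIn (.snd (.var 1))
      (.call 13 (.pair (eQuery (eKey (.var 1) .one .zero .zero) (.fst (.var 0)))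
        (.pair (.fst (.var 0)) (.pair (.fst (.snd (.var 0)))
          (.pair (.add (.fst (.snd (.snd (.var 0)))) .one)
            (.call 12 (.pair (.fst (.snd (.var 0)))
              (.pair (.var 1) (.snd (.snd (.snd (.var 0))))))))))))))
    (.snd (.snd (.snd (.var 0))))

def eEmptyCover : Expr := .pair .zero (.pair .nil .nil)

/-- A state with a new cover, for the input `(tables, points, uncovered points)`. -/
def rebuildBody : Expr :=
  .letIn (.fst (.snd (.var 0)))
    (.pair (.fst (.var 1)) (.pair (.var 0) (.pair (.snd (.snd (.var 1))) (.pair .zero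
      (.call 13 (.pair (.ifPair (.var 0) (.pair (.snd (.fst (.var 0))) .nil) .nil)
        (.pair (.var 0) (.pair (.fst (.var 1)) (.pair .zero eEmptyCover)))))))))

/-- Rebuilds the cover of a state if it is outdated. -/
def finishBody : Expr :=
  .letIn (.snd (.snd (.snd (.var 0))))
    (.ifLe (.add (.fst (.var 0)) (.fst (.var 0))) (.fst (.snd (.var 0))) (.var 1)
      (.call 14 (.pair (.fst (.var 1))
        (.pair (.fst (.snd (.var 1))) (.fst (.snd (.snd (.var 1))))))))

def insertBody : Expr :=
  .letIn (.call 10 (.pair (.fst (.fst (.var 0))) (.snd (.var 0))))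
  (.letIn (.pair (.fst (.snd (.var 0))) (.pair .zero (.snd (.var 1))))
  (.letIn (.fst (.var 2))
  (.letIn (.snd (.snd (.snd (.var 0))))
    (.ifPair (.fst (.var 3))
      (.call 15 (.pair (.fst (.var 1))
        (.pair (.call 3 (.pair (.pair (.var 2) (.snd (.snd (.var 3)))) (.fst (.snd (.var 1)))))
        (.pair (.fst (.snd (.snd (.var 1))))
        (.pair (.add (.fst (.var 0)) .one)
        (.pair (.fst (.snd (.var 0)))
          (.call 12 (.pair (.fst (.var 1)) (.pair (.fst (.snd (.var 4)))
            (.snd (.snd (.var 0))))))))))))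
      (.pair (.fst (.var 1)) (.pair (.fst (.snd (.var 1)))
        (.pair (.call 3 (.pair (.pair (.var 2) .zero) (.fst (.snd (.snd (.var 1))))))
          (.var 0))))))))

def deleteBody : Expr :=
  .letIn (.call 10 (.pair (.fst (.fst (.var 0))) (.snd (.var 0))))
  (.letIn (.pair (.fst (.snd (.var 0))) (.pair .zero (.snd (.var 1))))
  (.letIn (.fst (.var 2))
  (.letIn (.snd (.snd (.snd (.var 0))))
    (.ifPair (.fst (.var 3))
      (.call 15 (.pair (.fst (.var 1))
        (.pair (.call 7 (.pair (.var 2) (.fst (.snd (.var 1)))))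
        (.pair (.fst (.snd (.snd (.var 1))))
        (.pair (.add (.fst (.var 0)) .one) (.snd (.var 0)))))))
      (.pair (.fst (.var 1)) (.pair (.fst (.snd (.var 1)))
        (.pair (.call 7 (.pair (.var 2) (.fst (.snd (.snd (.var 1))))))
          (.var 0))))))))

/-- Inserts all points of a list into a state, for the input `(points, state)`. -/
def loadBody : Expr :=
  .ifPair (.fst (.var 0))
    (.call 16 (.pair (.call 18 (.pair (.snd (.fst (.var 0))) (.snd (.var 0))))
      (.fst (.fst (.var 0)))))
    (.snd (.var 0))

def eTable (e n qs : Expr) : Expr := .pair (.pair e n) (.call 9 (.pair (.pair e n) qs))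

def constructBody : Expr :=
  .letIn (.pair (eTable eTrue eTrue (.snd (.var 0)))
    (.pair (eTable eTrue .nil (.snd (.var 0)))
    (.pair (eTable .nil eTrue (.snd (.var 0)))
    (.pair (eTable .nil .nil (.snd (.var 0))) .nil))))
  (.letIn (.call 18 (.pair (.fst (.var 1)) (.pair (.var 0)
      (.pair .nil (.pair .nil (.pair .zero (.pair .zero eEmptyCover)))))))
    (.call 14 (.pair (.fst (.var 0))
      (.pair (.fst (.snd (.var 0))) (.fst (.snd (.snd (.var 0))))))))

/-- Answers a query by `e` if there is a solution in the state `st`. -/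
def eAnswer (st e : Expr) : Expr := .ifPair (.fst (.snd (.snd st))) eTrue e

def eCover (st : Expr) : Expr := .snd (.snd (.snd (.snd (.snd st))))

def sizeBody : Expr := eAnswer (.var 0) (.fst (eCover (.var 0)))

def memberBody : Expr :=
  eAnswer (.fst (.var 0))
    (.letIn (.call 4 (.pair (eQKey (.snd (.var 0))) (.snd (.snd (eCover (.fst (.var 0)))))))
      (.ifPair (.var 0) (.snd (.var 0)) .zero))

def reportBody : Expr := eAnswer (.var 0) (.fst (.snd (eCover (.var 0))))

def code : List Expr :=
  treeCode ++ [fillBody, infoBody, addBody, coverBody, greedyBody, rebuildBody, finishBody,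
    insertBody, deleteBody, loadBody, constructBody, sizeBody, memberBody, reportBody]

/-! ### Running times -/

set_option linter.unusedSimpArgs false

theorem encBool_true : encBool true = .pair .nil .nil := rfl

theorem encBool_false : encBool false = .nil := rfl

theorem ev_sg {P : List Expr} {env : List Val} {eb er : Expr} {b : Bool} {r : ℝ} {s t : ℕ}
    (hb : Ev P env eb (encBool b) s) (hr : Ev P env er (.real r) t) :
    Ev P env (eSg eb er) (.real (sg b r)) (s + t + 3) := by
  refine .of_wp (hb.wp fun m hm => ?_)
  cases b
  · simp only [encBool_true, encBool_false, Val.casesPair, wp]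
    exact hr.wp fun m hm => ⟨by simp [sg], by omega⟩
  · simp only [encBool_true, encBool_false, Val.casesPair]
    exact hr.wp fun m hm => ⟨by simp [sg], by omega⟩

theorem ev_same {P : List Expr} {env : List Val} {ea eb : Expr} {a b : Bool} {s t : ℕ}
    (ha : Ev P env ea (encBool a) s) (hb : Ev P env eb (encBool b) t) :
    Ev P env (eSame ea eb) (encBool (decide (a = b))) (s + t + 5) := by
  refine .of_wp (ha.wp fun m hm => ?_)
  cases a <;> simp only [encBool_true, encBool_false, Val.casesPair, wp] <;>
    refine hb.wp fun m hm => ?_ <;>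
    cases b <;> simp [encBool_true, encBool_false, eTrue] <;> omega

theorem ev_min {P : List Expr} {env : List Val} {ea eb : Expr} {a b : ℝ} {s t : ℕ}
    (ha : Ev P env ea (.real a) s) (hb : Ev P env eb (.real b) t) :
    Ev P env (eMin ea eb) (.real (min a b)) (2 * s + 2 * t + 1) := by
  refine .of_wp (ha.wp fun m hm => hb.wp fun m hm => ⟨fun h => ?_, fun h => ?_⟩)
  · exact ha.wp fun m hm => ⟨by rw [min_eq_left h], by omega⟩
  · exact hb.wp fun m hm => ⟨by rw [min_eq_right (not_le.1 h).le], by omega⟩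

theorem ev_max {P : List Expr} {env : List Val} {ea eb : Expr} {a b : ℝ} {s t : ℕ}
    (ha : Ev P env ea (.real a) s) (hb : Ev P env eb (.real b) t) :
    Ev P env (eMax ea eb) (.real (max a b)) (2 * s + 2 * t + 1) := by
  refine .of_wp (ha.wp fun m hm => hb.wp fun m hm => ⟨fun h => ?_, fun h => ?_⟩)
  · exact hb.wp fun m hm => ⟨by rw [max_eq_right h], by omega⟩
  · exact ha.wp fun m hm => ⟨by rw [max_eq_left (not_le.1 h).le], by omega⟩

theorem ev_negKey {P : List Expr} {env : List Val} {er : Expr} {r : ℝ} {s : ℕ}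
    (hr : Ev P env er (.real r) s) :
    Ev P env (eNegKey er) (encKey (mkKey (-r) 0 0 0)) (s + 8) := by
  refine .of_wp ?_
  simp only [eNegKey, eKey, wp]
  exact hr.wp fun m hm => ⟨by simp [encKey_mkKey], by omega⟩

theorem ev_query {env : List Val} {ek et : Expr} {k : Key} {t : AVL} {s s' : ℕ}
    (hk : Ev code env ek (encKey k) s) (ht : Ev code env et t.enc s') :
    Ev code env (eQuery ek et) (encOption (t.query k)) (s + s' + 400 * (t.height + 1) + 2) := by
  refine .of_wp (hk.wp fun m hm => ht.wp fun m hm => ?_)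
  exact (AVL.computes_query _ _).calls fun t ht => ⟨rfl, by omega⟩

theorem ev_qKey {P : List Expr} {env : List Val} {eq : Expr} {q : Quadrant} {s : ℕ}
    (hq : Ev P env eq (encQuadrant q) s) :
    Ev P env (eQKey eq) (encKey q.key) (4 * s + 20) := by
  refine .of_wp ?_
  simp only [eQKey, eKey, wp]
  refine hq.wp fun m hm => ?_
  simp only [encQuadrant, Val.onPair]
  refine hq.wp fun m hm => ?_
  simp only [encQuadrant, Val.onPair]
  refine hq.wp fun m hm => ?_
  rcases q with ⟨x, y, e, n⟩
  cases e
  all_goals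
    simp only [encQuadrant, Val.onPair, encBool_true, encBool_false, Val.casesPair]
    refine hq.wp fun m hm => ?_
    cases n <;> simp [encQuadrant, encBool_true, encBool_false, Quadrant.key, encKey_mkKey] <;> omega

/-! ### Programs for tables, spans and covers -/

theorem computes_fill (e n : Bool) (qs : List Quadrant) {H : ℕ}
    (hA : ∀ qs' : List Quadrant, qs'.length ≤ qs.length →
      (fillA e n qs').height ≤ H ∧ (fillB e n qs').height ≤ H) :
    Computes code 9 (.pair (.pair (encBool e) (encBool n)) (encList encQuadrant qs))
      (.pair (fillA e n qs).enc (fillB e n qs).enc) (4300 * (qs.length + 1) * (H + 1)) := by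
  induction qs with
  | nil =>
    refine .of_wp (body := fillBody) rfl ?_
    simp [fillBody, encList, fillA, fillB, AVL.enc]
    omega
  | cons q qs ih =>
    refine .of_wp (body := fillBody) rfl ?_
    simp only [fillBody, wp]
    refine ⟨_, rfl, ?_⟩
    simp only [encList, Val.onPair, Val.casesPair]
    refine ⟨_, rfl, _, rfl, ?_⟩
    simp only [Val.onPair]
    refine (ih fun qs' h => hA qs' (by simp; omega)).calls fun t ht => ?_
    obtain ⟨hHA, hHB⟩ := hA qs (by simp)
    have hlen : 4300 * ((q :: qs).length + 1) * (H + 1) =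
      4300 * (qs.length + 1) * (H + 1) + 4300 * (H + 1) := by
      rw [List.length_cons]; ring
    rw [hlen]
    refine ⟨_, rfl, ?_⟩
    simp only [Val.onPair]
    refine (ev_same (a := q.east) (b := e) (s := 10) (t := 10) (.of_wp (by simp [encQuadrant]))
      (.of_wp (by simp))).wp fun m hm => ?_
    by_cases he : q.east = e
    · simp only [he, decide_true, encBool_true, encBool_false, Val.casesPair]
      refine (ev_same (a := q.north) (b := n) (s := 10) (t := 10) (.of_wp (by simp [encQuadrant]))
        (.of_wp (by simp))).wp fun m hm => ?_
      by_cases hn : q.north = n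
      · simp only [hn, decide_true, encBool_true, encBool_false, Val.casesPair]
        refine (ev_sg (b := q.east) (r := q.x) (s := 10) (t := 10) (.of_wp (by simp [encQuadrant]))
          (.of_wp (by simp [encQuadrant]))).wp fun m hm => ?_
        refine (ev_sg (b := q.north) (r := q.y) (s := 10) (t := 10) (.of_wp (by simp [encQuadrant]))
          (.of_wp (by simp [encQuadrant]))).wp fun m hm => ?_
        simp [eKey]
        refine (AVL.computes_ins (mkKey (-q.v) 1 q.u 0) q.u (fillA e n qs)).calls fun m hm => ?_
        refine (AVL.computes_ins (mkKey (-q.u) 1 q.v 0) q.v (fillB e n qs)).calls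
          fun m hm => ⟨?_, ?_⟩
        · simp [fillA, fillB, he, hn]
        · omega
      · simp [hn, encBool_true, encBool_false, fillA, fillB]
        omega
    · simp [he, encBool_true, encBool_false, fillA, fillB]
      omega

def encInfo (i : Bool × ℝ × ℝ) : Val := .pair (encBool i.1) (.pair (.real i.2.1) (.real i.2.2))

theorem computes_info (ts : List Table) (p : Point) {H : ℕ} (hH : ∀ t ∈ ts, t.A.height ≤ H) :
    Computes code 10 (.pair (encList Table.enc ts) (encPoint p)) (encInfo (info ts p))
      (700 * (ts.length + 1) * (H + 1)) := by
  induction ts with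
  | nil =>
    refine .of_wp (body := infoBody) rfl ?_
    simp [infoBody, encList, encPoint, encInfo, info, encBool_true, encBool_false]
    omega
  | cons t ts ih =>
    refine .of_wp (body := infoBody) rfl ?_
    simp only [infoBody, wp]
    refine ⟨_, rfl, ?_⟩
    simp only [encList, Val.onPair, Val.casesPair]
    refine ⟨_, rfl, _, rfl, ?_⟩
    simp only [Val.onPair]
    refine (ih fun t ht => hH t (.tail _ ht)).calls fun m hm => ?_
    have hHt := hH t List.mem_cons_self
    have hlen : 700 * ((t :: ts).length + 1) * (H + 1) =
      700 * (ts.length + 1) * (H + 1) + 700 * (H + 1) := by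
      rw [List.length_cons]; ring
    rw [hlen]
    refine ⟨_, rfl, ?_⟩
    simp only [Val.onPair]
    refine (ev_sg (b := t.e) (r := p.1) (s := 10) (t := 10) (.of_wp (by simp [Table.enc]))
      (.of_wp (by simp [encPoint]))).wp fun m hm => ?_
    refine (ev_query (k := mkKey (-(sg t.n p.2)) 0 0 0) (t := t.A) (s := 31) (s' := 10)
      (ev_negKey (ev_sg (s := 10) (t := 10) (.of_wp (by simp [Table.enc]))
        (.of_wp (by simp [encPoint])))) (.of_wp (by simp [Table.enc]))).wp fun m hm => ?_
    refine ⟨_, rfl, ?_⟩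
    rw [info, Table.minU]
    rcases hq : t.A.query (mkKey (-(sg t.n p.2)) 0 0 0) with _ | u
    · simp [encOption]
      omega
    · simp only [encOption, Val.casesPair]
      refine ⟨_, rfl, ?_⟩
      simp only [Val.onPair]
      refine ⟨_, rfl, ?_⟩
      simp only [Val.onReal]
      refine ⟨fun h => ?_, fun h => ?_⟩
      · rw [if_pos h]
        simp only [eTrue, wp]
        refine ⟨_, rfl, ?_⟩
        rcases hte : t.e
        · simp only [Table.enc, Val.onPair, hte, encBool_true, encBool_false, Val.casesPair]
          refine ⟨_, rfl, ?_⟩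
          simp only [encInfo, Val.onPair]
          refine (ev_max (a := (info ts p).2.2) (b := -u) (s := 10) (t := 10)
            (.of_wp (by simp)) (.of_wp (by simp))).wp fun m hm => ⟨?_, ?_⟩
          · simp [encBool_true, encBool_false]
          · omega
        · simp only [Table.enc, Val.onPair, hte, encBool_true, encBool_false, Val.casesPair]
          refine (ev_min (a := (info ts p).2.1) (b := u) (s := 10) (t := 10)
            (.of_wp (by simp [encInfo])) (.of_wp (by simp))).wp fun m hm => ?_
          simp [encInfo, encBool_true, encBool_false]
          omega
      · simp [h]
        omega

theorem computes_add (c : Cover) (q : Quadrant) :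
    Computes code 11 (.pair c.enc (encQuadrant q)) (c.add q).enc (2600 * (c.T.height + 1)) := by
  refine .of_wp (body := addBody) rfl ?_
  simp only [addBody, wp]
  refine (ev_qKey (q := q) (s := 10) (.of_wp (by simp))).wp fun m hm => ?_
  simp [Cover.enc]
  refine (AVL.computes_get q.key c.T).calls fun m hm => ?_
  rcases hg : c.T.get q.key with _ | x
  · simp [AVL.encGet]
    refine (AVL.computes_ins q.key 1 c.T).calls fun m hm => ⟨?_, ?_⟩
    · simp [Cover.add, encList, hg]
    · omega
  · simp [AVL.encGet]
    refine (AVL.computes_ins q.key (x + 1) c.T).calls fun m hm => ⟨?_, ?_⟩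
    · simp [Cover.add, encList, hg]
    · omega

/-- A crude bound of one level per added quadrant suffices, since at most four are added at a time.
-/
theorem Cover.balanced_addAll {c : Cover} (hc : c.T.Balanced) (l : List Quadrant) :
    (c.addAll l).T.Balanced ∧ (c.addAll l).T.height ≤ c.T.height + l.length := by
  induction l with
  | nil => exact ⟨hc, le_rfl⟩
  | cons q l ih =>
    have := AVL.balanced_ins q.key (((c.addAll l).T.get q.key).elim 0 id + 1) ih.1
    exact ⟨this.1, by simp only [addAll, add, List.length_cons]; omega⟩

theorem length_coverQs_le (ts : List Table) (z : ℝ) : (coverQs ts z).length ≤ ts.length := by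
  induction ts with
  | nil => simp [coverQs]
  | cons t ts ih =>
    simp only [coverQs, List.length_cons]
    split
    · omega
    · split
      · omega
      · rw [List.length_cons]; omega

theorem computes_cover (ts : List Table) (z : ℝ) (c : Cover) {H : ℕ}
    (hH : ∀ t ∈ ts, t.A.height ≤ H ∧ t.B.height ≤ H) (hc : c.T.Balanced)
    (hcH : c.T.height + ts.length ≤ H) :
    Computes code 12 (.pair (encList Table.enc ts) (.pair (.real z) c.enc))
      (c.addAll (coverQs ts z)).enc (3800 * (ts.length + 1) * (H + 1)) := by
  induction ts with
  | nil =>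
    refine .of_wp (body := coverBody) rfl ?_
    simp [coverBody, encList, coverQs, Cover.addAll]
    omega
  | cons t ts ih =>
    refine .of_wp (body := coverBody) rfl ?_
    simp only [coverBody, wp]
    refine ⟨_, rfl, ?_⟩
    simp only [encList, Val.onPair, Val.casesPair]
    refine ⟨_, rfl, _, rfl, ?_⟩
    simp only [Val.onPair]
    rw [List.length_cons] at hcH
    refine (ih (fun t ht => hH t (.tail _ ht)) (by omega)).calls fun m hm => ?_
    obtain ⟨hHA, hHB⟩ := hH t List.mem_cons_self
    have hlen : 3800 * ((t :: ts).length + 1) * (H + 1) =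
      3800 * (ts.length + 1) * (H + 1) + 3800 * (H + 1) := by
      rw [List.length_cons]; ring
    rw [hlen]
    have hR := (Cover.balanced_addAll hc (coverQs ts z)).2
    have hR' := length_coverQs_le ts z
    refine ⟨_, rfl, ?_⟩
    simp only [Val.onPair]
    refine (ev_query (k := mkKey (-(sg t.e z)) 0 0 0) (t := t.B) (s := 31) (s' := 10)
      (ev_negKey (ev_sg (s := 10) (t := 10) (.of_wp (by simp [Table.enc]))
        (.of_wp (by simp)))) (.of_wp (by simp [Table.enc]))).wp fun m hm => ?_
    refine ⟨_, rfl, ?_⟩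
    rw [coverQs, Table.minV]
    rcases hq : t.B.query (mkKey (-(sg t.e z)) 0 0 0) with _ | v
    · simp [encOption]
      omega
    · simp only [encOption, Val.casesPair]
      refine (ev_query (k := mkKey (-v) 0 0 0) (t := t.A) (s := 20) (s' := 10)
        (.of_wp ((ev_negKey (r := v) (s := 10) (.of_wp (by simp))).wp fun m hm => ⟨rfl, by omega⟩))
        (.of_wp (by simp [Table.enc]))).wp fun m hm => ?_
      refine ⟨_, rfl, ?_⟩
      rw [Table.minU]
      rcases hq' : t.A.query (mkKey (-v) 0 0 0) with _ | u
      · simp [encOption]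
        omega
      · simp only [encOption, Val.casesPair]
        refine ⟨_, rfl, _, rfl, ?_⟩
        simp only [Table.enc, Val.onPair]
        refine (ev_sg (b := t.e) (r := u) (s := 10) (t := 10) (.of_wp (by simp))
          (.of_wp (by simp))).wp fun m hm => ?_
        refine (ev_sg (b := t.n) (r := v) (s := 10) (t := 10) (.of_wp (by simp))
          (.of_wp (by simp))).wp fun m hm => ?_
        refine (computes_add (c.addAll (coverQs ts z)) ⟨sg t.e u, sg t.n v, t.e, t.n⟩).calls
          fun m hm => ⟨?_, ?_⟩
        · simp [Cover.addAll]
        · omega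

end QuadrantSetCover

namespace QuadrantSetCover

/-! ### Correctness of the tables -/

/-- Strictly increasing keys make the entries distinct, so any list that contains them all bounds
their number and hence the height. -/
theorem AVL.length_le_of_subset {t : AVL} (ht : t.Sorted) {L : List (Key × ℝ)}
    (h : ∀ e ∈ t.toList, e ∈ L) : t.toList.length ≤ L.length :=
  (List.Nodup.subperm (ht.imp fun h => fun h' => (h' ▸ h).false) h).length_le

/-- A bound for the height of a search tree with at most `n` entries. -/
def hb (n : ℕ) : ℕ := 2 * Nat.log 2 (n + 1) + 1

theorem hb_mono {m n : ℕ} (h : m ≤ n) : hb m ≤ hb n := by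
  have : Nat.log 2 (m + 1) ≤ Nat.log 2 (n + 1) := Nat.log_mono_right (by omega)
  unfold hb
  omega

theorem AVL.height_le_hb {t : AVL} (ht : t.Balanced) (hs : t.Sorted) {L : List (Key × ℝ)}
    (h : ∀ e ∈ t.toList, e ∈ L) {n : ℕ} (hn : L.length ≤ n) : t.height ≤ hb n :=
  (AVL.height_le ht).trans (hb_mono ((AVL.length_le_of_subset hs h).trans hn))

theorem fillA_spec (e n : Bool) (qs : List Quadrant) : (fillA e n qs).Sorted ∧
    (fillA e n qs).Balanced ∧ ∀ x, x ∈ (fillA e n qs).toList ↔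
      ∃ q ∈ qs, q.east = e ∧ q.north = n ∧ x = (mkKey (-q.v) 1 q.u 0, q.u) := by
  induction qs with
  | nil => simp [fillA, AVL.Sorted, AVL.Balanced, AVL.toList]
  | cons q qs ih =>
    obtain ⟨h1, h2, h3⟩ := ih
    rw [fillA]
    split_ifs with h
    · obtain ⟨h4, h5⟩ := AVL.sorted_ins (mkKey (-q.v) 1 q.u 0) q.u h1
      refine ⟨h4, (AVL.balanced_ins _ _ h2).1, fun x => ?_⟩
      rw [h5, h3]
      simp only [List.mem_cons, exists_eq_or_imp, h, true_and]
      constructor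
      · rintro (rfl | ⟨h, -⟩)
        exacts [.inl rfl, .inr h]
      · rintro (rfl | ⟨q', hq', he, hn, rfl⟩)
        · exact .inl rfl
        -- An insertion may overwrite an entry with the same key, but the key determines the value,
        -- so nothing is lost.
        · by_cases hk : mkKey (-q'.v) 1 q'.u 0 = mkKey (-q.v) 1 q.u 0
          · have := mkKey_inj.1 hk
            exact .inl (by rw [hk, this.2.2.1])
          · exact .inr ⟨⟨q', hq', he, hn, rfl⟩, hk⟩
    · refine ⟨h1, h2, fun x => ?_⟩
      rw [h3]
      simp only [List.mem_cons, exists_eq_or_imp]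
      tauto

theorem fillB_spec (e n : Bool) (qs : List Quadrant) : (fillB e n qs).Sorted ∧
    (fillB e n qs).Balanced ∧ ∀ x, x ∈ (fillB e n qs).toList ↔
      ∃ q ∈ qs, q.east = e ∧ q.north = n ∧ x = (mkKey (-q.u) 1 q.v 0, q.v) := by
  induction qs with
  | nil => simp [fillB, AVL.Sorted, AVL.Balanced, AVL.toList]
  | cons q qs ih =>
    obtain ⟨h1, h2, h3⟩ := ih
    rw [fillB]
    split_ifs with h
    · obtain ⟨h4, h5⟩ := AVL.sorted_ins (mkKey (-q.u) 1 q.v 0) q.v h1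
      refine ⟨h4, (AVL.balanced_ins _ _ h2).1, fun x => ?_⟩
      rw [h5, h3]
      simp only [List.mem_cons, exists_eq_or_imp, h, true_and]
      constructor
      · rintro (rfl | ⟨h, -⟩)
        exacts [.inl rfl, .inr h]
      · rintro (rfl | ⟨q', hq', he, hn, rfl⟩)
        · exact .inl rfl
        · by_cases hk : mkKey (-q'.u) 1 q'.v 0 = mkKey (-q.u) 1 q.v 0
          · have := mkKey_inj.1 hk
            exact .inl (by rw [hk, this.2.2.1])
          · exact .inr ⟨⟨q', hq', he, hn, rfl⟩, hk⟩
    · refine ⟨h1, h2, fun x => ?_⟩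
      rw [h3]
      simp only [List.mem_cons, exists_eq_or_imp]
      tauto

theorem height_fillA_le (e n : Bool) {qs : List Quadrant} {m : ℕ} (hm : qs.length ≤ m) :
    (fillA e n qs).height ≤ hb m := by
  obtain ⟨h1, h2, h3⟩ := fillA_spec e n qs
  refine AVL.height_le_hb (L := qs.map fun q => (mkKey (-q.v) 1 q.u 0, q.u)) h2 h1 (fun x hx => ?_)
    (by simpa using hm)
  obtain ⟨q, hq, -, -, rfl⟩ := (h3 x).1 hx
  exact List.mem_map_of_mem hq

theorem height_fillB_le (e n : Bool) {qs : List Quadrant} {m : ℕ} (hm : qs.length ≤ m) :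
    (fillB e n qs).height ≤ hb m := by
  obtain ⟨h1, h2, h3⟩ := fillB_spec e n qs
  refine AVL.height_le_hb (L := qs.map fun q => (mkKey (-q.u) 1 q.v 0, q.v)) h2 h1 (fun x hx => ?_)
    (by simpa using hm)
  obtain ⟨q, hq, -, -, rfl⟩ := (h3 x).1 hx
  exact List.mem_map_of_mem hq

theorem sg_sg (b : Bool) (r : ℝ) : sg b (sg b r) = r := by cases b <;> simp [sg]

theorem Quadrant.mem_toSet {q : Quadrant} {p : Point} :
    p ∈ q.toSet ↔ q.u ≤ sg q.east p.1 ∧ q.v ≤ sg q.north p.2 := by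
  rcases q with ⟨x, y, _ | _, _ | _⟩ <;> simp [Quadrant.toSet, Quadrant.u, Quadrant.v, sg]

/-- The quadrants of the type of the table. -/
def Table.Has (qs : List Quadrant) (t : Table) (q : Quadrant) : Prop :=
  q ∈ qs ∧ q.east = t.e ∧ q.north = t.n

/-- The table answers the queries for the quadrants of its type. -/
def Table.Valid (qs : List Quadrant) (t : Table) : Prop :=
  (∀ b, IsOptMin {u | ∃ q, t.Has qs q ∧ q.v ≤ b ∧ q.u = u} (t.minU b)) ∧
  ∀ a, IsOptMin {v | ∃ q, t.Has qs q ∧ q.u ≤ a ∧ q.v = v} (t.minV a)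

theorem valid_mkTable (qs : List Quadrant) (e n : Bool) : (mkTable qs e n).Valid qs := by
  constructor
  · intro b
    obtain ⟨h1, -, h3⟩ := fillA_spec e n qs
    convert AVL.isOptMin_query (mkKey (-b) 0 0 0) h1 using 1
    swap
    · rfl
    ext u
    simp only [h3, Table.Has, mkTable, Set.mem_ofPred_eq]
    constructor
    · rintro ⟨q, ⟨hq, he, hn⟩, hb, rfl⟩
      refine ⟨_, ?_, q, hq, he, hn, rfl⟩
      rw [mkKey_lt_mkKey]
      rcases hb.lt_or_eq with hb | rfl
      · left; linarith
      · right; simp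
    · rintro ⟨k, hk, q, hq, he, hn, h⟩
      obtain ⟨rfl, rfl⟩ := Prod.mk.inj h
      refine ⟨q, ⟨hq, he, hn⟩, ?_, rfl⟩
      rw [mkKey_lt_mkKey] at hk
      rcases hk with hk | ⟨hk, -⟩ <;> linarith
  · intro a
    obtain ⟨h1, -, h3⟩ := fillB_spec e n qs
    convert AVL.isOptMin_query (mkKey (-a) 0 0 0) h1 using 1
    swap
    · rfl
    ext v
    simp only [h3, Table.Has, mkTable, Set.mem_ofPred_eq]
    constructor
    · rintro ⟨q, ⟨hq, he, hn⟩, hb, rfl⟩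
      refine ⟨_, ?_, q, hq, he, hn, rfl⟩
      rw [mkKey_lt_mkKey]
      rcases hb.lt_or_eq with hb | rfl
      · left; linarith
      · right; simp
    · rintro ⟨k, hk, q, hq, he, hn, h⟩
      obtain ⟨rfl, rfl⟩ := Prod.mk.inj h
      refine ⟨q, ⟨hq, he, hn⟩, ?_, rfl⟩
      rw [mkKey_lt_mkKey] at hk
      rcases hk with hk | ⟨hk, -⟩ <;> linarith

/-- The tables of all four types. -/
def ValidTables (qs : List Quadrant) (ts : List Table) : Prop :=
  (∀ t ∈ ts, t.Valid qs) ∧ ∀ e n, ∃ t ∈ ts, t.e = e ∧ t.n = n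

theorem valid_mkTables (qs : List Quadrant) : ValidTables qs (mkTables qs) := by
  constructor
  · simp only [mkTables, List.mem_cons, List.not_mem_nil, or_false]
    rintro t (rfl | rfl | rfl | rfl) <;> exact valid_mkTable ..
  · rintro (_ | _) (_ | _) <;> simp [mkTables, mkTable]

/-! ### The span of a point and the quadrants chosen on a vertical line -/

/-- The least `u` of the quadrants of the table that contain `p`. -/
def Table.IsHit (t : Table) (p : Point) (u : ℝ) : Prop :=
  t.minU (sg t.n p.2) = some u ∧ u ≤ sg t.e p.1

theorem Table.Valid.exists_of_isHit {qs : List Quadrant} {t : Table} (ht : t.Valid qs) {p : Point}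
    {u : ℝ} (h : t.IsHit p u) : ∃ q, t.Has qs q ∧ p ∈ q.toSet ∧ q.u = u := by
  have h1 := ht.1 (sg t.n p.2)
  rw [h.1] at h1
  obtain ⟨q, hq, hv, hu⟩ := h1.1
  refine ⟨q, hq, ?_, hu⟩
  rw [Quadrant.mem_toSet, hq.2.1, hq.2.2, hu]
  exact ⟨h.2, hv⟩

theorem Table.Valid.exists_isHit {qs : List Quadrant} {t : Table} (ht : t.Valid qs) {p : Point}
    {q : Quadrant} (hq : t.Has qs q) (hp : p ∈ q.toSet) : ∃ u, t.IsHit p u ∧ u ≤ q.u := by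
  rw [Quadrant.mem_toSet, hq.2.1, hq.2.2] at hp
  have h1 := ht.1 (sg t.n p.2)
  unfold Table.IsHit
  rcases h2 : t.minU (sg t.n p.2) with _ | u <;> rw [h2] at h1
  · exact absurd (show q.u ∈ (∅ : Set ℝ) from h1 ▸ ⟨q, hq, hp.2, rfl⟩) (Set.notMem_empty _)
  · have h3 : u ≤ q.u := h1.2 ⟨q, hq, hp.2, rfl⟩
    exact ⟨u, ⟨rfl, h3.trans hp.1⟩, h3⟩

/-- An eastward quadrant containing `p` has its vertex to the left of `p` or level with it, so it
can only move the left end; a westward one can only move the right end. For each type the hit with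
the least `u` is the extreme one. That each end is either `p.1` or attained by a hit is what
`exists_mem_coverQs` needs. -/
theorem info_spec (ts : List Table) (p : Point) :
    ((info ts p).1 = true ↔ ∃ t ∈ ts, ∃ u, t.IsHit p u) ∧
    (info ts p).2.1 ≤ p.1 ∧ p.1 ≤ (info ts p).2.2 ∧
    (∀ t ∈ ts, ∀ u, t.IsHit p u → if t.e then (info ts p).2.1 ≤ u else -u ≤ (info ts p).2.2) ∧
    ((info ts p).2.1 = p.1 ∨ ∃ t ∈ ts, t.e = true ∧ t.IsHit p (info ts p).2.1) ∧
    ((info ts p).2.2 = p.1 ∨ ∃ t ∈ ts, t.e = false ∧ t.IsHit p (-(info ts p).2.2)) := by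
  induction ts with
  | nil => simp [info]
  | cons t ts ih =>
    obtain ⟨h1, h2, h3, h4, h5, h6⟩ := ih
    by_cases hhit : ∃ u, t.IsHit p u
    · obtain ⟨u, hu⟩ := hhit
      have huniq : ∀ u', t.IsHit p u' → u' = u := fun u' hu' =>
        Option.some_inj.1 (hu'.1.symm.trans hu.1)
      rw [info, hu.1]
      dsimp only
      rw [if_pos hu.2]
      simp only [List.mem_cons, exists_eq_or_imp, forall_eq_or_imp]
      rcases hte : t.e
      · simp only [Bool.false_eq_true, if_false, true_iff]
        refine ⟨.inl ⟨u, hu⟩, h2, le_max_of_le_left h3, ⟨fun u' hu' => ?_, fun t' ht' u' hu' => ?_⟩,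
          ?_, ?_⟩
        · rw [huniq u' hu']; exact le_max_right _ _
        · have := h4 t' ht' u' hu'
          split_ifs at this ⊢ with h
          · exact this
          · exact le_max_of_le_left this
        · rcases h5 with h5 | h5
          · exact .inl h5
          · exact .inr (.inr h5)
        · rcases max_choice (info ts p).2.2 (-u) with h | h <;> rw [h]
          · rcases h6 with h6 | h6
            · exact .inl h6
            · exact .inr (.inr h6)
          · rw [neg_neg]; exact .inr (.inl ⟨trivial, hu⟩)
      · simp only [if_true, true_iff]
        refine ⟨.inl ⟨u, hu⟩, min_le_of_left_le h2, h3, ⟨fun u' hu' => ?_, fun t' ht' u' hu' => ?_⟩,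
          ?_, ?_⟩
        · rw [huniq u' hu']; exact min_le_right _ _
        · have := h4 t' ht' u' hu'
          split_ifs at this ⊢ with h
          · exact min_le_of_left_le this
          · exact this
        · rcases min_choice (info ts p).2.1 u with h | h <;> rw [h]
          · rcases h5 with h5 | h5
            · exact .inl h5
            · exact .inr (.inr h5)
          · exact .inr (.inl ⟨trivial, hu⟩)
        · rcases h6 with h6 | h6
          · exact .inl h6
          · exact .inr (.inr h6)
    · have hi : info (t :: ts) p = info ts p := by
        rw [info]
        split
        · rfl
        · rename_i u hu
          rw [if_neg fun h => hhit ⟨u, hu, h⟩]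
      rw [hi]
      simp only [List.mem_cons, exists_eq_or_imp, forall_eq_or_imp, hhit, false_or]
      refine ⟨h1, h2, h3, ⟨fun u hu => absurd ⟨u, hu⟩ hhit, h4⟩, ?_, ?_⟩
      · rcases h5 with h5 | h5
        exacts [.inl h5, .inr (.inr h5)]
      · rcases h6 with h6 | h6
        exacts [.inl h6, .inr (.inr h6)]

/-- The tree `B` yields the least `v` but no quadrant. Asking `A` for the least `u` with second
coordinate at most `v` yields a quadrant that still reaches the line, and minimality of `v` forces
its second coordinate to equal `v`. So the vertex assembled from the two answers is that of a
quadrant in the input. -/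
theorem coverQs_mem {qs : List Quadrant} {ts : List Table} (hts : ∀ t ∈ ts, t.Valid qs) (z : ℝ) :
    (∀ q ∈ coverQs ts z, q ∈ qs) ∧ ∀ t ∈ ts, ∀ q₀, t.Has qs q₀ → q₀.u ≤ sg t.e z →
      ∃ q ∈ coverQs ts z, q.east = t.e ∧ q.north = t.n ∧ q.u ≤ sg t.e z ∧ q.v ≤ q₀.v := by
  induction ts with
  | nil => simp [coverQs]
  | cons t ts ih =>
    obtain ⟨ih1, ih2⟩ := ih fun t ht => hts t (.tail _ ht)
    have ht := hts t List.mem_cons_self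
    have hB := ht.2 (sg t.e z)
    rw [coverQs]
    rcases hv : t.minV (sg t.e z) with _ | v <;> rw [hv] at hB
    · refine ⟨ih1, ?_⟩
      simp only [List.mem_cons, forall_eq_or_imp]
      refine ⟨fun q₀ hq₀ hu => ?_, ih2⟩
      exact absurd (show q₀.v ∈ (∅ : Set ℝ) from hB ▸ ⟨q₀, hq₀, hu, rfl⟩) (Set.notMem_empty _)
    · have hA := ht.1 v
      obtain ⟨q₁, hq₁, hu₁, hv₁⟩ := hB.1
      rcases hu : t.minU v with _ | u <;> rw [hu] at hA
      · exact absurd (show q₁.u ∈ (∅ : Set ℝ) from hA ▸ ⟨q₁, hq₁, hv₁.le, rfl⟩) (Set.notMem_empty _)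
      · obtain ⟨q₂, hq₂, hv₂, hu₂⟩ := hA.1
        have hu₃ : u ≤ q₁.u := hA.2 ⟨q₁, hq₁, hv₁.le, rfl⟩
        have hv₃ : v ≤ q₂.v := hB.2 ⟨q₂, hq₂, by linarith, rfl⟩
        have hq : (⟨sg t.e u, sg t.n v, t.e, t.n⟩ : Quadrant) = q₂ := by
          ext1
          · rw [← hu₂, Quadrant.u, hq₂.2.1, sg_sg]
          · rw [le_antisymm hv₃ hv₂, Quadrant.v, hq₂.2.2, sg_sg]
          · exact hq₂.2.1.symm
          · exact hq₂.2.2.symm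
        dsimp only
        rw [hu]
        dsimp only
        rw [hq]
        simp only [List.mem_cons, forall_eq_or_imp, exists_eq_or_imp]
        refine ⟨⟨hq₂.1, ih1⟩, fun q₀ hq₀ hu₀ => .inl ?_, fun t' ht' q₀ hq₀ hu₀ =>
          .inr (ih2 t' ht' q₀ hq₀ hu₀)⟩
        exact ⟨hq₂.2.1, hq₂.2.2, by linarith, hv₂.trans (hB.2 ⟨q₀, hq₀, hu₀, rfl⟩)⟩

namespace ValidTables

theorem exists_has {qs : List Quadrant} {ts : List Table} (h : ValidTables qs ts)
    {q : Quadrant} (hq : q ∈ qs) : ∃ t ∈ ts, t.Has qs q := by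
  obtain ⟨t, ht, he, hn⟩ := h.2 q.east q.north
  exact ⟨t, ht, hq, he.symm, hn.symm⟩

theorem info_fst {qs : List Quadrant} {ts : List Table} (h : ValidTables qs ts)
    {p : Point} : (info ts p).1 = true ↔ ∃ q ∈ qs, p ∈ q.toSet := by
  rw [(info_spec ts p).1]
  constructor
  · rintro ⟨t, ht, u, hu⟩
    obtain ⟨q, hq, hp, -⟩ := (h.1 t ht).exists_of_isHit hu
    exact ⟨q, hq.1, hp⟩
  · rintro ⟨q, hq, hp⟩
    obtain ⟨t, ht, hq⟩ := h.exists_has hq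
    obtain ⟨u, hu, -⟩ := (h.1 t ht).exists_isHit hq hp
    exact ⟨t, ht, u, hu⟩

/-- The half of the reduction that bounds the optimum from below: the vertices of a cover pierce
every span. -/
theorem x_mem_Icc {qs : List Quadrant} {ts : List Table} (h : ValidTables qs ts)
    {p : Point} {q : Quadrant} (hq : q ∈ qs) (hp : p ∈ q.toSet) :
    q.x ∈ Set.Icc (info ts p).2.1 (info ts p).2.2 := by
  obtain ⟨t, ht, hq⟩ := h.exists_has hq
  obtain ⟨u, hu, hu'⟩ := (h.1 t ht).exists_isHit hq hp
  obtain ⟨-, h2, h3, h4, -⟩ := info_spec ts p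
  have h5 := h4 t ht u hu
  have h6 := (Quadrant.mem_toSet.1 hp).1
  rw [← hq.2.1] at h5
  unfold Quadrant.u at *
  rcases he : q.east <;> rw [he] at h5 h6 hu' <;> simp [sg] at h5 h6 hu' <;>
    constructor <;> linarith

/-- The other half of the reduction: a breakpoint in the span of `p` costs at most four quadrants
and takes care of `p`. -/
theorem exists_mem_coverQs {qs : List Quadrant} {ts : List Table} (h : ValidTables qs ts)
    {p : Point} (hp : (info ts p).1 = true) {z : ℝ}
    (hz : z ∈ Set.Icc (info ts p).2.1 (info ts p).2.2) : ∃ q ∈ coverQs ts z, p ∈ q.toSet := by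
  -- Suppose `q₀` contains `p` and reaches the line, and the line lies on the near side of `p`. The
  -- chosen quadrant of this type starts no later than the line, hence no later than `p`, and
  -- reaches at least as far vertically as `q₀`.
  have key : ∀ t ∈ ts, ∀ q₀, t.Has qs q₀ → p ∈ q₀.toSet → q₀.u ≤ sg t.e z →
      sg t.e z ≤ sg t.e p.1 → ∃ q ∈ coverQs ts z, p ∈ q.toSet := by
    intro t ht q₀ hq₀ hp₀ hz₀ hz₁
    obtain ⟨q, hq, he, hn, hu, hv⟩ := (coverQs_mem h.1 z).2 t ht q₀ hq₀ hz₀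
    refine ⟨q, hq, Quadrant.mem_toSet.2 ⟨?_, ?_⟩⟩
    · rw [he]; exact hu.trans hz₁
    · rw [hn, ← hq₀.2.2]; exact hv.trans (Quadrant.mem_toSet.1 hp₀).2
  obtain ⟨h1, -, -, -, h5, h6⟩ := info_spec ts p
  -- To the left of `p`, the left end of the span cannot be `p.1`, so an eastward quadrant attains
  -- it and serves as `q₀`; the right side is symmetric. On the line through `p`, any quadrant
  -- containing `p` serves.
  rcases lt_trichotomy z p.1 with hlt | rfl | hlt
  · rcases h5 with h5 | ⟨t, ht, he, hu⟩
    · linarith [hz.1]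
    · obtain ⟨q₀, hq₀, hp₀, hu₀⟩ := (h.1 t ht).exists_of_isHit hu
      refine key t ht q₀ hq₀ hp₀ ?_ ?_
      · rw [hu₀, he]; simpa [sg] using hz.1
      · rw [he]; simpa [sg] using hlt.le
  · obtain ⟨t, ht, u, hu⟩ := h1.1 hp
    obtain ⟨q₀, hq₀, hp₀, hu₀⟩ := (h.1 t ht).exists_of_isHit hu
    exact key t ht q₀ hq₀ hp₀ (hu₀ ▸ hu.2) le_rfl
  · rcases h6 with h6 | ⟨t, ht, he, hu⟩
    · linarith [hz.2]
    · obtain ⟨q₀, hq₀, hp₀, hu₀⟩ := (h.1 t ht).exists_of_isHit hu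
      refine key t ht q₀ hq₀ hp₀ ?_ ?_
      · rw [hu₀, he]; simpa [sg] using hz.2
      · rw [he]; simpa [sg] using hlt.le

end ValidTables

end QuadrantSetCover

namespace QuadrantSetCover

/-! ### Covers -/

theorem Quadrant.key_injective : Function.Injective Quadrant.key := by
  rintro ⟨x, y, e, n⟩ ⟨x', y', e', n'⟩ h
  rw [Quadrant.key, Quadrant.key, mkKey_inj] at h
  obtain ⟨rfl, rfl, he, hn⟩ := h
  cases e <;> cases e' <;> cases n <;> cases n' <;> simp at he hn ⊢

namespace Cover

/-- The search tree stores the multiplicities of the quadrants in the list. -/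
structure Valid (c : Cover) : Prop where
  sorted : c.T.Sorted
  balanced : c.T.Balanced
  mem_iff : ∀ x, x ∈ c.T.toList ↔ ∃ q ∈ c.L, x = (q.key, (c.L.count q : ℝ))

theorem valid_empty : Valid ⟨[], .leaf⟩ :=
  ⟨by simp [AVL.Sorted, AVL.toList], trivial, by simp [AVL.toList]⟩

theorem Valid.get_key {c : Cover} (h : c.Valid) (q : Quadrant) :
    (c.T.get q.key).elim 0 id = (c.L.count q : ℝ) := by
  rcases hg : c.T.get q.key with _ | v
  · have hq : q ∉ c.L := by
      intro hq
      have := (AVL.get_eq_some h.sorted).2 ((h.mem_iff (q.key, (c.L.count q : ℝ))).2 ⟨q, hq, rfl⟩)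
      simp [hg] at this
    simp [List.count_eq_zero_of_not_mem hq]
  · obtain ⟨q', hq', he⟩ := (h.mem_iff _).1 ((AVL.get_eq_some h.sorted).1 hg)
    obtain ⟨he', rfl⟩ := Prod.mk.inj he
    rw [Quadrant.key_injective he']
    rfl

theorem Valid.add {c : Cover} (h : c.Valid) (q : Quadrant) : (c.add q).Valid := by
  obtain ⟨h1, h2⟩ := AVL.sorted_ins q.key ((c.T.get q.key).elim 0 id + 1) h.sorted
  refine ⟨h1, (AVL.balanced_ins _ _ h.balanced).1, fun x => ?_⟩
  simp only [Cover.add]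
  rw [h2, h.mem_iff, h.get_key]
  simp only [List.mem_cons, exists_eq_or_imp, List.count_cons_self, Nat.cast_add, Nat.cast_one]
  constructor
  · rintro (rfl | ⟨⟨q', hq', rfl⟩, hne⟩)
    · exact .inl rfl
    · refine .inr ⟨q', hq', ?_⟩
      rw [List.count_cons_of_ne]
      rintro rfl
      exact hne rfl
  · rintro (rfl | ⟨q', hq', rfl⟩)
    · exact .inl rfl
    · by_cases he : q' = q
      · subst he
        exact .inl (by simp)
      · exact .inr ⟨⟨q', hq', by rw [List.count_cons_of_ne (Ne.symm he)]⟩,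
          fun h => he (Quadrant.key_injective h)⟩

theorem Valid.addAll {c : Cover} (h : c.Valid) (l : List Quadrant) : (c.addAll l).Valid := by
  induction l with
  | nil => exact h
  | cons q l ih => exact ih.add q

theorem addAll_L (c : Cover) (l : List Quadrant) : (c.addAll l).L = l ++ c.L := by
  induction l with
  | nil => rfl
  | cons q l ih => simp [Cover.addAll, Cover.add, ih]

theorem Valid.height_le {c : Cover} (h : c.Valid) {n : ℕ} (hn : c.L.length ≤ n) :
    c.T.height ≤ hb n := by
  refine AVL.height_le_hb (L := c.L.map fun q => (q.key, (c.L.count q : ℝ))) h.balanced h.sorted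
    (fun x hx => ?_) (by simpa using hn)
  obtain ⟨q, hq, rfl⟩ := (h.mem_iff x).1 hx
  exact List.mem_map_of_mem hq

end Cover

/-! ### Trees of points -/

noncomputable def covered (qs : List Quadrant) (p : Point) : Bool := (info (mkTables qs) p).1

noncomputable def lo (qs : List Quadrant) (p : Point) : ℝ := (info (mkTables qs) p).2.1

noncomputable def hi (qs : List Quadrant) (p : Point) : ℝ := (info (mkTables qs) p).2.2

/-- Here the second component is `0` and the query key has `1`, so that a query at `z` sees only
spans that start strictly beyond `z`. The coordinates of the point make the key injective. -/
noncomputable def pkey (qs : List Quadrant) (p : Point) : Key := mkKey (lo qs p) 0 p.1 p.2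

theorem pkey_injective (qs : List Quadrant) : Function.Injective (pkey qs) := by
  intro p p' h
  obtain ⟨-, -, h1, h2⟩ := mkKey_inj.1 h
  exact Prod.ext h1 h2

theorem lo_le (qs : List Quadrant) (p : Point) : lo qs p ≤ p.1 := (info_spec _ p).2.1

theorem le_hi (qs : List Quadrant) (p : Point) : p.1 ≤ hi qs p := (info_spec _ p).2.2.1

/-- The search tree `t` represents the set `S` of points, with the values `f`. -/
structure PointTree (qs : List Quadrant) (f : Point → ℝ) (S : Finset Point) (t : AVL) : Prop where
  sorted : t.Sorted
  balanced : t.Balanced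
  mem_iff : ∀ x, x ∈ t.toList ↔ ∃ p ∈ S, x = (pkey qs p, f p)

namespace PointTree

theorem empty (qs : List Quadrant) (f : Point → ℝ) : PointTree qs f ∅ .leaf :=
  ⟨by simp [AVL.Sorted, AVL.toList], trivial, by simp [AVL.toList]⟩

theorem ins {qs : List Quadrant} {f : Point → ℝ} {S : Finset Point} {t : AVL}
    (h : PointTree qs f S t) (p : Point) :
    PointTree qs f (insert p S) (t.ins (pkey qs p) (f p)) := by
  obtain ⟨h1, h2⟩ := AVL.sorted_ins (pkey qs p) (f p) h.sorted
  refine ⟨h1, (AVL.balanced_ins _ _ h.balanced).1, fun x => ?_⟩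
  rw [h2, h.mem_iff]
  simp only [Finset.mem_insert, exists_eq_or_imp]
  constructor
  · rintro (rfl | ⟨h, -⟩)
    exacts [.inl rfl, .inr h]
  · rintro (rfl | ⟨p', hp', rfl⟩)
    · exact .inl rfl
    · by_cases he : p' = p
      · exact .inl (by rw [he])
      · exact .inr ⟨⟨p', hp', rfl⟩, fun h => he (pkey_injective qs h)⟩

theorem del {qs : List Quadrant} {f : Point → ℝ} {S : Finset Point} {t : AVL}
    (h : PointTree qs f S t) (p : Point) : PointTree qs f (S.erase p) (t.del (pkey qs p)) := by
  obtain ⟨h1, h2⟩ := AVL.sorted_del (pkey qs p) h.sorted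
  refine ⟨h1, (AVL.balanced_del _ h.balanced).1, fun x => ?_⟩
  rw [h2, h.mem_iff]
  simp only [Finset.mem_erase]
  constructor
  · rintro ⟨⟨p', hp', rfl⟩, hne⟩
    exact ⟨p', ⟨fun h => hne (by rw [h]), hp'⟩, rfl⟩
  · rintro ⟨p', ⟨hne, hp'⟩, rfl⟩
    exact ⟨⟨p', hp', rfl⟩, fun h => hne (pkey_injective qs h)⟩

theorem height_le {qs : List Quadrant} {f : Point → ℝ} {S : Finset Point} {t : AVL}
    (h : PointTree qs f S t) {n : ℕ} (hn : S.card ≤ n) : t.height ≤ hb n := by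
  refine AVL.height_le_hb (L := S.toList.map fun p => (pkey qs p, f p)) h.balanced h.sorted
    (fun x hx => ?_) (by simpa using hn)
  obtain ⟨p, hp, rfl⟩ := (h.mem_iff x).1 hx
  exact List.mem_map_of_mem (Finset.mem_toList.2 hp)

theorem isOptMin_query {qs : List Quadrant} {f : Point → ℝ} {S : Finset Point} {t : AVL}
    (h : PointTree qs f S t) (z : ℝ) :
    IsOptMin {g | ∃ p ∈ S, z < lo qs p ∧ f p = g} (t.query (mkKey z 1 0 0)) := by
  convert AVL.isOptMin_query (mkKey z 1 0 0) h.sorted using 1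
  ext g
  simp only [h.mem_iff, Set.mem_ofPred_eq]
  constructor
  · rintro ⟨p, hp, hz, rfl⟩
    exact ⟨_, mkKey_lt_mkKey.2 (.inl hz), p, hp, rfl⟩
  · rintro ⟨k, hk, p, hp, he⟩
    obtain ⟨rfl, rfl⟩ := Prod.mk.inj he
    refine ⟨p, hp, ?_, rfl⟩
    rw [pkey, mkKey_lt_mkKey] at hk
    norm_num at hk
    exact hk

end PointTree

/-- The minimum value of a tree. -/
noncomputable def AVL.minimum : AVL → Option ℝ
  | .leaf => none
  | .node _ v l r => some (r.minWith (l.minWith v))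

theorem PointTree.isOptMin_minimum {qs : List Quadrant} {f : Point → ℝ} {S : Finset Point}
    {t : AVL} (h : PointTree qs f S t) : IsOptMin {g | ∃ p ∈ S, f p = g} t.minimum := by
  have h1 : {g | ∃ p ∈ S, f p = g} = {g | ∃ k, (k, g) ∈ t.toList} := by
    ext g
    simp only [h.mem_iff, Set.mem_ofPred_eq]
    constructor
    · rintro ⟨p, hp, rfl⟩
      exact ⟨_, p, hp, rfl⟩
    · rintro ⟨k, p, hp, he⟩
      exact ⟨p, hp, (Prod.mk.inj he).2.symm⟩
  rw [h1]
  rcases t with _ | ⟨k, v, l, r⟩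
  · simp [IsOptMin, AVL.minimum, AVL.toList]
  · have h2 := AVL.isLeast_minWith l v
    have h3 := AVL.isLeast_minWith r (l.minWith v)
    simp only [AVL.minimum, IsOptMin, AVL.toList, List.mem_append, List.mem_cons, Prod.mk.injEq]
    constructor
    · rcases h3.1 with h | ⟨k', h⟩
      · rw [h]
        rcases h2.1 with h | ⟨k', h⟩
        · exact ⟨k, .inr (.inl ⟨rfl, h⟩)⟩
        · exact ⟨k', .inl h⟩
      · exact ⟨k', .inr (.inr h)⟩
    · rintro x ⟨k', hx | ⟨-, rfl⟩ | hx⟩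
      · exact (h3.2 (.inl rfl)).trans (h2.2 (.inr ⟨k', hx⟩))
      · exact (h3.2 (.inl rfl)).trans (h2.2 (.inl rfl))
      · exact h3.2 (.inr ⟨k', hx⟩)

/-! ### The greedy algorithm -/

theorem length_mkTables (qs : List Quadrant) : (mkTables qs).length = 4 := rfl

theorem height_mkTables_le (qs : List Quadrant) {n : ℕ} (hn : qs.length ≤ n) :
    ∀ t ∈ mkTables qs, t.A.height ≤ hb n ∧ t.B.height ≤ hb n := by
  simp only [mkTables, List.mem_cons, List.not_mem_nil, or_false]
  rintro t (rfl | rfl | rfl | rfl) <;>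
    exact ⟨height_fillA_le _ _ hn, height_fillB_le _ _ hn⟩

-- The value `o` is the next breakpoint. The bound on `j` counts only vertices beyond `z`, which
-- lets the induction gain one per breakpoint. The time bound is conditional on the size of the
-- final cover; callers first bound `j` by the size of some cover, and then discharge the condition.
open Classical in
theorem computes_greedy {qs : List Quadrant} {S : Finset Point} {t : AVL} {H : ℕ}
    (hS : PointTree qs (hi qs) S t) (hcov : ∀ p ∈ S, covered qs p = true)
    (hts : ∀ t ∈ mkTables qs, t.A.height ≤ H ∧ t.B.height ≤ H) (ht : t.height ≤ H)
    (z : ℝ) (o : Option ℝ) (ho : IsOptMin {g | ∃ p ∈ S, z < lo qs p ∧ hi qs p = g} o)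
    (k : ℕ) (c : Cover) (hc : c.Valid) :
    ∃ (j : ℕ) (c' : Cover), c'.Valid ∧
      (hb c'.L.length + 4 ≤ H → Computes code 13 (.pair (encOption o) (.pair t.enc
        (.pair (encList Table.enc (mkTables qs)) (.pair (.real k) c.enc))))
        (.pair (.real (k + j : ℕ)) c'.enc) (20000 * (j + 1) * (H + 1))) ∧
      (∀ R, IsSetCover S qs.toFinset R → j ≤ Multiset.card (R.filter fun q => z < q.x)) ∧
      c.L.length ≤ c'.L.length ∧ c'.L.length ≤ c.L.length + 4 * j ∧
      (∀ q ∈ c.L, q ∈ c'.L) ∧ (∀ q ∈ c'.L, q ∈ c.L ∨ q ∈ qs) ∧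
      ∀ p ∈ S, z < lo qs p → ∃ q ∈ c'.L, p ∈ q.toSet := by
  induction hm : (S.filter fun p => z < lo qs p).card using Nat.strong_induction_on
    generalizing z o k c with
  | _ m ih =>
  have hvalid := valid_mkTables qs
  rcases o with _ | g
  · refine ⟨0, c, hc, fun _ => ?_, fun _ _ => Nat.zero_le _, le_rfl, le_rfl, fun _ h => h,
      fun _ h => .inl h, fun p hp hz => ?_⟩
    · refine .of_wp (body := greedyBody) rfl ?_
      simp [greedyBody, encOption]
      omega
    · exact absurd (show hi qs p ∈ (∅ : Set ℝ) from ho ▸ ⟨p, hp, hz, rfl⟩) (Set.notMem_empty _)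
  · obtain ⟨p₀, hp₀, hz₀, hg₀⟩ := ho.1
    have hlg : lo qs p₀ ≤ g := (lo_le qs p₀).trans (hg₀ ▸ le_hi qs p₀)
    have hzg : z < g := hz₀.trans_le hlg
    have hlt : (S.filter fun p => g < lo qs p).card < m := by
      rw [← hm]
      refine Finset.card_lt_card ⟨fun p hp => ?_, fun h => ?_⟩
      · rw [Finset.mem_filter] at hp ⊢
        exact ⟨hp.1, hzg.trans hp.2⟩
      · have := h (Finset.mem_filter.2 ⟨hp₀, hz₀⟩)
        exact hlg.not_gt (Finset.mem_filter.1 this).2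
    obtain ⟨j, c', hc', hrun, hlow, hlen1, hlen2, hsub, hmem, hcover⟩ :=
      ih _ hlt g _ (hS.isOptMin_query g) (k + 1) _ (hc.addAll (coverQs (mkTables qs) g)) rfl
    have hcl := length_coverQs_le (mkTables qs) g
    rw [length_mkTables] at hcl
    rw [Cover.addAll_L, List.length_append] at hlen1 hlen2
    refine ⟨j + 1, c', hc', fun hH => ?_, fun R hR => ?_, by omega, by omega, fun q hq => ?_,
      fun q hq => ?_, fun p hp hz => ?_⟩
    -- The cover only grows, so the final size bounds the present tree; the slack of 4 in the
    -- hypothesis is for the quadrants of this breakpoint.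
    · have hcH : c.T.height + (mkTables qs).length ≤ H := by
        have := (hc.height_le le_rfl).trans (hb_mono (show c.L.length ≤ c'.L.length by omega))
        rw [length_mkTables]
        omega
      refine .of_wp (body := greedyBody) rfl ?_
      simp only [greedyBody, wp]
      refine ⟨_, rfl, ?_⟩
      simp only [encOption, Val.onPair, Val.casesPair]
      refine ⟨_, rfl, ?_⟩
      simp only [Val.onPair]
      refine ⟨_, rfl, ?_⟩
      simp only [Val.onPair]
      refine (ev_query (k := mkKey g 1 0 0) (t := t) (s := 20) (s' := 10)
        (.of_wp (by simp [eKey, encKey_mkKey])) (.of_wp (by simp))).wp fun m1 hm1 => ?_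
      simp
      refine (computes_cover _ g c hts hc.balanced hcH).calls fun m2 hm2 => ?_
      have := hrun hH
      rw [Nat.cast_add, Nat.cast_one] at this
      refine this.calls fun m3 hm3 => ⟨?_, ?_⟩
      · rw [show ((k + 1 + j : ℕ) : ℝ) = k + (j + 1) by push_cast; ring]
      · rw [length_mkTables] at hm2
        have h1 : 20000 * (j + 1 + 1) * (H + 1) =
          20000 * (j + 1) * (H + 1) + 20000 * (H + 1) := by ring
        omega
    -- The span of `p₀` starts beyond `z` and ends at `g`, so a quadrant of `R` containing `p₀` has
    -- its vertex in between. It is counted for `z` but not for `g`.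
    · refine Nat.lt_of_le_of_lt (hlow R hR) (Multiset.card_lt_card (lt_of_le_of_ne ?_ ?_))
      · exact Multiset.monotone_filter_right _ fun q hq => hzg.trans hq
      · intro heq
        obtain ⟨q, hq, hpq⟩ := hR.2 p₀ hp₀
        have hx := hvalid.x_mem_Icc (List.mem_toFinset.1 (hR.1 q hq)) hpq
        have : q ∈ R.filter fun q => z < q.x := Multiset.mem_filter.2 ⟨hq, hz₀.trans_le hx.1⟩
        rw [← heq, Multiset.mem_filter] at this
        have h2 : q.x ≤ g := hg₀ ▸ hx.2
        linarith [this.2]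
    · exact hsub q (by rw [Cover.addAll_L]; exact List.mem_append_right _ hq)
    · rcases hmem q hq with h | h
      · rw [Cover.addAll_L, List.mem_append] at h
        rcases h with h | h
        exacts [.inr ((coverQs_mem hvalid.1 g).1 q h), .inl h]
      · exact .inr h
    · by_cases hgp : g < lo qs p
      · exact hcover p hp hgp
      -- A span that starts after `z` but not after `g` contains `g`, because `g` is the least right
      -- end.
      · obtain ⟨q, hq, hpq⟩ := hvalid.exists_mem_coverQs (hcov p hp) (z := g)
          ⟨not_lt.1 hgp, ho.2 ⟨p, hp, hz, rfl⟩⟩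
        exact ⟨q, hsub q (by rw [Cover.addAll_L]; exact List.mem_append_left _ hq), hpq⟩

/-! ### States and rebuilding -/

/-- A state of the data structure: the trees of the points that some quadrant contains, and of the
other points, the number of updates since the last rebuilding, the number of breakpoints at the last
rebuilding, and the cover. -/
structure State : Type where
  S : AVL
  U : AVL
  cnt : ℕ
  k : ℕ
  c : Cover

noncomputable def State.enc (qs : List Quadrant) (st : State) : Val :=
  .pair (encList Table.enc (mkTables qs)) (.pair st.S.enc (.pair st.U.enc
    (.pair (.real st.cnt) (.pair (.real st.k) st.c.enc))))

theorem computes_rebuild {qs : List Quadrant} {S : Finset Point} {t : AVL} {H : ℕ}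
    (hS : PointTree qs (hi qs) S t) (hcov : ∀ p ∈ S, covered qs p = true)
    (hts : ∀ t ∈ mkTables qs, t.A.height ≤ H ∧ t.B.height ≤ H) (ht : t.height ≤ H) (U : AVL) :
    ∃ (j : ℕ) (c : Cover), c.Valid ∧
      (hb c.L.length + 4 ≤ H → Computes code 14 (.pair (encList Table.enc (mkTables qs))
        (.pair t.enc U.enc)) (State.enc qs ⟨t, U, 0, j, c⟩) (20000 * (j + 2) * (H + 1))) ∧
      (∀ R, IsSetCover S qs.toFinset R → j ≤ Multiset.card R) ∧
      c.L.length ≤ 4 * j ∧ (∀ q ∈ c.L, q ∈ qs) ∧ ∀ p ∈ S, ∃ q ∈ c.L, p ∈ q.toSet := by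
  classical
  -- The program never computes this `z`: with `z` left of all spans, the first breakpoint is the
  -- minimum stored at the root.
  obtain ⟨z, hz⟩ : ∃ z, ∀ p ∈ S, z < lo qs p := by
    obtain ⟨z, hz⟩ := (S.image (lo qs)).bddBelow
    exact ⟨z - 1, fun p hp => (sub_one_lt z).trans_le (hz (Finset.mem_image_of_mem _ hp))⟩
  have ho : IsOptMin {g | ∃ p ∈ S, z < lo qs p ∧ hi qs p = g} t.minimum := by
    have he : {g | ∃ p ∈ S, z < lo qs p ∧ hi qs p = g} = {g | ∃ p ∈ S, hi qs p = g} := by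
      ext g
      exact ⟨fun ⟨p, hp, _, h⟩ => ⟨p, hp, h⟩, fun ⟨p, hp, h⟩ => ⟨p, hp, hz p hp, h⟩⟩
    rw [he]
    exact hS.isOptMin_minimum
  obtain ⟨j, c, hc, hrun, hlow, -, hlen, -, hmem, hcover⟩ :=
    computes_greedy hS hcov hts ht z _ ho 0 _ Cover.valid_empty
  refine ⟨j, c, hc, fun hH => ?_, fun R hR => (hlow R hR).trans
    (Multiset.card_le_card (Multiset.filter_le _ _)), by simpa using hlen, fun q hq => by
      simpa using hmem q hq, fun p hp => hcover p hp (hz p hp)⟩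
  refine .of_wp (body := rebuildBody) rfl ?_
  simp only [rebuildBody, wp]
  refine ⟨_, rfl, ?_⟩
  simp only [Val.onPair]
  refine ⟨_, rfl, ?_⟩
  simp only [Val.onPair]
  refine ⟨_, rfl, _, rfl, ?_⟩
  simp only [Val.onPair]
  refine ⟨_, rfl, ?_⟩
  have hrun := hrun hH
  have h1 : 20000 * (j + 2) * (H + 1) = 20000 * (j + 1) * (H + 1) + 20000 * (H + 1) := by ring
  rw [h1]
  simp only [Cover.enc, List.length_nil, Nat.cast_zero, zero_add, encList] at hrun
  rcases t with _ | ⟨kt, vt, l, r⟩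
  · simp [AVL.enc, eEmptyCover]
    refine hrun.calls fun m hm => ⟨?_, by omega⟩
    simp [State.enc, AVL.enc, Cover.enc]
  · simp [AVL.enc, eEmptyCover]
    refine hrun.calls fun m hm => ⟨?_, by omega⟩
    simp [State.enc, AVL.enc, Cover.enc]

end QuadrantSetCover

namespace QuadrantSetCover

/-! ### Logarithmic bounds -/

def lg (n : ℕ) : ℕ := Nat.log 2 (n + 2)

theorem one_le_lg (n : ℕ) : 1 ≤ lg n := Nat.le_log_of_pow_le (by norm_num) (by omega)

theorem lg_mono {m n : ℕ} (h : m ≤ n) : lg m ≤ lg n := Nat.log_mono_right (by omega)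

/-- Doubling the argument adds one to the logarithm, and `lg` is at least one. -/
theorem lg_le_two_mul {m n : ℕ} (h : m ≤ 2 * n + 2) : lg m ≤ 2 * lg n := by
  have h1 : lg m ≤ Nat.log 2 ((n + 2) * 2) := Nat.log_mono_right (by omega)
  rw [Nat.log_mul_base (by norm_num) (by omega)] at h1
  have := one_le_lg n
  unfold lg at *
  omega

/-- A bound for the heights of all search trees of an instance of size `n`. -/
def Hb (n : ℕ) : ℕ := hb (6 * n + 4) + 4

theorem Hb_le (n : ℕ) : Hb n + 1 ≤ 14 * lg n := by
  have h1 : Nat.log 2 (6 * n + 4 + 1) ≤ Nat.log 2 ((n + 2) * 2 * 2 * 2) :=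
    Nat.log_mono_right (by omega)
  rw [Nat.log_mul_base (by norm_num) (by omega), Nat.log_mul_base (by norm_num) (by omega),
    Nat.log_mul_base (by norm_num) (by omega)] at h1
  have := one_le_lg n
  unfold Hb hb lg at *
  omega

theorem hb_add_four_le_Hb {m n : ℕ} (h : m ≤ 6 * n + 4) : hb m + 4 ≤ Hb n := by
  have := hb_mono h
  unfold Hb
  omega

theorem hb_le_Hb {m n : ℕ} (h : m ≤ 6 * n + 4) : hb m ≤ Hb n := by
  have := hb_add_four_le_Hb h
  omega

/-! ### Updates -/

theorem covered_iff {qs : List Quadrant} {p : Point} :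
    covered qs p = true ↔ ∃ q ∈ qs, p ∈ q.toSet := (valid_mkTables qs).info_fst

/-- The points of `P` that some quadrant contains. -/
noncomputable def coveredPoints (qs : List Quadrant) (P : Finset Point) : Finset Point :=
  P.filter fun p => covered qs p = true

/-- The state `st` represents the point set `P`; the number `w` is the size of the instance at the
last rebuilding, without the points that no quadrant contains. -/
structure Inv (qs : List Quadrant) (P : Finset Point) (w : ℕ) (st : State) : Prop where
  tS : PointTree qs (hi qs) (coveredPoints qs P) st.S
  tU : PointTree qs (fun _ => 0) (P.filter fun p => covered qs p = false) st.U
  valid : st.c.Valid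
  mem : ∀ q ∈ st.c.L, q ∈ qs
  cover : ∀ p ∈ coveredPoints qs P, ∃ q ∈ st.c.L, p ∈ q.toSet
  lower : ∀ R, IsSetCover (coveredPoints qs P) qs.toFinset R → st.k ≤ Multiset.card R + st.cnt
  len : st.c.L.length ≤ 4 * (st.k + st.cnt)
  k_le : st.k ≤ qs.length
  le_add : w ≤ (coveredPoints qs P).card + qs.length + st.cnt
  add_le : (coveredPoints qs P).card + qs.length ≤ w + st.cnt
  le_w : qs.length ≤ w

theorem isSetCover_all (qs : List Quadrant) (P : Finset Point) :
    IsSetCover (coveredPoints qs P) qs.toFinset (qs : Multiset Quadrant) :=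
  ⟨fun _ hq => List.mem_toFinset.2 hq, fun _ hp =>
    covered_iff.1 (Finset.mem_filter.1 hp).2⟩

/-- The potential is `6720000 * cnt * lg w`, with `w` frozen at the last rebuilding so that it grows
only with `cnt`. The number `cnt` is at most about half of `k`, and `k ≤ qs.length ≤ w`. So `w` and
the current size `s` differ by at most a constant factor and their logarithms are comparable.
Uncovered points are left out of `w` because their updates do not raise `cnt`. -/
theorem computes_finish {qs : List Quadrant} {P : Finset Point} {w n : ℕ} {st : State}
    (h : Inv qs P w st) (hn : st.cnt = n + 1) (hk : 2 * n ≤ st.k) :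
    ∃ st' w' T, Computes code 15 (st.enc qs) (st'.enc qs) T ∧ Inv qs P w' st' ∧
      2 * st'.cnt ≤ st'.k ∧ T + 6720000 * st'.cnt * lg w' ≤
        6720000 * n * lg w + 20000000 * lg ((coveredPoints qs P).card + qs.length) := by
  set s := (coveredPoints qs P).card + qs.length with hs
  have hk' := h.k_le
  have h1 := h.le_add
  have h2 := h.add_le
  have h3 := h.le_w
  have hl := one_le_lg s
  by_cases hle : 2 * st.cnt ≤ st.k
  · refine ⟨st, w, 40, ?_, h, hle, ?_⟩
    · refine .of_wp (body := finishBody) rfl ?_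
      simp [finishBody, State.enc]
      exact fun h => absurd h (by norm_cast; omega)
    · have h4 : lg w ≤ 2 * lg s := lg_le_two_mul (by omega)
      rw [hn]
      have h5 : 6720000 * (n + 1) * lg w = 6720000 * n * lg w + 6720000 * lg w := by ring
      omega
  · have hcov : ∀ p ∈ coveredPoints qs P, covered qs p = true := fun p hp =>
      (Finset.mem_filter.1 hp).2
    obtain ⟨j, c, hc, hrun, hlow, hlen, hmem, hcover⟩ := computes_rebuild (H := Hb s) h.tS hcov
      (fun t ht => by
        have := height_mkTables_le qs le_rfl t ht
        have := hb_le_Hb (show qs.length ≤ 6 * s + 4 by omega)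
        omega)
      ((h.tS.height_le le_rfl).trans (hb_le_Hb (by omega))) st.U
    have hjq : j ≤ qs.length := by simpa using hlow _ (isSetCover_all qs P)
    -- The stored cover is itself a cover, so its size bounds the new number of breakpoints and
    -- thereby the cost of the rebuilding.
    have hjc : j ≤ st.c.L.length := by
      simpa using hlow (st.c.L : Multiset Quadrant)
        ⟨fun q hq => List.mem_toFinset.2 (h.mem q hq), fun p hp => h.cover p hp⟩
    have hlen' := h.len
    refine ⟨⟨st.S, st.U, 0, j, c⟩, s, 20000 * (j + 3) * (Hb s + 1), ?_, ⟨h.tS, h.tU, hc, hmem, hcover, hlow, by simpa using hlen,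
      hjq, by simp [hs], by simp [hs], by omega⟩, by simp, ?_⟩
    · refine .of_wp (body := finishBody) rfl ?_
      simp [finishBody, State.enc]
      refine ⟨fun h => absurd h (by norm_cast; omega), fun _ => ?_⟩
      refine (hrun (hb_add_four_le_Hb (by omega))).calls fun m hm => ⟨by simp [State.enc], ?_⟩
      have h5 : 20000 * (j + 3) * (Hb s + 1) =
        20000 * (j + 2) * (Hb s + 1) + 20000 * (Hb s + 1) := by ring
      omega
    · have h4 : lg s ≤ 2 * lg w := lg_le_two_mul (by omega)
      -- From `st.k ≤ 2 * n + 1` and `st.cnt = n + 1` the old cover has at most `12 * n + 8`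
      -- quadrants. The factor of the potential is `20000 * 12 * 14 * 2`, the last 2 from `h4`.
      have h5 : 20000 * (j + 3) * (Hb s + 1) ≤ 20000 * (12 * n + 11) * (14 * lg s) :=
        Nat.mul_le_mul (by omega) (Hb_le s)
      have h6 : 20000 * (12 * n + 11) * (14 * lg s) = 3360000 * (n * lg s) + 3080000 * lg s := by
        ring
      have h7 : n * lg s ≤ n * (2 * lg w) := Nat.mul_le_mul le_rfl h4
      have h8 : n * (2 * lg w) = 2 * (n * lg w) := by ring
      have h9 : 6720000 * n * lg w = 6720000 * (n * lg w) := by ring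
      dsimp only
      omega

theorem coveredPoints_insert {qs : List Quadrant} {P : Finset Point} {p : Point} :
    coveredPoints qs (insert p P) =
      if covered qs p = true then insert p (coveredPoints qs P) else coveredPoints qs P :=
  Finset.filter_insert ..

theorem coveredPoints_erase {qs : List Quadrant} {P : Finset Point} {p : Point} :
    coveredPoints qs (P.erase p) = (coveredPoints qs P).erase p :=
  Finset.filter_erase ..

theorem computes_info_mkTables (qs : List Quadrant) (p : Point) {n : ℕ} (hn : qs.length ≤ n) :
    Computes code 10 (.pair (encList Table.enc (mkTables qs)) (encPoint p))
      (.pair (encBool (covered qs p)) (.pair (.real (lo qs p)) (.real (hi qs p))))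
      (3500 * (Hb n + 1)) := by
  refine (computes_info (mkTables qs) p (H := Hb n) fun t ht => ?_).mono ?_
  · have := height_mkTables_le qs le_rfl t ht
    have := hb_le_Hb (show qs.length ≤ 6 * n + 4 by omega)
    omega
  · rw [length_mkTables]

-- A cover of the larger point set also covers the smaller one, so the lower bound survives; `p.1`
-- lies in the span of `p`, so four more quadrants suffice.
set_option maxRecDepth 4000 in
theorem computes_insert {qs : List Quadrant} {P : Finset Point} {w : ℕ} {st : State}
    (h : Inv qs P w st) (hk : 2 * st.cnt ≤ st.k) (p : Point) :
    ∃ st' w' T, Computes code 16 (.pair (st.enc qs) (encPoint p)) (st'.enc qs) T ∧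
      Inv qs (insert p P) w' st' ∧ 2 * st'.cnt ≤ st'.k ∧ T + 6720000 * st'.cnt * lg w' ≤
        6720000 * st.cnt * lg w + 21000000 * lg ((insert p P).card + qs.length) := by
  set n := (insert p P).card + qs.length with hn
  have hPc : (coveredPoints qs P).card ≤ P.card := Finset.card_filter_le _ _
  have hUc : (P.filter fun p => covered qs p = false).card ≤ P.card := Finset.card_filter_le _ _
  have hP : P.card ≤ (insert p P).card := Finset.card_le_card (Finset.subset_insert _ _)
  have hkl := h.k_le
  have hlen := h.len
  have hinfo := computes_info_mkTables qs p (n := n) (by omega)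
  have hSh : st.S.height ≤ Hb n := (h.tS.height_le le_rfl).trans (hb_le_Hb (by omega))
  have hUh : st.U.height ≤ Hb n := (h.tU.height_le le_rfl).trans (hb_le_Hb (by omega))
  -- The cover has at most `4 * (k + cnt) ≤ 6 * k ≤ 6 * qs.length` quadrants, the origin of the 6 in
  -- `Hb`; the spare 4 is for the quadrants about to be added.
  have hch : st.c.T.height + 4 ≤ Hb n := by
    have := h.valid.height_le le_rfl
    have := hb_add_four_le_Hb (show st.c.L.length ≤ 6 * n + 4 by omega)
    omega
  have hHb := Hb_le n
  have hkey : (Val.real (lo qs p)).pair ((Val.real 0).pair (encPoint p)) = encKey (pkey qs p) := rfl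
  rcases hcp : covered qs p
  · refine ⟨⟨st.S, st.U.ins (pkey qs p) 0, st.cnt, st.k, st.c⟩, w, 6000 * (Hb n + 1), ?_, ?_, hk, ?_⟩
    · refine .of_wp (body := insertBody) rfl ?_
      simp [insertBody, State.enc]
      refine hinfo.calls fun m hm => ?_
      simp [hcp, encBool]
      rw [hkey]
      exact (AVL.computes_ins _ _ _).calls fun m' hm' => ⟨rfl, by omega⟩
    · have hPs : coveredPoints qs (insert p P) = coveredPoints qs P := by
        rw [coveredPoints_insert, if_neg (by simp [hcp])]
      refine ⟨hPs ▸ h.tS, ?_, h.valid, h.mem, hPs ▸ h.cover, hPs ▸ h.lower, h.len, h.k_le,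
        hPs ▸ h.le_add, hPs ▸ h.add_le, h.le_w⟩
      rw [Finset.filter_insert, if_pos hcp]
      exact h.tU.ins p
    · dsimp only
      omega
  · have hPs : coveredPoints qs (insert p P) = insert p (coveredPoints qs P) := by
      rw [coveredPoints_insert, if_pos hcp]
    have hcard1 : (coveredPoints qs P).card ≤ (insert p (coveredPoints qs P)).card :=
      Finset.card_le_card (Finset.subset_insert _ _)
    have hcard2 := Finset.card_insert_le p (coveredPoints qs P)
    have hinv : Inv qs (insert p P) w ⟨st.S.ins (pkey qs p) (hi qs p), st.U, st.cnt + 1, st.k,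
        st.c.addAll (coverQs (mkTables qs) p.1)⟩ := by
      have h1 := h.le_add
      have h2 := h.add_le
      refine ⟨hPs ▸ h.tS.ins p, ?_, h.valid.addAll _, ?_, ?_, ?_, ?_, h.k_le, ?_, ?_, h.le_w⟩
      · rw [Finset.filter_insert, if_neg (by simp [hcp])]
        exact h.tU
      · intro q hq
        rw [Cover.addAll_L, List.mem_append] at hq
        rcases hq with hq | hq
        exacts [(coverQs_mem (valid_mkTables qs).1 p.1).1 q hq, h.mem q hq]
      · intro p' hp'
        simp only [Cover.addAll_L, List.mem_append]
        rw [hPs, Finset.mem_insert] at hp'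
        rcases hp' with rfl | hp'
        · obtain ⟨q, hq, hpq⟩ := (valid_mkTables qs).exists_mem_coverQs hcp
            ⟨lo_le qs p', le_hi qs p'⟩
          exact ⟨q, .inl hq, hpq⟩
        · obtain ⟨q, hq, hpq⟩ := h.cover p' hp'
          exact ⟨q, .inr hq, hpq⟩
      · intro R hR
        have := h.lower R ⟨hR.1, fun p' hp' => hR.2 p' (hPs ▸ Finset.mem_insert_of_mem hp')⟩
        dsimp only
        omega
      · have := length_coverQs_le (mkTables qs) p.1
        rw [length_mkTables] at this
        simp only [Cover.addAll_L, List.length_append]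
        omega
      · rw [hPs]; dsimp only; omega
      · rw [hPs]; dsimp only; omega
    obtain ⟨st', w', T, hT, hinv', hk', hpot⟩ := computes_finish hinv rfl hk
    have hs : lg ((coveredPoints qs (insert p P)).card + qs.length) ≤ lg n := lg_mono (by
      have : (coveredPoints qs (insert p P)).card ≤ (insert p P).card := Finset.card_filter_le _ _
      omega)
    refine ⟨st', w', 26000 * (Hb n + 1) + T, ?_, hinv', hk', by omega⟩
    refine .of_wp (body := insertBody) rfl ?_
    simp [insertBody, State.enc]
    refine hinfo.calls fun m hm => ?_
    simp [hcp, encBool]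
    rw [hkey]
    refine (AVL.computes_ins _ _ _).calls fun m1 hm1 => ?_
    simp [encPoint]
    refine (computes_cover (mkTables qs) p.1 st.c (H := Hb n) (fun t ht => ?_) h.valid.balanced
      (by rw [length_mkTables]; omega)).calls fun m2 hm2 => ?_
    · have := height_mkTables_le qs le_rfl t ht
      have := hb_le_Hb (show qs.length ≤ 6 * n + 4 by omega)
      omega
    · rw [length_mkTables] at hm2
      simp only [State.enc, Nat.cast_add, Nat.cast_one] at hT
      exact hT.calls fun m3 hm3 => ⟨rfl, by omega⟩

-- Any cover of the remaining points becomes a cover of the old ones by adding one quadrant that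
-- contains `p`, so the lower bound drops by at most one.
set_option maxRecDepth 4000 in
theorem computes_delete {qs : List Quadrant} {P : Finset Point} {w : ℕ} {st : State}
    (h : Inv qs P w st) (hk : 2 * st.cnt ≤ st.k) (p : Point) :
    ∃ st' w' T, Computes code 17 (.pair (st.enc qs) (encPoint p)) (st'.enc qs) T ∧
      Inv qs (P.erase p) w' st' ∧ 2 * st'.cnt ≤ st'.k ∧ T + 6720000 * st'.cnt * lg w' ≤
        6720000 * st.cnt * lg w + 21000000 * lg ((P.erase p).card + qs.length) := by
  set n := (P.erase p).card + qs.length with hn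
  have hPc : (coveredPoints qs P).card ≤ P.card := Finset.card_filter_le _ _
  have hUc : (P.filter fun p => covered qs p = false).card ≤ P.card := Finset.card_filter_le _ _
  have hP : P.card ≤ (P.erase p).card + 1 := by
    have := Finset.pred_card_le_card_erase (s := P) (a := p)
    omega
  have hinfo := computes_info_mkTables qs p (n := n) (by omega)
  have hSh : st.S.height ≤ Hb n := (h.tS.height_le le_rfl).trans (hb_le_Hb (by omega))
  have hUh : st.U.height ≤ Hb n := (h.tU.height_le le_rfl).trans (hb_le_Hb (by omega))
  have hHb := Hb_le n
  have hkey : (Val.real (lo qs p)).pair ((Val.real 0).pair (encPoint p)) = encKey (pkey qs p) := rfl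
  rcases hcp : covered qs p
  · refine ⟨⟨st.S, st.U.del (pkey qs p), st.cnt, st.k, st.c⟩, w, 8000 * (Hb n + 1), ?_, ?_, hk, ?_⟩
    · refine .of_wp (body := deleteBody) rfl ?_
      simp [deleteBody, State.enc]
      refine hinfo.calls fun m hm => ?_
      simp [hcp, encBool]
      rw [hkey]
      exact (AVL.computes_del _ _).calls fun m' hm' => ⟨rfl, by omega⟩
    · have hPs : coveredPoints qs (P.erase p) = coveredPoints qs P := by
        rw [coveredPoints_erase, Finset.erase_eq_of_notMem (by simp [coveredPoints, hcp])]
      refine ⟨hPs ▸ h.tS, ?_, h.valid, h.mem, hPs ▸ h.cover, hPs ▸ h.lower, h.len, h.k_le,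
        hPs ▸ h.le_add, hPs ▸ h.add_le, h.le_w⟩
      rw [Finset.filter_erase]
      exact h.tU.del p
    · dsimp only
      omega
  · have hPs : coveredPoints qs (P.erase p) = (coveredPoints qs P).erase p := coveredPoints_erase
    have hcard1 : (coveredPoints qs P).card ≤ ((coveredPoints qs P).erase p).card + 1 := by
      have := Finset.pred_card_le_card_erase (s := coveredPoints qs P) (a := p)
      omega
    have hcard2 := Finset.card_erase_le (s := coveredPoints qs P) (a := p)
    have hinv : Inv qs (P.erase p) w
        ⟨st.S.del (pkey qs p), st.U, st.cnt + 1, st.k, st.c⟩ := by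
      have h1 := h.le_add
      have h2 := h.add_le
      have h3 := h.len
      refine ⟨hPs ▸ h.tS.del p, ?_, h.valid, h.mem, fun p' hp' => h.cover p' ?_, ?_, ?_, h.k_le,
        ?_, ?_, h.le_w⟩
      · rw [Finset.filter_erase, Finset.erase_eq_of_notMem (by simp [hcp])]
        exact h.tU
      · rw [hPs] at hp'
        exact Finset.mem_of_mem_erase hp'
      · intro R hR
        obtain ⟨q, hq, hpq⟩ := covered_iff.1 hcp
        have := h.lower (q ::ₘ R) ⟨fun q' hq' => ?_, fun p' hp' => ?_⟩
        · rw [Multiset.card_cons] at this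
          dsimp only
          omega
        · rcases Multiset.mem_cons.1 hq' with rfl | hq'
          exacts [List.mem_toFinset.2 hq, hR.1 q' hq']
        · by_cases hpp : p' = p
          · exact ⟨q, Multiset.mem_cons_self _ _, hpp ▸ hpq⟩
          · obtain ⟨q', hq', hpq'⟩ := hR.2 p' (hPs ▸ Finset.mem_erase.2 ⟨hpp, hp'⟩)
            exact ⟨q', Multiset.mem_cons_of_mem hq', hpq'⟩
      · dsimp only; omega
      · rw [hPs]; dsimp only; omega
      · rw [hPs]; dsimp only; omega
    obtain ⟨st', w', T, hT, hinv', hk', hpot⟩ := computes_finish hinv rfl hk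
    have hs : lg ((coveredPoints qs (P.erase p)).card + qs.length) ≤ lg n := lg_mono (by
      have : (coveredPoints qs (P.erase p)).card ≤ (P.erase p).card := Finset.card_filter_le _ _
      omega)
    refine ⟨st', w', 8000 * (Hb n + 1) + T, ?_, hinv', hk', by omega⟩
    refine .of_wp (body := deleteBody) rfl ?_
    simp [deleteBody, State.enc]
    refine hinfo.calls fun m hm => ?_
    simp [hcp, encBool]
    rw [hkey]
    refine (AVL.computes_del _ _).calls fun m1 hm1 => ?_
    simp only [State.enc, Nat.cast_add, Nat.cast_one] at hT
    exact hT.calls fun m3 hm3 => ⟨rfl, by omega⟩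

end QuadrantSetCover

namespace QuadrantSetCover

/-! ### Construction -/

noncomputable def State.empty : State := ⟨.leaf, .leaf, 0, 0, ⟨[], .leaf⟩⟩

theorem inv_empty (qs : List Quadrant) : Inv qs ∅ qs.length State.empty :=
  ⟨PointTree.empty _ _, PointTree.empty _ _, Cover.valid_empty, by simp [State.empty],
    by simp [coveredPoints], fun _ _ => Nat.zero_le _, by simp [State.empty],
    Nat.zero_le _, by simp [coveredPoints], by simp [coveredPoints], le_rfl⟩

theorem computes_load (qs : List Quadrant) (ps : List Point) :
    ∃ st w T, Computes code 18 (.pair (encList encPoint ps) (State.empty.enc qs)) (st.enc qs) T ∧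
      Inv qs ps.toFinset w st ∧ 2 * st.cnt ≤ st.k ∧ T + 6720000 * st.cnt * lg w ≤
        (ps.length + 1) * (21000020 * lg (ps.length + qs.length)) := by
  induction ps with
  | nil =>
    refine ⟨State.empty, qs.length, 20, .of_wp (body := loadBody) rfl ?_, inv_empty qs, le_rfl, ?_⟩
    · simp [loadBody, encList]
    · have := one_le_lg (([] : List Point).length + qs.length)
      simp only [State.empty]
      rw [List.length_nil] at *
      omega
  | cons p ps ih =>
    obtain ⟨st, w, T, hT, hinv, hk, hpot⟩ := ih
    obtain ⟨st', w', T', hT', hinv', hk', hpot'⟩ := computes_insert hinv hk p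
    refine ⟨st', w', T + T' + 20, .of_wp (body := loadBody) rfl ?_, by
      rw [List.toFinset_cons]; exact hinv', hk', ?_⟩
    · simp [loadBody, encList]
      exact hT.calls fun m hm => hT'.calls fun m' hm' => ⟨rfl, by omega⟩
    · have h1 : lg ((insert p ps.toFinset).card + qs.length) ≤
          lg ((p :: ps).length + qs.length) := by
        have h := List.toFinset_card_le (p :: ps)
        rw [List.toFinset_cons] at h
        exact lg_mono (by omega)
      have h2 : lg (ps.length + qs.length) ≤ lg ((p :: ps).length + qs.length) :=
        lg_mono (by rw [List.length_cons]; omega)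
      have h3 := one_le_lg ((p :: ps).length + qs.length)
      have h4 : (ps.length + 1) * (21000020 * lg (ps.length + qs.length)) ≤
          (ps.length + 1) * (21000020 * lg ((p :: ps).length + qs.length)) :=
        Nat.mul_le_mul le_rfl (Nat.mul_le_mul le_rfl h2)
      have h5 : ((p :: ps).length + 1) * (21000020 * lg ((p :: ps).length + qs.length)) =
          (ps.length + 1) * (21000020 * lg ((p :: ps).length + qs.length)) +
          21000020 * lg ((p :: ps).length + qs.length) := by
        rw [List.length_cons]; ring
      omega

theorem construct_arith {a b j h l n T : ℕ} (h1 : h + 1 ≤ 14 * l) (hn : a + b ≤ n) (hj : j ≤ b)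
    (hl : 1 ≤ l) (hT : T ≤ (a + 1) * (21000020 * l)) :
    17200 * (b + 1) * (h + 1) + T + 20000 * (j + 2) * (h + 1) + 100 ≤
      25000000 * ((n + 1) * l) := by
  have e1 : (b + 1) * (h + 1) ≤ (n + 1) * (14 * l) := Nat.mul_le_mul (by omega) h1
  have e2 : (j + 2) * (h + 1) ≤ (2 * (n + 1)) * (14 * l) := Nat.mul_le_mul (by omega) h1
  have e3 : (a + 1) * l ≤ (n + 1) * l := Nat.mul_le_mul (by omega) le_rfl
  have e4 : 1 ≤ (n + 1) * l := Nat.mul_pos (by omega) hl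
  nlinarith

-- Loading inserts the points one by one; the rebuilding at the end resets `cnt`, so the updates
-- start with potential zero.
set_option maxRecDepth 4000 in
theorem computes_construct (ps : List Point) (qs : List Quadrant) :
    ∃ st w T, Computes code 19 (encInstance ps qs) (st.enc qs) T ∧
      Inv qs ps.toFinset w st ∧ st.cnt = 0 ∧
      T ≤ 25000000 * ((ps.length + qs.length + 1) * lg (ps.length + qs.length)) := by
  set n := ps.length + qs.length with hn
  obtain ⟨st, w, T, hT, hinv, hk, hpot⟩ := computes_load qs ps
  have hfill : ∀ e n' : Bool, Computes code 9
      (.pair (.pair (encBool e) (encBool n')) (encList encQuadrant qs))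
      (.pair (fillA e n' qs).enc (fillB e n' qs).enc) (4300 * (qs.length + 1) * (Hb n + 1)) := by
    intro e n'
    refine computes_fill e n' qs fun qs' h => ?_
    have := hb_le_Hb (show qs.length ≤ 6 * n + 4 by omega)
    exact ⟨(height_fillA_le _ _ h).trans this, (height_fillB_le _ _ h).trans this⟩
  have hcard := List.toFinset_card_le ps
  have hPc : (coveredPoints qs ps.toFinset).card ≤ ps.toFinset.card := Finset.card_filter_le _ _
  obtain ⟨j, c, hc, hrun, hlow, hlen, hmem, hcover⟩ := computes_rebuild (H := Hb n) hinv.tS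
    (fun p hp => (Finset.mem_filter.1 hp).2)
    (fun t ht => by
      have := height_mkTables_le qs le_rfl t ht
      have := hb_le_Hb (show qs.length ≤ 6 * n + 4 by omega)
      omega)
    ((hinv.tS.height_le le_rfl).trans (hb_le_Hb (by omega))) st.U
  have hjq : j ≤ qs.length := by simpa using hlow _ (isSetCover_all qs ps.toFinset)
  refine ⟨⟨st.S, st.U, 0, j, c⟩, (coveredPoints qs ps.toFinset).card + qs.length,
    17200 * (qs.length + 1) * (Hb n + 1) + T + 20000 * (j + 2) * (Hb n + 1) + 100, ?_,
    ⟨hinv.tS, hinv.tU, hc, hmem, hcover, hlow, by simpa using hlen, hjq, by simp, by simp,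
      by simp⟩, rfl, ?_⟩
  · refine .of_wp (body := constructBody) rfl ?_
    simp [constructBody, eTable, eTrue, encInstance, eEmptyCover]
    refine (hfill true true).calls fun m1 hm1 => ?_
    refine (hfill true false).calls fun m2 hm2 => ?_
    refine (hfill false true).calls fun m3 hm3 => ?_
    refine (hfill false false).calls fun m4 hm4 => ?_
    simp only [State.enc, State.empty, Cover.enc, List.length_nil, Nat.cast_zero] at hT
    refine hT.calls fun m5 hm5 => ?_
    simp
    refine (hrun (hb_add_four_le_Hb (by omega))).calls fun m6 hm6 => ⟨rfl, ?_⟩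
    have : 17200 * (qs.length + 1) * (Hb n + 1) = 4 * (4300 * (qs.length + 1) * (Hb n + 1)) := by
      ring
    omega
  · exact construct_arith (Hb_le n) (by omega) hjq (one_le_lg n)
      (show T ≤ (ps.length + 1) * (21000020 * lg n) from (Nat.le_add_right _ _).trans hpot)

/-! ### Queries -/

theorem natLog_le (m : ℕ) (hm : m ≠ 0) : (Nat.log 2 m : ℝ) ≤ 2 * Real.log m := by
  have h1 : ((2 ^ Nat.log 2 m : ℕ) : ℝ) ≤ m := by exact_mod_cast Nat.pow_log_le_self 2 hm
  have h2 := Real.log_le_log (by positivity) h1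
  rw [Nat.cast_pow, Real.log_pow, Nat.cast_ofNat] at h2
  -- Only `1 / 2 ≤ Real.log 2` is needed.
  have h3 := Real.log_two_gt_d9
  have h4 : (0 : ℝ) ≤ Nat.log 2 m := Nat.cast_nonneg _
  nlinarith

/-- The data structure. -/
def implementation : Implementation := ⟨code, 19, 16, 17, 20, 21, 22⟩

theorem Inv.U_eq_leaf_iff {qs : List Quadrant} {P : Finset Point} {w : ℕ} {st : State}
    (h : Inv qs P w st) : st.U = .leaf ↔ Feasible P qs.toFinset := by
  constructor
  · intro hU
    refine ⟨(qs : Multiset Quadrant), fun q hq => List.mem_toFinset.2 hq, fun p hp => ?_⟩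
    rcases hcp : covered qs p
    · have := (h.tU.mem_iff (pkey qs p, 0)).2 ⟨p, Finset.mem_filter.2 ⟨hp, hcp⟩, rfl⟩
      simp [hU, AVL.toList] at this
    · exact covered_iff.1 hcp
  · rintro ⟨R, hR⟩
    rcases hU : st.U with _ | ⟨k, v, l, r⟩
    · rfl
    · obtain ⟨p, hp, -⟩ := (h.tU.mem_iff (k, v)).1 (by simp [hU, AVL.toList])
      rw [Finset.mem_filter] at hp
      obtain ⟨q, hq, hpq⟩ := hR.2 p hp.1
      have := covered_iff.2 ⟨q, List.mem_toFinset.1 (hR.1 q hq), hpq⟩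
      simp [hp.2] at this

theorem Inv.stores {qs : List Quadrant} {P : Finset Point} {w : ℕ} {st : State}
    (h : Inv qs P w st) (hU : st.U = .leaf) :
    implementation.Stores 10000 qs.toFinset (st.enc qs) (st.c.L : Multiset Quadrant) := by
  refine ⟨?_, fun q _ => ?_, ?_⟩
  · have : Computes code 20 (st.enc qs) (.real (Multiset.card (st.c.L : Multiset Quadrant))) 100 := by
      refine .of_wp (body := sizeBody) rfl ?_
      simp [sizeBody, eAnswer, eCover, State.enc, hU, AVL.enc, Cover.enc]
    obtain ⟨t, ht, hle⟩ := this.runs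
    exact ⟨t, ht, by norm_cast; omega⟩
  · have : Computes code 21 (.pair (st.enc qs) (encQuadrant q))
        (.real (Multiset.count q (st.c.L : Multiset Quadrant)))
        (400 * (st.c.T.height + 1) + 200) := by
      refine .of_wp (body := memberBody) rfl ?_
      simp [memberBody, eAnswer, eCover, State.enc, hU, AVL.enc]
      refine (ev_qKey (q := q) (s := 10) (.of_wp (by simp))).wp fun m hm => ?_
      simp [Cover.enc]
      refine (AVL.computes_get q.key st.c.T).calls fun m hm => ?_
      have hg := h.valid.get_key q
      rcases hgq : st.c.T.get q.key with _ | v <;> rw [hgq] at hg <;> simp at hg <;>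
        simp [AVL.encGet, ← hg] <;> omega
    obtain ⟨t, ht, hle⟩ := this.runs
    refine ⟨t, ht, ?_⟩
    have h1 := AVL.height_le h.valid.balanced
    -- The tree of multiplicities has at most as many entries as the cover has elements, so a lookup
    -- is logarithmic in the cover and not in the instance.
    have h2 : st.c.T.height ≤ hb st.c.L.length := h.valid.height_le le_rfl
    have h3 : t ≤ 800 * Nat.log 2 (st.c.L.length + 1) + 1002 := by
      unfold hb at h2
      omega
    have h4 := natLog_le (st.c.L.length + 1) (by omega)
    have h5 : (t : ℝ) ≤ 800 * Nat.log 2 (st.c.L.length + 1) + 1002 := by exact_mod_cast h3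
    rw [Multiset.coe_card, add_comm 1 (st.c.L.length : ℝ)]
    push_cast at h4
    have h6 : 0 ≤ Real.log (st.c.L.length + 1) := Real.log_nonneg (by simp)
    linarith
  · have : Computes code 22 (st.enc qs) (encList encQuadrant st.c.L) 100 := by
      refine .of_wp (body := reportBody) rfl ?_
      simp [reportBody, eAnswer, eCover, State.enc, hU, AVL.enc, Cover.enc]
    obtain ⟨t, ht, hle⟩ := this.runs
    refine ⟨st.c.L, t, rfl, ht, ?_⟩
    have h1 : (t : ℝ) ≤ 102 := by exact_mod_cast hle
    have h2 : (0 : ℝ) ≤ Multiset.card (st.c.L : Multiset Quadrant) := Nat.cast_nonneg _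
    linarith

theorem State.reportsNoSolution {qs : List Quadrant} {st : State} (hU : st.U ≠ .leaf) :
    implementation.ReportsNoSolution 10000 qs.toFinset (st.enc qs) := by
  rcases st with ⟨S, _ | ⟨k, v, l, r⟩, cnt, m, c⟩
  · exact absurd rfl hU
  refine ⟨?_, fun q _ => ?_, ?_⟩
  · have : Computes code 20 (State.enc qs ⟨S, .node k v l r, cnt, m, c⟩) noSolution 100 := by
      refine .of_wp (body := sizeBody) rfl ?_
      simp [sizeBody, eAnswer, State.enc, AVL.enc, eTrue, noSolution]
    obtain ⟨t, ht, hle⟩ := this.runs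
    exact ⟨t, ht, by norm_cast; omega⟩
  · have : Computes code 21
        (.pair (State.enc qs ⟨S, .node k v l r, cnt, m, c⟩) (encQuadrant q)) noSolution 100 := by
      refine .of_wp (body := memberBody) rfl ?_
      simp [memberBody, eAnswer, State.enc, AVL.enc, eTrue, noSolution]
    obtain ⟨t, ht, hle⟩ := this.runs
    exact ⟨t, ht, by norm_cast; omega⟩
  · have : Computes code 22 (State.enc qs ⟨S, .node k v l r, cnt, m, c⟩) noSolution 100 := by
      refine .of_wp (body := reportBody) rfl ?_
      simp [reportBody, eAnswer, State.enc, AVL.enc, eTrue, noSolution]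
    obtain ⟨t, ht, hle⟩ := this.runs
    exact ⟨t, ht, by norm_cast; omega⟩

/-! ### From the invariant to the guarantees -/

theorem Implementation.Stores.mono {D : Implementation} {C C' : ℝ} (hC : C ≤ C')
    {Q : Finset Quadrant} {st : Val} {R : Multiset Quadrant} (h : D.Stores C Q st R) :
    D.Stores C' Q st R := by
  obtain ⟨⟨t, h1, h2⟩, h3, ⟨l, t', h4, h5, h6⟩⟩ := h
  refine ⟨⟨t, h1, h2.trans hC⟩, fun q hq => ?_, ⟨l, t', h4, h5, h6.trans ?_⟩⟩
  · obtain ⟨t, h7, h8⟩ := h3 q hq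
    refine ⟨t, h7, h8.trans (mul_le_mul_of_nonneg_right hC ?_)⟩
    have : 0 ≤ Real.log (1 + Multiset.card R) := Real.log_nonneg (by simp)
    linarith
  · exact mul_le_mul_of_nonneg_right hC (by positivity)

theorem Implementation.ReportsNoSolution.mono {D : Implementation} {C C' : ℝ} (hC : C ≤ C')
    {Q : Finset Quadrant} {st : Val} (h : D.ReportsNoSolution C Q st) :
    D.ReportsNoSolution C' Q st := by
  obtain ⟨⟨t, h1, h2⟩, h3, ⟨t', h4, h5⟩⟩ := h
  refine ⟨⟨t, h1, h2.trans hC⟩, fun q hq => ?_, ⟨t', h4, h5.trans hC⟩⟩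
  obtain ⟨t, h7, h8⟩ := h3 q hq
  exact ⟨t, h7, h8.trans hC⟩

theorem Inv.maintains {qs : List Quadrant} {P : Finset Point} {w : ℕ} {st : State}
    (h : Inv qs P w st) (hk : 2 * st.cnt ≤ st.k) {C : ℝ} (hC : 10000 ≤ C) :
    implementation.Maintains 12 C P qs.toFinset (st.enc qs) := by
  constructor
  · intro hF
    have hU := h.U_eq_leaf_iff.2 hF
    have hP : coveredPoints qs P = P := by
      obtain ⟨R, hR⟩ := hF
      refine Finset.filter_true_of_mem fun p hp => ?_
      obtain ⟨q, hq, hpq⟩ := hR.2 p hp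
      exact covered_iff.2 ⟨q, List.mem_toFinset.1 (hR.1 q hq), hpq⟩
    refine ⟨(st.c.L : Multiset Quadrant), ⟨fun q hq => List.mem_toFinset.2 (h.mem q hq),
      fun p hp => h.cover p (hP.symm ▸ hp)⟩, ?_, (h.stores hU).mono hC⟩
    obtain ⟨R, hR, hcard⟩ : opt P qs.toFinset ∈ {k : ℕ | ∃ R : Multiset Quadrant,
        IsSetCover P qs.toFinset R ∧ Multiset.card R = k} := by
      obtain ⟨R, hR⟩ := hF
      exact Nat.sInf_mem ⟨_, R, hR, rfl⟩
    have h1 := h.lower R (hP.symm ▸ hR)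
    have h2 := h.len
    rw [hcard] at h1
    -- From `k ≤ opt + cnt` and `2 * cnt ≤ k` follows `k ≤ 2 * opt`, and the cover has at most `4 *
    -- (k + cnt) ≤ 6 * k` elements.
    have h3 : st.c.L.length ≤ 12 * opt P qs.toFinset := by omega
    rw [Multiset.coe_card]
    exact_mod_cast h3
  · intro hF
    exact (State.reportsNoSolution fun hU => hF (h.U_eq_leaf_iff.1 hU)).mono hC

theorem runsUpdate {qs : List Quadrant} {P : Finset Point} {w : ℕ} {st : State}
    (h : Inv qs P w st) (hk : 2 * st.cnt ≤ st.k) (u : Update) :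
    ∃ st' w' t, implementation.RunsUpdate (st.enc qs) u (st'.enc qs) t ∧
      Inv qs (u.apply P) w' st' ∧ 2 * st'.cnt ≤ st'.k ∧ t + 6720000 * st'.cnt * lg w' ≤
        6720000 * st.cnt * lg w + 22000000 * lg ((u.apply P).card + qs.length) := by
  have hl := one_le_lg ((u.apply P).card + qs.length)
  cases u with
  | insert p =>
    obtain ⟨st', w', T, hT, hinv, hk', hpot⟩ := computes_insert h hk p
    obtain ⟨t, ht, hle⟩ := hT.runs
    simp only [Update.apply] at hl ⊢
    exact ⟨st', w', t, ht, hinv, hk', by omega⟩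
  | delete p =>
    obtain ⟨st', w', T, hT, hinv, hk', hpot⟩ := computes_delete h hk p
    obtain ⟨t, ht, hle⟩ := hT.runs
    simp only [Update.apply] at hl ⊢
    exact ⟨st', w', t, ht, hinv, hk', by omega⟩

theorem lg_le_log (n : ℕ) : (lg n : ℝ) ≤ 2 * Real.log ((n : ℕ) + 2) := by
  have := natLog_le (n + 2) (by omega)
  push_cast at this
  exact this

end QuadrantSetCover

open QuadrantSetCover in
theorem mainTheorem8 :
    ∃ (D : QuadrantSetCover.Implementation) (c C : ℝ) (k : ℕ),
      ∀ (ps : List QuadrantSetCover.Point) (qs : List QuadrantSetCover.Quadrant),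
        ps.Nodup → qs.Nodup →
        ∀ ops : ℕ → QuadrantSetCover.Update,
          ∃ (st : ℕ → QuadrantSetCover.Val) (t₀ : ℕ) (t : ℕ → ℕ),
            -- construction time
            QuadrantSetCover.Runs D.code D.construct
              (QuadrantSetCover.encInstance ps qs) (st 0) t₀ ∧
            (t₀ : ℝ) ≤ C * ((ps.length + qs.length : ℕ) + 1) *
              Real.log ((ps.length + qs.length : ℕ) + 2) ^ k ∧
            -- amortized update time
            (∀ i : ℕ, D.RunsUpdate (st i) (ops i) (st (i + 1)) (t i)) ∧
            (∀ m : ℕ, ∑ i ∈ Finset.range m, (t i : ℝ) ≤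
              ∑ i ∈ Finset.range m, C * Real.log
                (((QuadrantSetCover.pointsAt ps.toFinset ops (i + 1)).card + qs.length : ℕ) + 2) ^ k) ∧
            -- approximation and queries, at all times
            (∀ i : ℕ, D.Maintains c C (QuadrantSetCover.pointsAt ps.toFinset ops i)
              qs.toFinset (st i)) := by
  -- The constant exceeds `2 * 22000000` for the updates and `2 * 25000002` for the construction;
  -- the factor 2 passes from `lg` to the natural logarithm.
  refine ⟨implementation, 12, 60000000, 1, fun ps qs _ _ ops => ?_⟩
  -- With the invariant packed into the type, `choose` turns the existence of each step into a
  -- function that can be iterated.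
  let Good (i : ℕ) : Type := {x : State × ℕ //
    Inv qs (pointsAt ps.toFinset ops i) x.2 x.1 ∧ 2 * x.1.cnt ≤ x.1.k}
  obtain ⟨st₀, w₀, T₀, hT₀, hinv₀, hcnt₀, hle₀⟩ := computes_construct ps qs
  obtain ⟨t₀, ht₀, hlt₀⟩ := hT₀.runs
  have step : ∀ i (x : Good i), ∃ y : Good (i + 1), ∃ t,
      implementation.RunsUpdate (x.1.1.enc qs) (ops i) (y.1.1.enc qs) t ∧
      t + 6720000 * y.1.1.cnt * lg y.1.2 ≤ 6720000 * x.1.1.cnt * lg x.1.2 +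
        22000000 * lg ((pointsAt ps.toFinset ops (i + 1)).card + qs.length) := by
    rintro i ⟨⟨st, w⟩, hinv, hk⟩
    obtain ⟨st', w', t, hrun, hinv', hk', hpot⟩ := runsUpdate hinv hk (ops i)
    exact ⟨⟨⟨st', w'⟩, hinv', hk'⟩, t, hrun, hpot⟩
  choose next time hrun hpot using step
  let x₀ : Good 0 := ⟨⟨st₀, w₀⟩, hinv₀, by rw [hcnt₀]; exact Nat.zero_le _⟩
  let f : ∀ i, Good i := fun i => Nat.rec x₀ (fun i x => next i x) i
  refine ⟨fun i => (f i).1.1.enc qs, t₀, fun i => time i (f i), ht₀, ?_, fun i => hrun i (f i),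
    fun m => ?_, fun i => (f i).2.1.maintains (f i).2.2 (by norm_num)⟩
  · have h1 := lg_le_log (ps.length + qs.length)
    have h2 : t₀ ≤ 25000002 * ((ps.length + qs.length + 1) * lg (ps.length + qs.length)) := by
      have : 1 ≤ (ps.length + qs.length + 1) * lg (ps.length + qs.length) :=
        Nat.mul_pos (by omega) (one_le_lg _)
      omega
    have h3 : (t₀ : ℝ) ≤ 25000002 * (((ps.length + qs.length : ℕ) + 1) *
      lg (ps.length + qs.length)) := by exact_mod_cast h2
    have h4 : (0 : ℝ) ≤ (ps.length + qs.length : ℕ) + 1 := by positivity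
    have h5 := mul_le_mul_of_nonneg_left h1 h4
    have h6 : (0 : ℝ) ≤ lg (ps.length + qs.length) := Nat.cast_nonneg _
    have h7 := mul_nonneg h4 h6
    rw [pow_one, mul_assoc]
    linarith
  -- The potential telescopes; it vanishes initially since `cnt` is zero after the construction, and
  -- the final one is dropped.
  · have hsum : ∀ m, ∑ i ∈ Finset.range m, time i (f i) + 6720000 * (f m).1.1.cnt * lg (f m).1.2 ≤
        ∑ i ∈ Finset.range m,
          22000000 * lg ((pointsAt ps.toFinset ops (i + 1)).card + qs.length) := by
      intro m
      induction m with
      | zero => simp [f, x₀, hcnt₀]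
      | succ m ih =>
        rw [Finset.sum_range_succ, Finset.sum_range_succ]
        have h1 := hpot m (f m)
        have h2 : f (m + 1) = next m (f m) := rfl
        rw [h2]
        omega
    have h1 : ∑ i ∈ Finset.range m, time i (f i) ≤ ∑ i ∈ Finset.range m,
        22000000 * lg ((pointsAt ps.toFinset ops (i + 1)).card + qs.length) :=
      (Nat.le_add_right _ _).trans (hsum m)
    have h2 : ∑ i ∈ Finset.range m, (time i (f i) : ℝ) ≤ ∑ i ∈ Finset.range m,
        22000000 * (lg ((pointsAt ps.toFinset ops (i + 1)).card + qs.length) : ℝ) := by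
      exact_mod_cast h1
    refine h2.trans (Finset.sum_le_sum fun i _ => ?_)
    have h3 := lg_le_log ((pointsAt ps.toFinset ops (i + 1)).card + qs.length)
    have h4 : (0 : ℝ) ≤ lg ((pointsAt ps.toFinset ops (i + 1)).card + qs.length) :=
      Nat.cast_nonneg _
    rw [pow_one]
    linarith
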